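/- \textbf{Setting.} A running server consumes power $P>0$; turning a server on (off) costs $\beta_{on}\ge 0$ ($\beta_{off}\ge0$), with $\beta_{on}+\beta_{off}>0$. Put $\Delta=(\beta_{on}+\beta_{off})/P$ and let $\alpha\in[0,1]$. A workload on $[0,T]$, $T>0$, consists of $a(0)$ jobs present at time $0$ and of job arrivals and departures at finitely many pairwise distinct times in $(0,T]$; $a(t)$ is the number of jobs in the system at time $t$ (events at time $t$ included). The cost of a right-continuous, piecewise constant $x:[0,T]\to\mathbb{Z}_{\ge 0}$, where $x(t)$ is the number of servers that are on, is $$P\int_0^T x(t)\,dt+\lim_{\delta\to0^+}\sum_{i=1}^{\lceil T/\delta\rceil}\Big(\beta_{on}\big[x(i\delta)-x((i-1)\delta)\big]^+ +\beta_{off}\big[x((i-1)\delta)-x(i\delta)\big]^+\Big)$$ (arguments beyond $T$ are read as $T$). The minimum cost $P^*$ is the infimum of the cost over all such $x$ with $x(t)\ge a(t)$ on $[0,T]$, $x(0)=a(0)$ and $x(T)=a(T)$. \textbf{Dispatching.} Under last-empty-server-first dispatching the servers that are not serving are kept in a stack (of unlimited supply); an arriving job is given to the server popped from the top, and a server that its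 job leaves is pushed onto the top. A deterministic online algorithm (under this dispatching, with look-ahead window $\alpha\Delta$) chooses for every workload the finite set of servers that are on at each time $t\in[0,T]$, right-continuous and piecewise constant in $t$, containing all serving servers, consisting of $a(t)$ servers at $t=0$ and $t=T$, and depending at time $t$ only on $a(0)$, on the arrivals and departures up to time $t$, and on the values of $a$ in $[t,t+\alpha\Delta]$ (including the end $T$ of the horizon, if it lies in this window). A randomized online algorithm is a random choice of a deterministic one for which the state of each server at each time is a random variable; its cost is the expected cost. An algorithm is $c$-competitive if its cost is at most $c\,P^*$ for all workloads that are not identically zero and satisfy $a(0)\le a(T)$. \textbf{Algorithms.} In A1, A2 and A3, a server that becomes empty waits idle for a time $Z$; if it has not received a job by then, it turns itself off, unless it will receive a job within the next $\alpha\Delta$ units of time (and before the end of the horizon), in which case it stays idle until then. All servers that are not serving are off at times $0$ and $T$. In A1, $Z=(1-\alpha)\Delta$. In A2 and A3 the waiting times of the different empty periods are independent; in A2, $Z$ has the density $\frac{e^{z/((1-\alpha)\Delta)}}{(e-1)(1-\alpha)\Delta}$ on $[0,(1-\alpha)\Delta]$; in A3, $\Pr(Z=0)=\frac{\alpha}{e-1+\alpha}$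 and $Z$ has the density $\Big(1-\frac{\alpha}{e-1+\alpha}\Big)\frac{e^{z/((1-\alpha)\Delta)}}{(e-1)(1-\alpha)\Delta}$ on $(0,(1-\alpha)\Delta]$. For $\alpha=1$, $Z=0$ in both. \textbf{Theorem.} A1 is a deterministic and A2 and A3 are randomized online algorithms in this sense. A1 is $c$-competitive with $c=2-\alpha$, A2 with $c=\frac{e-\alpha}{e-1}$, and A3 with $c=\frac{e}{e-1+\alpha}$. Moreover, for every workload, without any restriction on $a(0)$ and $a(T)$, the (expected) cost of the algorithm is at most $c\,P^*+(c-1)\,\beta_{on}\,[a(0)-a(T)]^+$ with the same $c$. The ratios of A1 and A3 are best possible: a $c$-competitive deterministic online algorithm under last-empty-server-first dispatching has $c\ge 2-\alpha$, and a $c$-competitive randomized one has $c\ge\frac{e}{e-1+\alpha}$. -/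

import Mathlib

open MeasureTheory Filter Topology
open scoped ENNReal

universe u

/-- The parameters of the model: a running server consumes power `P`, turning a server on (off)
costs `βon` (`βoff`), and the look-ahead window is the fraction `α` of the critical interval. -/
structure Model where
  P : ℝ
  βon : ℝ
  βoff : ℝ
  α : ℝ
  P_pos : 0 < P
  βon_nonneg : 0 ≤ βon
  βoff_nonneg : 0 ≤ βoff
  β_pos : 0 < βon + βoff
  α_nonneg : 0 ≤ α
  α_le_one : α ≤ 1

/-- The critical interval `Δ = (βon + βoff) / P`. -/
noncomputable def Model.Δ (M : Model) : ℝ := (M.βon + M.βoff) / M.P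

/-! ### Jobs and last-empty-server-first dispatching -/

/-- Jobs are labelled in the order of their arrival, so an arrival needs no label. -/
inductive JobEvent where
  | arrival : JobEvent
  | departure (j : ℕ) : JobEvent

/-- The record kept by the job-dispatching entity: the label of the next job, the labels of the
jobs in the system, the server that each job was assigned to, and the stack of the servers that
are not serving (its top is the head of the stream; the supply of servers is unlimited). -/
structure Center where
  next : ℕ
  present : Finset ℕ
  server : ℕ → ℕ
  stack : Stream' ℕ

/-- With `n` jobs in the system, jobs `0, …, n - 1` are served by servers `0, …, n - 1`, and all
the other servers are in the stack. -/
def Center.init (n : ℕ) : Center where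
  next := n
  present := Finset.range n
  server := id
  stack := fun k => n + k

/-- Upon an arrival, pop a server from the stack and assign the job to it; upon a departure,
push the server that the job leaves. -/
def Center.step (c : Center) : JobEvent → Center
  | .arrival =>
      { next := c.next + 1
        present := insert c.next c.present
        server := Function.update c.server c.next c.stack.head
        stack := c.stack.tail }
  | .departure j =>
      { next := c.next
        present := c.present.erase j
        server := c.server
        stack := Stream'.cons (c.server j) c.stack }

/-- The record after a list of timed events. -/
def Center.run (c : Center) (l : List (ℝ × JobEvent)) : Center :=
  l.foldl (fun c e => c.step e.2) c

/-- A workload on `[0, T]` in the continuous-time brick model: `a₀` jobs are in the system at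
time `0`, and after that jobs arrive and depart at pairwise distinct times. -/
structure Workload where
  T : ℝ
  T_pos : 0 < T
  a₀ : ℕ
  events : List (ℝ × JobEvent)
  sorted : events.Pairwise (fun e f => e.1 < f.1)
  mem_horizon : ∀ e ∈ events, 0 < e.1 ∧ e.1 ≤ T
  /-- only jobs that are in the system depart -/
  departs : ∀ l₁ t j l₂, events = l₁ ++ (t, JobEvent.departure j) :: l₂ →
    j ∈ ((Center.init a₀).run l₁).present

namespace Workload

/-- The events up to and including time `t`. -/
noncomputable def upTo (W : Workload) (t : ℝ) : List (ℝ × JobEvent) :=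
  W.events.filter (fun e => decide (e.1 ≤ t))

/-- The record of the dispatching entity at time `t`. -/
noncomputable def center (W : Workload) (t : ℝ) : Center :=
  (Center.init W.a₀).run (W.upTo t)

/-- The number `a(t)` of jobs in the system at time `t`. -/
noncomputable def a (W : Workload) (t : ℝ) : ℕ := (W.center t).present.card

/-- Server `s` is serving a job at time `t`. -/
def Serving (W : Workload) (s : ℕ) (t : ℝ) : Prop :=
  ∃ j ∈ (W.center t).present, (W.center t).server j = s

end Workload

/-! ### Operation cost and the problem SCP -/

/-- `f` is right-continuous and piecewise constant on `[0, T]`, with finitely many pieces. -/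
def IsStep {β : Type*} (T : ℝ) (f : ℝ → β) : Prop :=
  ∃ F : Finset ℝ, ∀ s t : ℝ, 0 ≤ s → s ≤ t → t ≤ T → (∀ p ∈ F, ¬ (s < p ∧ p ≤ t)) → f s = f t

/-- `P_on(t₁, t₂)`, for `x` given on `[t₁, t₂]`. For step functions the limit `δ → 0+` of the sums
exists, so that the upper limit is the limit; the natural-number difference is the positive part
`[·]⁺`, and grid points beyond `t₂` are read as `t₂`. -/
noncomputable def costOn (M : Model) (x : ℝ → ℕ) (t₁ t₂ : ℝ) : ℝ≥0∞ :=
  limsup (fun δ : ℝ => ENNReal.ofReal M.βon *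
    ((∑ i ∈ Finset.Icc 1 ⌈(t₂ - t₁) / δ⌉₊,
      (x (min (t₁ + i * δ) t₂) - x (min (t₁ + ((i : ℝ) - 1) * δ) t₂)) : ℕ) : ℝ≥0∞)) (𝓝[>] 0)

/-- `P_off(t₁, t₂)`, likewise. -/
noncomputable def costOff (M : Model) (x : ℝ → ℕ) (t₁ t₂ : ℝ) : ℝ≥0∞ :=
  limsup (fun δ : ℝ => ENNReal.ofReal M.βoff *
    ((∑ i ∈ Finset.Icc 1 ⌈(t₂ - t₁) / δ⌉₊,
      (x (min (t₁ + ((i : ℝ) - 1) * δ) t₂) - x (min (t₁ + i * δ) t₂)) : ℕ) : ℝ≥0∞)) (𝓝[>] 0)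

/-- The operation cost in `[0, T]` when `x(t)` servers are on at time `t`. -/
noncomputable def operationCost (M : Model) (T : ℝ) (x : ℝ → ℕ) : ℝ≥0∞ :=
  ENNReal.ofReal M.P * (∫⁻ t in Set.Icc 0 T, (x t : ℝ≥0∞)) + costOn M x 0 T + costOff M x 0 T

/-- The constraints of the problem SCP. -/
structure Feasible (W : Workload) (x : ℝ → ℕ) : Prop where
  step : IsStep W.T x
  demand : ∀ t, 0 ≤ t → t ≤ W.T → W.a t ≤ x t
  start : x 0 = W.a 0
  finish : x W.T = W.a W.T

/-- The minimum server operation cost of the problem SCP. -/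
noncomputable def optCost (M : Model) (W : Workload) : ℝ≥0∞ :=
  ⨅ (x : ℝ → ℕ) (_ : Feasible W x), operationCost M W.T x

/-! ### Online algorithms under last-empty-server-first dispatching -/

/-- A server on-off policy: the finite set of the servers that are on at each time. -/
abbrev Policy := Workload → ℝ → Finset ℕ

/-- The operation cost of a policy. -/
noncomputable def Policy.cost (M : Model) (A : Policy) (W : Workload) : ℝ≥0∞ :=
  operationCost M W.T (fun t => (A W t).card)

/-- What is known at time `t` with a look-ahead window of length `w` does not tell `W` from `W'`:
the past arrivals and departures agree, and so does the workload `a` in the window `[t, t + w]`,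
including the end of the horizon if that lies in the window. -/
structure SameInfo (W W' : Workload) (t w : ℝ) : Prop where
  start : W.a₀ = W'.a₀
  past : W.upTo t = W'.upTo t
  window : ∀ u, t ≤ u → u ≤ t + w → W.a u = W'.a u
  horizon : W.T ≤ t + w ∨ W'.T ≤ t + w → W.T = W'.T

/-- A deterministic online algorithm under last-empty-server-first dispatching with look-ahead
window `α Δ`: every server to which the dispatcher has given a job is on while it serves, the
boundary conditions hold, servers are toggled finitely often, and the decisions at time `t` depend
only on what is known at time `t`. -/
structure IsOnline (M : Model) (A : Policy) : Prop where
  serves : ∀ W t s, 0 ≤ t → t ≤ W.T → W.Serving s t → s ∈ A W t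
  start : ∀ W, (A W 0).card = W.a 0
  finish : ∀ W, (A W W.T).card = W.a W.T
  step : ∀ W, IsStep W.T (A W)
  nonanticipating : ∀ W W' t, 0 ≤ t → t ≤ W.T → t ≤ W'.T →
    SameInfo W W' t (M.α * M.Δ) → A W t = A W' t

/-- A randomized online algorithm: a random choice of a deterministic one, in which the state of
every server at every time is a random variable. -/
structure IsRandomizedOnline {Ω : Type*} [MeasurableSpace Ω] (M : Model) (A : Ω → Policy) :
    Prop where
  online : ∀ ω, IsOnline M (A ω)
  measurable : ∀ W t s, MeasurableSet {ω | s ∈ A ω W t}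

/-- The expected operation cost of a randomized algorithm. -/
noncomputable def expectedCost {Ω : Type*} [MeasurableSpace Ω] (M : Model) (μ : Measure Ω)
    (A : Ω → Policy) (W : Workload) : ℝ≥0∞ :=
  ∫⁻ ω, (A ω).cost M W ∂μ

/-- An algorithm whose (expected) operation cost is `C` is `c`-competitive: its cost is at most `c`
times the minimum, for all workloads that are not always zero and satisfy `a(0) ≤ a(T)`. -/
def IsCompetitive (M : Model) (C : Workload → ℝ≥0∞) (c : ℝ) : Prop :=
  ∀ W : Workload, (∃ t, 0 ≤ t ∧ t ≤ W.T ∧ W.a t ≠ 0) → W.a 0 ≤ W.a W.T →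
    C W ≤ ENNReal.ofReal c * optCost M W

/-- The bound for arbitrary boundary values: up to the term `(c - 1) βon [a(0) - a(T)]⁺`, which
depends on the boundary values alone, the cost is at most `c` times the minimum. -/
def IsCompetitiveUpToBoundary (M : Model) (C : Workload → ℝ≥0∞) (c : ℝ) : Prop :=
  ∀ W : Workload, C W ≤ ENNReal.ofReal c * optCost M W +
    ENNReal.ofReal ((c - 1) * M.βon) * ((W.a 0 - W.a W.T : ℕ) : ℝ≥0∞)

/-! ### The three algorithms -/

open Classical in
/-- The future-aware policy with waiting times `z`, where `z j` is the waiting time for the empty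
period that the departure of job `j` starts. If that period starts at `t₁`, the server waits idle
until `t₁ + z j`. If it has not received a job by then, it looks into the window
`[t₁ + z j, t₁ + z j + α Δ]` and turns itself off, unless it will receive a job in the window.
Servers that are not serving are off at time `0` and at time `T`. -/
noncomputable def waitPolicy (M : Model) (z : ℕ → ℝ) : Policy := fun W t =>
  (Finset.range (W.a₀ + W.events.length)).filter (fun s =>
    W.Serving s t ∨
      (t < W.T ∧ ∃ t₁ j, (t₁, JobEvent.departure j) ∈ W.events ∧ t₁ ≤ t ∧
        (W.center t).server j = s ∧
        (∀ u, t₁ ≤ u → u ≤ t → ¬ W.Serving s u) ∧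
        (t < t₁ + z j ∨
          ∃ τ, t₁ < τ ∧ τ ≤ t₁ + z j + M.α * M.Δ ∧ τ ≤ W.T ∧ W.Serving s τ)))

/-- Algorithm A1: wait for `(1 - α) Δ`. -/
noncomputable def algA1 (M : Model) : Policy := waitPolicy M (fun _ => (1 - M.α) * M.Δ)

/-- The law of the waiting time in A2 (the time is `0` if `α = 1`). -/
noncomputable def lawA2 (M : Model) : Measure ℝ :=
  if M.α < 1 then
    volume.withDensity ((Set.Icc 0 ((1 - M.α) * M.Δ)).indicator fun z =>
      ENNReal.ofReal (Real.exp (z / ((1 - M.α) * M.Δ)) /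
        ((Real.exp 1 - 1) * ((1 - M.α) * M.Δ))))
  else Measure.dirac 0

/-- The law of the waiting time in A3 (the time is `0` if `α = 1`): an atom of mass
`α / (e - 1 + α)` at `0`, and a density on `(0, (1 - α) Δ]`. -/
noncomputable def lawA3 (M : Model) : Measure ℝ :=
  if M.α < 1 then
    ENNReal.ofReal (M.α / (Real.exp 1 - 1 + M.α)) • Measure.dirac 0 +
    volume.withDensity ((Set.Ioc 0 ((1 - M.α) * M.Δ)).indicator fun z =>
      ENNReal.ofReal ((1 - M.α / (Real.exp 1 - 1 + M.α)) /
        ((Real.exp 1 - 1) * ((1 - M.α) * M.Δ)) * Real.exp (z / ((1 - M.α) * M.Δ))))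
  else Measure.dirac 0

theorem Model.Δ_pos (M : Model) : 0 < M.Δ := div_pos M.β_pos M.P_pos

theorem exp_one_sub_one_pos : 0 < Real.exp 1 - 1 := by
  have := Real.add_one_lt_exp (one_ne_zero (α := ℝ)); linarith

/-- The mass of an exponential density on `(0, c]`. -/
theorem lintegral_exp_density {c k : ℝ} (hc : 0 < c) (hk : 0 ≤ k) :
    ∫⁻ z in Set.Ioc 0 c, ENNReal.ofReal (k / ((Real.exp 1 - 1) * c) * Real.exp (z / c)) =
      ENNReal.ofReal k := by
  have he := exp_one_sub_one_pos
  rw [← ofReal_integral_eq_lintegral_ofReal]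
  · congr 1
    rw [← intervalIntegral.integral_of_le hc.le, intervalIntegral.integral_const_mul,
      intervalIntegral.integral_comp_div (fun x => Real.exp x) hc.ne', integral_exp]
    simp only [zero_div, div_self hc.ne', Real.exp_zero, smul_eq_mul]
    field_simp
  · have hcont : Continuous fun z : ℝ => k / ((Real.exp 1 - 1) * c) * Real.exp (z / c) := by
      fun_prop
    exact hcont.integrableOn_Ioc
  · exact Eventually.of_forall fun z => by positivity

instance (M : Model) : IsProbabilityMeasure (lawA2 M) := by
  unfold lawA2
  split_ifs with h
  · have hc : 0 < (1 - M.α) * M.Δ := mul_pos (by linarith) M.Δ_pos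
    constructor
    rw [withDensity_apply _ MeasurableSet.univ, Measure.restrict_univ,
      lintegral_indicator measurableSet_Icc, setLIntegral_congr Ioc_ae_eq_Icc.symm]
    have := lintegral_exp_density hc zero_le_one
    rw [ENNReal.ofReal_one] at this
    rw [← this]
    refine lintegral_congr fun z => ?_
    congr 1
    ring
  · infer_instance

instance (M : Model) : IsProbabilityMeasure (lawA3 M) := by
  unfold lawA3
  split_ifs with h
  · have hc : 0 < (1 - M.α) * M.Δ := mul_pos (by linarith) M.Δ_pos
    have he := exp_one_sub_one_pos
    have h0 := M.α_nonneg
    have h1 : 0 ≤ M.α / (Real.exp 1 - 1 + M.α) := by positivity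
    have h2 : M.α / (Real.exp 1 - 1 + M.α) ≤ 1 := by
      rw [div_le_one (by linarith)]; linarith
    constructor
    rw [Measure.add_apply, withDensity_apply _ MeasurableSet.univ, Measure.restrict_univ,
      lintegral_indicator measurableSet_Ioc, lintegral_exp_density hc (by linarith)]
    simp only [Measure.smul_apply, measure_univ, smul_eq_mul, mul_one]
    rw [← ENNReal.ofReal_add h1 (by linarith)]
    simp
  · infer_instance

/-- The randomized algorithm with independent waiting times of law `μ`; the sample is the sequence
of the waiting times. -/
noncomputable def waitTimes (μ : Measure ℝ) [IsProbabilityMeasure μ] : Measure (ℕ → ℝ) :=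
  Measure.infinitePi (fun _ => μ)

/-!
The cost of a profile `x` is `P ∫ x`, plus `βon + βoff` for each server that is turned on, plus a
boundary term (`operationCost_eq`): a server that is turned off was on at the start or has been
turned on before. With `Δ = (βon + βoff) / P`, an empty period of length `ℓ` thus costs at least
`P min(ℓ, Δ)` (`gapCost`).

*Empty periods.* Under last-empty-server-first dispatching an arrival ends the latest open empty
period, as a closing bracket matches an opening one. This pairing (`Ledger`) does not refer to
servers, so it structures the costs of all profiles alike. The servers in the stack are those of the
open empty periods, the latest on top, followed by the servers that have never served
(`Center.Tracks`). Hence the depth of a server in the stack together with `a` tells when it gets its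
next job (`Workload.serving_iff_of_stack`), which makes the future-aware policy online.

*Minimum cost.* By induction over a partition into pieces on which everything is constant, the
cost of a feasible profile up to time `t` covers the service, `gapCost` for each ended period,
`βon + βoff` for each arrival at a server that has never served, and `surplusCost` for the servers
in excess of the demand at time `t` (`Workload.lower_step`, `Workload.lowerCost_le_optCost`).

*Cost of the algorithms.* The same induction, now with the actual idling (`idleTime`), bounds the
cost of the policy by a sum over the empty periods in which each waiting time enters separately
(`Workload.cost_waitPolicy_le`). By linearity of expectation it suffices that the mean cost of an
ended period is at most `c · gapCost`, and that the mean idling of a period that does not end is at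
most `(c - 1) (βon + βoff)` (`isCompetitiveUpToBoundary_of_gap`); the numbers of periods that do not
end and of first arrivals differ by `a(0) - a(T)`. For the three laws these are elementary integrals.

*Optimality.* One job leaves, and another one arrives at the end of the horizon. Until the arrival
enters the look-ahead window, gaps of different lengths cannot be told apart
(`IsOnline.adversary_eq`). A deterministic algorithm is defeated by ending the gap just beyond the
window when the algorithm turns off (`two_sub_le_of_isCompetitive`). Against randomized algorithms
the part of the gap beyond the window gets the density `e ^ (-y / D) / D` on `[0, D]`, where
`D = (1 - α) Δ`, with the remaining mass `1 / e` at a long gap: then turning off within `D` has the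
mean cost `P Δ` whatever the time, and turning off later costs no less, while the mean of the
minimum cost is `P Δ (e - 1 + α) / e`. A discretization keeps everything finite
(`le_weighted_adversaryCost`, `weighted_gap_sum`), with the geometric weights `(1 - 1 / n) ^ k` in
the place of the exponential.
-/

/-! ### Partitions of the horizon and the cost of step functions -/

/-- The points `p 0 < p 1 < ⋯ < p n` divide `[0, T]` into `n` pieces; the values of `p` beyond `n`
are irrelevant, but strict monotonicity is required of them as well. -/
structure IsPartition (T : ℝ) (n : ℕ) (p : ℕ → ℝ) : Prop where
  strictMono : StrictMono p
  zero : p 0 = 0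
  last : p n = T

/-- `x` is constant on each of the pieces `[p i, p (i + 1))`. -/
def Adapted {β : Type*} (n : ℕ) (p : ℕ → ℝ) (x : ℝ → β) : Prop :=
  ∀ i < n, ∀ t, p i ≤ t → t < p (i + 1) → x t = x (p i)

theorem exists_isPartition (F : Finset ℝ) {T : ℝ} (hT : 0 < T) :
    ∃ (n : ℕ) (p : ℕ → ℝ), IsPartition T n p ∧
      ∀ q ∈ F, 0 ≤ q → q ≤ T → ∃ i ≤ n, p i = q := by
  classical
  set G : Finset ℝ := (insert 0 (insert T F)).filter (fun q => 0 ≤ q ∧ q ≤ T) with hG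
  have h0 : (0 : ℝ) ∈ G := by simp [hG, hT.le]
  have h1 : T ∈ G := by simp [hG, hT.le]
  have hcard : 0 < G.card := Finset.card_pos.mpr ⟨0, h0⟩
  have hle : ∀ q ∈ G, 0 ≤ q ∧ q ≤ T := fun q hq => (Finset.mem_filter.mp hq).2
  set f := G.orderEmbOfFin rfl with hf
  have hfG : ∀ i, f i ∈ G := fun i => Finset.orderEmbOfFin_mem G rfl i
  let p : ℕ → ℝ := fun i => if h : i < G.card then f ⟨i, h⟩ else T + i
  have hp : ∀ i (h : i < G.card), p i = f ⟨i, h⟩ := fun i h => dif_pos h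
  refine ⟨G.card - 1, p, ⟨?_, ?_, ?_⟩, ?_⟩
  · intro i j hij
    by_cases hj : j < G.card
    · rw [hp i (hij.trans hj), hp j hj]
      exact f.strictMono hij
    · have hjp : p j = T + j := dif_neg hj
      have hj0 : (0 : ℝ) < j := by exact_mod_cast (hcard.trans_le (not_lt.mp hj))
      by_cases hi : i < G.card
      · rw [hp i hi, hjp]
        linarith [(hle _ (hfG ⟨i, hi⟩)).2]
      · have hip : p i = T + i := dif_neg hi
        rw [hip, hjp]
        have : (i : ℝ) < j := by exact_mod_cast hij
        linarith
  · rw [hp 0 hcard, hf, Finset.orderEmbOfFin_zero rfl hcard]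
    exact le_antisymm (Finset.min'_le _ _ h0) (hle _ (Finset.min'_mem _ _)).1
  · rw [hp _ (by omega), hf, Finset.orderEmbOfFin_last rfl hcard]
    exact le_antisymm (hle _ (Finset.max'_mem _ _)).2 (Finset.le_max' _ _ h1)
  · intro q hq hq0 hqT
    have : q ∈ Set.range f := by
      rw [hf, Finset.range_orderEmbOfFin]
      simp [hG, hq, hq0, hqT]
    obtain ⟨⟨i, hi⟩, rfl⟩ := this
    exact ⟨i, by omega, hp i hi⟩

namespace IsPartition

variable {T : ℝ} {n : ℕ} {p : ℕ → ℝ}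

theorem nonneg (h : IsPartition T n p) (i : ℕ) : 0 ≤ p i := by
  rw [← h.zero]; exact h.strictMono.monotone (Nat.zero_le i)

theorem le_last (h : IsPartition T n p) {i : ℕ} (hi : i ≤ n) : p i ≤ T := by
  rw [← h.last]; exact h.strictMono.monotone hi

/-- A point that occurs in the partition does not lie inside a piece. -/
theorem not_between (h : IsPartition T n p) {q : ℝ} (hq : ∃ i ≤ n, p i = q) (i : ℕ) :
    ¬ (p i < q ∧ q < p (i + 1)) := by
  rintro ⟨h1, h2⟩
  obtain ⟨j, -, rfl⟩ := hq
  have := h.strictMono.lt_iff_lt.mp h1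
  have := h.strictMono.lt_iff_lt.mp h2
  omega

end IsPartition

/-- A step function, together with any finite set of points, has a common partition. -/
theorem IsStep.exists_adapted {β : Type*} {T : ℝ} {x : ℝ → β} (hx : IsStep T x) (F : Finset ℝ)
    (hT : 0 < T) : ∃ (n : ℕ) (p : ℕ → ℝ), IsPartition T n p ∧ Adapted n p x ∧
      ∀ q ∈ F, 0 ≤ q → q ≤ T → ∃ i ≤ n, p i = q := by
  classical
  obtain ⟨E, hE⟩ := hx
  obtain ⟨n, p, hp, hF⟩ := exists_isPartition (E ∪ F) hT
  refine ⟨n, p, hp, ?_, fun q hq => hF q (Finset.mem_union_right _ hq)⟩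
  intro i hi t h1 h2
  refine (hE (p i) t (hp.nonneg i) h1 (h2.le.trans (hp.le_last hi)) ?_).symm
  rintro q hq ⟨h3, h4⟩
  exact hp.not_between (hF q (Finset.mem_union_left _ hq) ((hp.nonneg i).trans h3.le)
    ((h4.trans h2.le).trans (hp.le_last hi))) i ⟨h3, h4.trans_lt h2⟩

/-- The increments of a step function along a fine enough grid are those along its partition,
since no grid interval jumps over a piece. -/
theorem eventually_grid_sum {β : Type*} {T : ℝ} {n : ℕ} {p : ℕ → ℝ} (hp : IsPartition T n p)
    {x : ℝ → β} (hx : Adapted n p x) (f : β → β → ℕ) (hf : ∀ b, f b b = 0) :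
    ∀ᶠ δ : ℝ in 𝓝[>] 0, ∑ i ∈ Finset.Icc 1 ⌈T / δ⌉₊,
        f (x (min (i * δ) T)) (x (min (((i : ℝ) - 1) * δ) T)) =
      ∑ i ∈ Finset.range n, f (x (p (i + 1))) (x (p i)) := by
  have hT : 0 ≤ T := hp.last ▸ hp.nonneg n
  have hsmall : ∀ᶠ δ : ℝ in 𝓝[>] 0, ∀ i ∈ Finset.range n, δ < p (i + 1) - p i := by
    rw [eventually_all_finset]
    intro i _
    exact nhdsWithin_le_nhds (Iio_mem_nhds (sub_pos.mpr (hp.strictMono (Nat.lt_succ_self i))))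
  filter_upwards [hsmall, self_mem_nhdsWithin] with δ hδ hδ0
  have hδ0 : 0 < δ := hδ0
  have key : ∀ m : ℕ, ∃ k ≤ n, p k ≤ min (m * δ) T ∧ (k < n → min (m * δ) T < p (k + 1)) ∧
      ∑ i ∈ Finset.Icc 1 m, f (x (min (i * δ) T)) (x (min (((i : ℝ) - 1) * δ) T)) =
        ∑ i ∈ Finset.range k, f (x (p (i + 1))) (x (p i)) := by
    have val : ∀ k ≤ n, ∀ t ≤ T, p k ≤ t → (k < n → t < p (k + 1)) → x t = x (p k) := by
      intro k hk t ht h1 h2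
      rcases hk.lt_or_eq with h | rfl
      · exact hx k h t h1 (h2 h)
      · rw [le_antisymm ht (hp.last ▸ h1), hp.last]
    intro m
    induction m with
    | zero =>
      refine ⟨0, Nat.zero_le n, ?_, ?_, by simp⟩
      · simp [hp.zero, hT]
      · intro _
        simp only [Nat.cast_zero, zero_mul, zero_add]
        rw [min_eq_left hT, ← hp.zero]
        exact hp.strictMono one_pos
    | succ m ih =>
      obtain ⟨k, hk, h1, h2, h3⟩ := ih
      have e : (((m + 1 : ℕ) : ℝ) - 1) * δ = m * δ := by push_cast; ring
      have hmono : min (m * δ) T ≤ min (((m + 1 : ℕ) : ℝ) * δ) T := by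
        refine min_le_min_right T ?_
        push_cast; nlinarith
      have hstep : min (((m + 1 : ℕ) : ℝ) * δ) T ≤ min (m * δ) T + δ := by
        rw [← min_add_add_right]
        refine min_le_min ?_ (by linarith)
        push_cast; linarith
      rw [Finset.sum_Icc_succ_top (by omega), h3, e, val k hk _ (min_le_right _ _) h1 h2]
      by_cases hlt : k < n ∧ p (k + 1) ≤ min (((m + 1 : ℕ) : ℝ) * δ) T
      · have h4 : k + 1 < n → min (((m + 1 : ℕ) : ℝ) * δ) T < p (k + 1 + 1) := by
          intro h
          have := hδ (k + 1) (Finset.mem_range.mpr h)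
          linarith [h2 hlt.1]
        refine ⟨k + 1, hlt.1, hlt.2, h4, ?_⟩
        rw [Finset.sum_range_succ, val (k + 1) hlt.1 _ (min_le_right _ _) hlt.2 h4]
      · have h4 : k < n → min (((m + 1 : ℕ) : ℝ) * δ) T < p (k + 1) := by
          intro h
          by_contra h'
          exact hlt ⟨h, not_lt.mp h'⟩
        refine ⟨k, hk, h1.trans hmono, h4, ?_⟩
        rw [val k hk _ (min_le_right _ _) (h1.trans hmono) h4, hf, add_zero]
  obtain ⟨k, hk, -, h2, h3⟩ := key ⌈T / δ⌉₊
  rw [h3]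
  have hend : min (⌈T / δ⌉₊ * δ) T = T := by
    refine min_eq_right ?_
    have := Nat.le_ceil (T / δ)
    rwa [div_le_iff₀ hδ0] at this
  rw [hend] at h2
  have : k = n := by
    by_contra hne
    have hlt : k < n := lt_of_le_of_ne hk hne
    exact absurd (h2 hlt) (not_lt.mpr (hp.le_last hlt))
  rw [this]

theorem lintegral_of_adapted {T : ℝ} {n : ℕ} {p : ℕ → ℝ} (hp : IsPartition T n p)
    {x : ℝ → ℕ} (hx : Adapted n p x) :
    ∫⁻ t in Set.Icc 0 T, (x t : ℝ≥0∞) =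
      ENNReal.ofReal (∑ i ∈ Finset.range n, x (p i) * (p (i + 1) - p i)) := by
  have hpos : ∀ i, 0 ≤ p (i + 1) - p i := fun i =>
    sub_nonneg.mpr (hp.strictMono (Nat.lt_succ_self i)).le
  have key : ∀ k ≤ n, ∫⁻ t in Set.Ico 0 (p k), (x t : ℝ≥0∞) =
      ENNReal.ofReal (∑ i ∈ Finset.range k, x (p i) * (p (i + 1) - p i)) := by
    intro k
    induction k with
    | zero => simp [hp.zero]
    | succ k ih =>
      intro hk
      have hle : p k ≤ p (k + 1) := (hp.strictMono (Nat.lt_succ_self k)).le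
      rw [← Set.Ico_union_Ico_eq_Ico (hp.nonneg k) hle,
        lintegral_union measurableSet_Ico (Set.Ico_disjoint_Ico_same), ih (by omega),
        Finset.sum_range_succ, ENNReal.ofReal_add
          (Finset.sum_nonneg fun i _ => mul_nonneg (Nat.cast_nonneg _) (hpos i))
          (mul_nonneg (Nat.cast_nonneg _) (hpos k))]
      congr 1
      rw [setLIntegral_congr_fun measurableSet_Ico
        (g := fun _ => (x (p k) : ℝ≥0∞)) fun t ht => by simp only [hx k (by omega) t ht.1 ht.2]]
      rw [setLIntegral_const, Real.volume_Ico, ENNReal.ofReal_mul (Nat.cast_nonneg _),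
        ENNReal.ofReal_natCast]
  rw [← key n le_rfl, hp.last]
  exact setLIntegral_congr Ico_ae_eq_Icc.symm

/-- The running cost plus `βon + βoff` for each server turned on, along the first `k` pieces. -/
noncomputable def startCost (M : Model) (p : ℕ → ℝ) (x : ℝ → ℕ) (k : ℕ) : ℝ :=
  ∑ i ∈ Finset.range k, (M.P * (x (p i) * (p (i + 1) - p i)) +
    (M.βon + M.βoff) * ((x (p (i + 1)) - x (p i) : ℕ) : ℝ))

/-- Every server that is turned off was on at time `0` or has been turned on before. Hence the
cost of turning off may be charged when a server is turned on, up to a boundary term. -/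
theorem operationCost_eq (M : Model) {T : ℝ} {n : ℕ} {p : ℕ → ℝ} (hp : IsPartition T n p)
    {x : ℝ → ℕ} (hx : Adapted n p x) :
    operationCost M T x =
      ENNReal.ofReal (startCost M p x n - M.βoff * ((x T : ℝ) - x 0)) := by
  have hpos : ∀ i, 0 ≤ p (i + 1) - p i := fun i =>
    sub_nonneg.mpr (hp.strictMono (Nat.lt_succ_self i)).le
  have hon : costOn M x 0 T = ENNReal.ofReal M.βon *
      ((∑ i ∈ Finset.range n, (x (p (i + 1)) - x (p i)) : ℕ) : ℝ≥0∞) := by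
    unfold costOn
    rw [limsup_congr (v := fun _ => ENNReal.ofReal M.βon *
      ((∑ i ∈ Finset.range n, (x (p (i + 1)) - x (p i)) : ℕ) : ℝ≥0∞)), limsup_const]
    filter_upwards [eventually_grid_sum hp hx (fun a b => a - b) (by simp)] with δ hδ
    simp only [sub_zero, zero_add]
    rw [hδ]
  have hoff : costOff M x 0 T = ENNReal.ofReal M.βoff *
      ((∑ i ∈ Finset.range n, (x (p i) - x (p (i + 1))) : ℕ) : ℝ≥0∞) := by
    unfold costOff
    rw [limsup_congr (v := fun _ => ENNReal.ofReal M.βoff *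
      ((∑ i ∈ Finset.range n, (x (p i) - x (p (i + 1))) : ℕ) : ℝ≥0∞)), limsup_const]
    filter_upwards [eventually_grid_sum hp hx (fun a b => b - a) (by simp)] with δ hδ
    simp only [sub_zero, zero_add]
    rw [hδ]
  have hsum : 0 ≤ ∑ i ∈ Finset.range n, x (p i) * (p (i + 1) - p i) :=
    Finset.sum_nonneg fun i _ => mul_nonneg (Nat.cast_nonneg _) (hpos i)
  rw [operationCost, hon, hoff, lintegral_of_adapted hp hx,
    ← ENNReal.ofReal_natCast (∑ i ∈ Finset.range n, (x (p (i + 1)) - x (p i))),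
    ← ENNReal.ofReal_natCast (∑ i ∈ Finset.range n, (x (p i) - x (p (i + 1)))),
    ← ENNReal.ofReal_mul M.P_pos.le, ← ENNReal.ofReal_mul M.βon_nonneg,
    ← ENNReal.ofReal_mul M.βoff_nonneg, ← ENNReal.ofReal_add, ← ENNReal.ofReal_add]
  · congr 1
    have htel : (x T : ℝ) - x 0 = ∑ i ∈ Finset.range n, ((x (p (i + 1)) : ℝ) - x (p i)) := by
      rw [Finset.sum_range_sub (fun i => (x (p i) : ℝ)), hp.zero, hp.last]
    rw [startCost, htel]
    push_cast
    simp only [Finset.mul_sum, ← Finset.sum_add_distrib, ← Finset.sum_sub_distrib]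
    refine Finset.sum_congr rfl fun i _ => ?_
    rcases le_total (x (p i)) (x (p (i + 1))) with h | h
    · rw [Nat.sub_eq_zero_of_le h, Nat.cast_sub h]; push_cast; ring
    · rw [Nat.sub_eq_zero_of_le h, Nat.cast_sub h]; push_cast; ring
  · exact add_nonneg (mul_nonneg M.P_pos.le hsum) (mul_nonneg M.βon_nonneg (Nat.cast_nonneg _))
  · exact mul_nonneg M.βoff_nonneg (Nat.cast_nonneg _)
  · exact mul_nonneg M.P_pos.le hsum
  · exact mul_nonneg M.βon_nonneg (Nat.cast_nonneg _)

theorem startCost_succ (M : Model) (p : ℕ → ℝ) (x : ℝ → ℕ) (k : ℕ) :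
    startCost M p x (k + 1) = startCost M p x k + (M.P * (x (p k) * (p (k + 1) - p k)) +
      (M.βon + M.βoff) * ((x (p (k + 1)) - x (p k) : ℕ) : ℝ)) :=
  Finset.sum_range_succ _ _

/-! ### Events in the course of time -/

theorem filter_le_prefix {β : Type*} {l : List (ℝ × β)} (hl : l.Pairwise (fun e f => e.1 < f.1))
    {s t : ℝ} (hst : s ≤ t) :
    ∃ l', l.filter (fun e => decide (e.1 ≤ t)) =
      l.filter (fun e => decide (e.1 ≤ s)) ++ l' := by
  induction l with
  | nil => exact ⟨[], rfl⟩
  | cons e l ih =>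
    rw [List.pairwise_cons] at hl
    by_cases hes : e.1 ≤ s
    · obtain ⟨l', h⟩ := ih hl.2
      refine ⟨l', ?_⟩
      rw [List.filter_cons_of_pos (by simpa using hes.trans hst),
        List.filter_cons_of_pos (by simpa using hes), h, List.cons_append]
    · have : (e :: l).filter (fun e => decide (e.1 ≤ s)) = [] := by
        rw [List.filter_eq_nil_iff]
        intro f hf
        rcases List.mem_cons.mp hf with rfl | hf
        · simpa using hes
        · simpa using (not_le.mp hes).trans (hl.1 f hf)
      exact ⟨_, by rw [this, List.nil_append]⟩

theorem filter_le_step {β : Type*} {l : List (ℝ × β)} (hl : l.Pairwise (fun e f => e.1 < f.1))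
    {s t : ℝ} (hst : s < t) (hno : ∀ e ∈ l, ¬ (s < e.1 ∧ e.1 < t)) :
    l.filter (fun e => decide (e.1 ≤ t)) = l.filter (fun e => decide (e.1 ≤ s)) ∨
      ∃ b, l.filter (fun e => decide (e.1 ≤ t)) =
        l.filter (fun e => decide (e.1 ≤ s)) ++ [(t, b)] := by
  induction l with
  | nil => exact Or.inl rfl
  | cons e l ih =>
    rw [List.pairwise_cons] at hl
    by_cases hes : e.1 ≤ s
    · rw [List.filter_cons_of_pos (by simpa using hes.trans hst.le),
        List.filter_cons_of_pos (by simpa using hes)]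
      rcases ih hl.2 (fun f hf => hno f (List.mem_cons_of_mem _ hf)) with h | ⟨b, h⟩
      · exact Or.inl (by rw [h])
      · exact Or.inr ⟨b, by rw [h, List.cons_append]⟩
    · have hte : t ≤ e.1 := not_lt.mp fun h => hno e (List.mem_cons_self) ⟨not_le.mp hes, h⟩
      have h1 : (e :: l).filter (fun e => decide (e.1 ≤ s)) = [] := by
        rw [List.filter_eq_nil_iff]
        intro f hf
        rcases List.mem_cons.mp hf with rfl | hf
        · simpa using hes
        · simpa using (not_le.mp hes).trans (hl.1 f hf)
      have h2 : l.filter (fun e => decide (e.1 ≤ t)) = [] := by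
        rw [List.filter_eq_nil_iff]
        intro f hf
        simpa using hte.trans_lt (hl.1 f hf)
      rw [h1]
      by_cases het : e.1 = t
      · refine Or.inr ⟨e.2, ?_⟩
        rw [List.filter_cons_of_pos (by simpa using het.le), h2, ← het, List.nil_append]
      · refine Or.inl ?_
        rw [List.filter_cons_of_neg (by simpa using lt_of_le_of_ne hte (Ne.symm het)), h2]

namespace Workload

variable (W : Workload)

theorem mem_upTo {t : ℝ} {e : ℝ × JobEvent} : e ∈ W.upTo t ↔ e ∈ W.events ∧ e.1 ≤ t := by
  simp [upTo, List.mem_filter]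

theorem upTo_prefix {s t : ℝ} (hst : s ≤ t) : ∃ l, W.upTo t = W.upTo s ++ l :=
  filter_le_prefix W.sorted hst

theorem upTo_isPrefix (t : ℝ) : ∃ l, W.events = W.upTo t ++ l := by
  obtain ⟨l, hl⟩ := W.upTo_prefix (le_max_left t W.T)
  refine ⟨l, ?_⟩
  rw [← hl, upTo, List.filter_eq_self.mpr]
  intro e he
  simpa using Or.inr (W.mem_horizon e he).2

theorem upTo_zero : W.upTo 0 = [] := by
  rw [upTo, List.filter_eq_nil_iff]
  intro e he
  simpa using (W.mem_horizon e he).1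

theorem upTo_eq_of_no_event {s t : ℝ} (hst : s ≤ t)
    (hno : ∀ e ∈ W.events, ¬ (s < e.1 ∧ e.1 ≤ t)) : W.upTo t = W.upTo s := by
  refine List.filter_congr fun e he => ?_
  simp only [decide_eq_decide]
  exact ⟨fun h => not_lt.mp fun h' => hno e he ⟨h', h⟩, fun h => h.trans hst⟩

theorem upTo_min_horizon (t : ℝ) : W.upTo (min t W.T) = W.upTo t := by
  refine List.filter_congr fun e he => ?_
  simp [(W.mem_horizon e he).2]

/-- Between two successive partition points the history is constant; at the later one at most one
event is added to it. -/
structure Next (s t : ℝ) : Prop where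
  nonneg : 0 ≤ s
  lt : s < t
  quiet : ∀ u, s ≤ u → u < t → W.upTo u = W.upTo s
  step : W.upTo t = W.upTo s ∨ ∃ e, W.upTo t = W.upTo s ++ [(t, e)]

theorem next_of_no_event {s t : ℝ} (hs : 0 ≤ s) (hst : s < t)
    (hno : ∀ e ∈ W.events, ¬ (s < e.1 ∧ e.1 < t)) : W.Next s t where
  nonneg := hs
  lt := hst
  quiet _ h1 h2 := W.upTo_eq_of_no_event h1 fun e he h => hno e he ⟨h.1, h.2.trans_lt h2⟩
  step := filter_le_step W.sorted hst hno

/-- The times of the events. -/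
noncomputable def times : Finset ℝ := (W.events.map Prod.fst).toFinset

theorem mem_times {e : ℝ × JobEvent} (he : e ∈ W.events) : e.1 ∈ W.times := by
  simp only [times, List.mem_toFinset, List.mem_map]
  exact ⟨e, he, rfl⟩

theorem next_of_partition {T : ℝ} {n : ℕ} {p : ℕ → ℝ} (hp : IsPartition T n p)
    (hF : ∀ q ∈ W.times, 0 ≤ q → q ≤ T → ∃ i ≤ n, p i = q) {i : ℕ} (hi : i < n) :
    W.Next (p i) (p (i + 1)) := by
  refine W.next_of_no_event (hp.nonneg i) (hp.strictMono (Nat.lt_succ_self i)) ?_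
  rintro e he ⟨h1, h2⟩
  exact hp.not_between (hF e.1 (W.mem_times he) (W.mem_horizon e he).1.le
    (h2.le.trans (hp.le_last hi))) i ⟨h1, h2⟩

theorem time_induction {Q : ℝ → Prop} {t₀ : ℝ} (ht₀ : 0 ≤ t₀) (start : Q t₀)
    (step : ∀ s t, t₀ ≤ s → W.Next s t → Q s → Q t) {t : ℝ} (ht : t₀ ≤ t) : Q t := by
  classical
  rcases ht.eq_or_lt with rfl | hlt
  · exact start
  · obtain ⟨n, p, hp, hF⟩ :=
      exists_isPartition (W.times.image (fun q => q - t₀)) (sub_pos.mpr hlt)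
    have key : ∀ i ≤ n, Q (t₀ + p i) := by
      intro i
      induction i with
      | zero => intro _; rw [hp.zero, add_zero]; exact start
      | succ i ih =>
        intro hi
        have h0 := hp.nonneg i
        refine step _ _ (by linarith) (W.next_of_no_event (by linarith)
          (by linarith [hp.strictMono (Nat.lt_succ_self i)]) ?_) (ih (by omega))
        rintro e he ⟨h1, h2⟩
        have h3 := hp.le_last hi
        exact hp.not_between (hF (e.1 - t₀) (Finset.mem_image_of_mem _ (W.mem_times he))
          (by linarith) (by linarith)) i ⟨by linarith, by linarith⟩
    have := key n le_rfl
    rwa [hp.last, add_sub_cancel] at this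

theorem center_append {s t : ℝ} {l : List (ℝ × JobEvent)} (h : W.upTo t = W.upTo s ++ l) :
    W.center t = (W.center s).run l := by
  rw [center, h, Center.run, List.foldl_append]; rfl

theorem center_congr {s t : ℝ} (h : W.upTo t = W.upTo s) : W.center t = W.center s := by
  rw [center, h, center]

theorem center_event {s t : ℝ} {e : JobEvent} (h : W.upTo t = W.upTo s ++ [(t, e)]) :
    W.center t = (W.center s).step e := W.center_append h

theorem mem_present_of_departure {s t : ℝ} {j : ℕ}
    (h : W.upTo t = W.upTo s ++ [(t, JobEvent.departure j)]) : j ∈ (W.center s).present := by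
  obtain ⟨l, hl⟩ := W.upTo_isPrefix t
  rw [h, List.append_assoc] at hl
  exact W.departs _ _ _ _ hl

theorem a_congr {s t : ℝ} (h : W.upTo t = W.upTo s) : W.a t = W.a s := by
  rw [a, W.center_congr h, a]

theorem serving_congr {s t : ℝ} (h : W.upTo t = W.upTo s) (r : ℕ) :
    W.Serving r t ↔ W.Serving r s := by
  rw [Serving, W.center_congr h, Serving]

end Workload

theorem Center.run_server (c : Center) (l : List (ℝ × JobEvent)) :
    c.next ≤ (c.run l).next ∧ ∀ j < c.next, (c.run l).server j = c.server j := by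
  induction l generalizing c with
  | nil => exact ⟨le_rfl, fun _ _ => rfl⟩
  | cons e l ih =>
    obtain ⟨h1, h2⟩ := ih (c.step e.2)
    have h3 : c.next ≤ (c.step e.2).next := by cases e.2 <;> simp [Center.step]
    refine ⟨h3.trans h1, fun j hj => (h2 j (hj.trans_le h3)).trans ?_⟩
    cases e.2 with
    | arrival => simp [Center.step, Function.update_of_ne hj.ne]
    | departure i => rfl

/-! ### Pairing departures with the arrivals that end their empty periods -/

/-- The bookkeeping of the empty periods. An empty period is recorded as the pair of its starting
time and the departing job. -/
structure Ledger where
  /-- the empty periods that have not ended, the latest first -/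
  opens : List (ℝ × ℕ)
  /-- the empty periods that have ended, together with their ends -/
  pairs : List ((ℝ × ℕ) × ℝ)
  /-- the number of the arrivals that were given to servers that had never served before -/
  firsts : ℕ

/-- A departure opens an empty period; an arrival ends the latest one that is open. -/
def Ledger.step (L : Ledger) (e : ℝ × JobEvent) : Ledger :=
  match e.2 with
  | .departure j => { L with opens := (e.1, j) :: L.opens }
  | .arrival =>
    match L.opens with
    | [] => { L with firsts := L.firsts + 1 }
    | d :: ds => { L with opens := ds, pairs := (d, e.1) :: L.pairs }

/-- The ledger at time `t`. -/
noncomputable def Workload.ledger (W : Workload) (t : ℝ) : Ledger :=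
  (W.upTo t).foldl Ledger.step ⟨[], [], 0⟩

/-- The servers from number `N` on, in increasing order. -/
def serversFrom (N : ℕ) : Stream' ℕ := fun k => N + k

theorem serversFrom_get (N k : ℕ) : (serversFrom N).get k = N + k := rfl

theorem serversFrom_tail (N : ℕ) : (serversFrom N).tail = serversFrom (N + 1) := by
  ext k
  simp only [Stream'.get_tail, serversFrom_get]
  omega

/-- The ledger describes the record `c` of the dispatching entity: on top of the stack are the
servers of the open empty periods, and below them the servers that have never served. -/
structure Center.Tracks (c : Center) (L : Ledger) (a₀ : ℕ) : Prop where
  present_lt : ∀ j ∈ c.present, j < c.next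
  opens_lt : ∀ d ∈ L.opens, d.2 < c.next
  server_lt : ∀ j ∈ c.present, c.server j < a₀ + L.firsts
  idle_lt : ∀ d ∈ L.opens, c.server d.2 < a₀ + L.firsts
  injOn : Set.InjOn c.server c.present
  nodup : (L.opens.map (fun d => c.server d.2)).Nodup
  disjoint : ∀ j ∈ c.present, ∀ d ∈ L.opens, c.server d.2 ≠ c.server j
  stack_eq : c.stack = L.opens.map (fun d => c.server d.2) ++ₛ serversFrom (a₀ + L.firsts)
  card_eq : c.present.card + L.opens.length = a₀ + L.firsts

namespace Center

theorem tracks_init (a₀ : ℕ) : (Center.init a₀).Tracks ⟨[], [], 0⟩ a₀ where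
  present_lt j hj := by simpa [Center.init] using hj
  opens_lt d hd := by simp at hd
  server_lt j hj := by simpa [Center.init] using hj
  idle_lt d hd := by simp at hd
  injOn := Set.injOn_id _
  nodup := by simp
  disjoint j _ d hd := by simp at hd
  stack_eq := rfl
  card_eq := by simp [Center.init]

variable {c : Center} {L : Ledger} {a₀ : ℕ}

theorem Tracks.departure (h : c.Tracks L a₀) {j : ℕ} (hj : j ∈ c.present) (t : ℝ) :
    (c.step (.departure j)).Tracks (L.step (t, .departure j)) a₀ where
  present_lt i hi := h.present_lt i (Finset.mem_of_mem_erase hi)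
  opens_lt d hd := by
    rcases List.mem_cons.mp hd with rfl | hd
    · exact h.present_lt j hj
    · exact h.opens_lt d hd
  server_lt i hi := h.server_lt i (Finset.mem_of_mem_erase hi)
  idle_lt d hd := by
    rcases List.mem_cons.mp hd with rfl | hd
    · exact h.server_lt j hj
    · exact h.idle_lt d hd
  injOn := h.injOn.mono (Finset.coe_subset.mpr (Finset.erase_subset _ _))
  nodup := by
    simp only [Ledger.step, step, List.map_cons, List.nodup_cons]
    refine ⟨fun hm => ?_, h.nodup⟩
    obtain ⟨d, hd, he⟩ := List.mem_map.mp hm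
    exact h.disjoint j hj d hd he
  disjoint i hi d hd := by
    have hi' := Finset.mem_erase.mp hi
    rcases List.mem_cons.mp hd with rfl | hd
    · exact fun he => hi'.1 (h.injOn hi'.2 hj he.symm)
    · exact h.disjoint i hi'.2 d hd
  stack_eq := by
    simp only [Ledger.step, step, List.map_cons, Stream'.cons_append_stream]
    rw [h.stack_eq]
  card_eq := by
    have h1 : 0 < c.present.card := Finset.card_pos.mpr ⟨j, hj⟩
    have h2 := h.card_eq
    simp only [Ledger.step, step, Finset.card_erase_of_mem hj, List.length_cons]
    omega

theorem Tracks.arrival (h : c.Tracks L a₀) (t : ℝ) :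
    (c.step .arrival).Tracks (L.step (t, .arrival)) a₀ := by
  have hne : ∀ j ∈ c.present, j ≠ c.next := fun j hj => (h.present_lt j hj).ne
  have hne' : ∀ d ∈ L.opens, d.2 ≠ c.next := fun d hd => (h.opens_lt d hd).ne
  have hnot : c.next ∉ c.present := fun hm => hne _ hm rfl
  have hcard := h.card_eq
  have hnodup := h.nodup
  have hstack := h.stack_eq
  obtain ⟨opens, pairs, firsts⟩ := L
  cases opens with
  | nil =>
    have hhead : c.stack.head = a₀ + firsts := by rw [hstack]; rfl
    simp only [Ledger.step, step]
    constructor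
    · intro j hj
      rcases Finset.mem_insert.mp hj with rfl | hj
      · exact Nat.lt_succ_self _
      · exact (h.present_lt j hj).trans (Nat.lt_succ_self _)
    · simp
    · intro j hj
      rcases Finset.mem_insert.mp hj with rfl | hj
      · simp only [Function.update_self, hhead]; omega
      · simp only [Function.update_of_ne (hne j hj)]
        have := h.server_lt j hj
        simp only at this; omega
    · simp
    · intro i hi j hj hij
      simp only [Finset.coe_insert, Set.mem_insert_iff, Finset.mem_coe] at hi hj
      rcases hi with rfl | hi <;> rcases hj with rfl | hj
      · rfl
      · simp only [Function.update_self, Function.update_of_ne (hne j hj), hhead] at hij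
        exact absurd hij (h.server_lt j hj).ne'
      · simp only [Function.update_self, Function.update_of_ne (hne i hi), hhead] at hij
        exact absurd hij (h.server_lt i hi).ne
      · simp only [Function.update_of_ne (hne i hi), Function.update_of_ne (hne j hj)] at hij
        exact h.injOn hi hj hij
    · simp
    · simp
    · change c.stack.tail = serversFrom (a₀ + (firsts + 1))
      rw [hstack, List.map_nil, Stream'.nil_append_stream, serversFrom_tail, add_assoc]
    · rw [Finset.card_insert_of_notMem hnot]
      simp only [List.length_nil] at hcard ⊢
      omega
  | cons d ds =>
    have hhead : c.stack.head = c.server d.2 := by rw [hstack]; rfl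
    have hmap : ∀ e ∈ ds, Function.update c.server c.next c.stack.head e.2 = c.server e.2 :=
      fun e he => Function.update_of_ne (hne' e (List.mem_cons_of_mem _ he)) _ _
    have hmap' : ds.map (fun e => Function.update c.server c.next c.stack.head e.2) =
        ds.map (fun e => c.server e.2) := List.map_congr_left hmap
    simp only [List.map_cons, List.nodup_cons] at hnodup
    have hd : d ∈ d :: ds := List.mem_cons_self
    simp only [Ledger.step, step]
    constructor
    · intro j hj
      rcases Finset.mem_insert.mp hj with rfl | hj
      · exact Nat.lt_succ_self _
      · exact (h.present_lt j hj).trans (Nat.lt_succ_self _)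
    · intro e he
      exact (h.opens_lt e (List.mem_cons_of_mem _ he)).trans (Nat.lt_succ_self _)
    · intro j hj
      rcases Finset.mem_insert.mp hj with rfl | hj
      · simp only [Function.update_self, hhead]; exact h.idle_lt d hd
      · simp only [Function.update_of_ne (hne j hj)]; exact h.server_lt j hj
    · intro e he
      simp only [hmap e he]; exact h.idle_lt e (List.mem_cons_of_mem _ he)
    · intro i hi j hj hij
      simp only [Finset.coe_insert, Set.mem_insert_iff, Finset.mem_coe] at hi hj
      rcases hi with rfl | hi <;> rcases hj with rfl | hj
      · rfl
      · simp only [Function.update_self, Function.update_of_ne (hne j hj), hhead] at hij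
        exact absurd hij (h.disjoint j hj d hd)
      · simp only [Function.update_self, Function.update_of_ne (hne i hi), hhead] at hij
        exact absurd hij.symm (h.disjoint i hi d hd)
      · simp only [Function.update_of_ne (hne i hi), Function.update_of_ne (hne j hj)] at hij
        exact h.injOn hi hj hij
    · simp only [hmap']; exact hnodup.2
    · intro j hj e he
      simp only [hmap e he]
      rcases Finset.mem_insert.mp hj with rfl | hj
      · simp only [Function.update_self, hhead]
        exact fun heq => hnodup.1 (List.mem_map.mpr ⟨e, he, heq⟩)
      · simp only [Function.update_of_ne (hne j hj)]
        exact h.disjoint j hj e (List.mem_cons_of_mem _ he)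
    · simp only [hmap']
      rw [hstack, List.map_cons, Stream'.cons_append_stream, Stream'.tail_cons]
    · rw [Finset.card_insert_of_notMem hnot]
      simp only [List.length_cons] at hcard ⊢
      omega

theorem Tracks.mem_stack (h : c.Tracks L a₀) {d : ℝ × ℕ} (hd : d ∈ L.opens) :
    ∃ k, c.stack.get k = c.server d.2 := by
  rw [h.stack_eq]
  obtain ⟨k, hk, rfl⟩ := List.mem_iff_getElem.mp hd
  exact ⟨k, by rw [Stream'.get_append_left _ _ _ (by simpa using hk)]; simp⟩

/-- The servers in the stack are not serving. -/
theorem Tracks.stack_ne (h : c.Tracks L a₀) (k : ℕ) {j : ℕ} (hj : j ∈ c.present) :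
    c.stack.get k ≠ c.server j := by
  rw [h.stack_eq]
  by_cases hk : k < L.opens.length
  · rw [Stream'.get_append_left _ _ _ (by simpa using hk), List.getElem_map]
    exact h.disjoint j hj _ (List.getElem_mem hk)
  · obtain ⟨m, rfl⟩ := Nat.exists_eq_add_of_le (not_lt.mp hk)
    have := Stream'.get_append_right m (L.opens.map (fun d => c.server d.2))
      (serversFrom (a₀ + L.firsts))
    rw [List.length_map] at this
    rw [this]
    have := h.server_lt j hj
    rw [serversFrom_get]
    omega

end Center

namespace Workload

variable (W : Workload)

theorem ledger_congr {s t : ℝ} (h : W.upTo t = W.upTo s) : W.ledger t = W.ledger s := by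
  rw [ledger, h, ledger]

theorem ledger_event {s t : ℝ} {e : JobEvent} (h : W.upTo t = W.upTo s ++ [(t, e)]) :
    W.ledger t = (W.ledger s).step (t, e) := by
  rw [ledger, h, List.foldl_append]; rfl

theorem ledger_zero : W.ledger 0 = ⟨[], [], 0⟩ := by
  rw [ledger, W.upTo_zero]; rfl

theorem center_zero : W.center 0 = Center.init W.a₀ := by
  rw [center, W.upTo_zero]; rfl

theorem tracks {t : ℝ} (ht : 0 ≤ t) : (W.center t).Tracks (W.ledger t) W.a₀ := by
  refine W.time_induction (Q := fun t => (W.center t).Tracks (W.ledger t) W.a₀) le_rfl ?_ ?_ ht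
  · rw [W.center_zero, W.ledger_zero]; exact Center.tracks_init _
  · intro s t _ hn ih
    rcases hn.step with h | ⟨e, h⟩
    · rw [W.center_congr h, W.ledger_congr h]; exact ih
    · rw [W.center_event h, W.ledger_event h]
      cases e with
      | arrival => exact ih.arrival t
      | departure j => exact ih.departure (W.mem_present_of_departure h) t

theorem server_eq {s t : ℝ} (hst : s ≤ t) {j : ℕ} (hj : j < (W.center s).next) :
    (W.center t).server j = (W.center s).server j := by
  obtain ⟨l, hl⟩ := W.upTo_prefix hst
  rw [W.center_append hl]
  exact ((W.center s).run_server l).2 j hj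

/-- The server that a departing job leaves. -/
noncomputable def serverOf (d : ℝ × ℕ) : ℕ := (W.center d.1).server d.2

theorem not_serving_of_mem_opens {t : ℝ} (ht : 0 ≤ t) {d : ℝ × ℕ} (hd : d ∈ (W.ledger t).opens) :
    ¬ W.Serving ((W.center t).server d.2) t := by
  rintro ⟨j, hj, he⟩
  exact (W.tracks ht).disjoint j hj d hd he.symm

/-- The server of an open empty period has not served since the period began. -/
theorem opens_spec {t : ℝ} (ht : 0 ≤ t) : ∀ d ∈ (W.ledger t).opens,
    d.1 ≤ t ∧ (d.1, JobEvent.departure d.2) ∈ W.events ∧ d.2 < (W.center d.1).next ∧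
      ∀ u, d.1 ≤ u → u ≤ t → ¬ W.Serving (W.serverOf d) u := by
  refine W.time_induction (Q := fun t => ∀ d ∈ (W.ledger t).opens,
    d.1 ≤ t ∧ (d.1, JobEvent.departure d.2) ∈ W.events ∧ d.2 < (W.center d.1).next ∧
      ∀ u, d.1 ≤ u → u ≤ t → ¬ W.Serving (W.serverOf d) u) le_rfl ?_ ?_ ht
  · rw [W.ledger_zero]; simp
  · intro s t hs hn ih d hd
    have ht : 0 ≤ t := hs.trans hn.lt.le
    have old : d ∈ (W.ledger s).opens → d.1 ≤ t ∧ (d.1, JobEvent.departure d.2) ∈ W.events ∧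
        d.2 < (W.center d.1).next ∧ ∀ u, d.1 ≤ u → u ≤ t → ¬ W.Serving (W.serverOf d) u := by
      intro h
      obtain ⟨h1, h2, h3, h4⟩ := ih d h
      refine ⟨h1.trans hn.lt.le, h2, h3, fun u hu hut => ?_⟩
      rcases hut.lt_or_eq with hlt | rfl
      · rcases le_total u s with hus | hsu
        · exact h4 u hu hus
        · rw [W.serving_congr (hn.quiet u hsu hlt)]
          exact h4 s h1 le_rfl
      · rw [serverOf, ← W.server_eq hu h3]
        exact W.not_serving_of_mem_opens ht hd
    rcases hn.step with h | ⟨e, h⟩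
    · rw [W.ledger_congr h] at hd
      exact old hd
    · cases e with
      | arrival =>
        refine old ?_
        rw [W.ledger_event h] at hd
        revert hd
        generalize W.ledger s = L
        rcases L with ⟨_ | ⟨b, bs⟩, pairs, firsts⟩
        · simp [Ledger.step]
        · intro hd
          exact List.mem_cons_of_mem _ hd
      | departure j =>
        have hd' := hd
        rw [W.ledger_event h] at hd
        rcases List.mem_cons.mp hd with rfl | hd
        · refine ⟨le_rfl, (W.mem_upTo.mp (h.symm ▸ by simp : (t, JobEvent.departure j) ∈ W.upTo t)).1, ?_, fun u hu hut => ?_⟩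
          · exact (W.tracks ht).opens_lt _ hd'
          · obtain rfl := le_antisymm hut hu
            exact W.not_serving_of_mem_opens ht hd'
        · exact old hd

/-- An empty period that has begun is open until its server serves again. -/
theorem mem_opens_or_serving {t t₁ : ℝ} {j : ℕ} (ht : 0 ≤ t)
    (hd : (t₁, JobEvent.departure j) ∈ W.events) (h₁ : t₁ ≤ t) :
    j < (W.center t₁).next ∧ ((t₁, j) ∈ (W.ledger t).opens ∨
      ∃ u, t₁ < u ∧ u ≤ t ∧ W.Serving (W.serverOf (t₁, j)) u) := by
  refine W.time_induction (Q := fun t => t₁ ≤ t → j < (W.center t₁).next ∧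
    ((t₁, j) ∈ (W.ledger t).opens ∨
      ∃ u, t₁ < u ∧ u ≤ t ∧ W.Serving (W.serverOf (t₁, j)) u)) le_rfl ?_ ?_ ht h₁
  · intro h
    exact absurd (W.mem_horizon _ hd).1 (not_lt.mpr h)
  · intro s t hs hn ih h₁
    have hm : (t₁, JobEvent.departure j) ∈ W.upTo t := W.mem_upTo.mpr ⟨hd, h₁⟩
    have ht : 0 ≤ t := hs.trans hn.lt.le
    rcases hn.step with h | ⟨e, h⟩
    · rw [h] at hm
      obtain ⟨h1, h2⟩ := ih (W.mem_upTo.mp hm).2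
      rw [W.ledger_congr h]
      exact ⟨h1, h2.imp id fun ⟨u, hu1, hu2, hu3⟩ => ⟨u, hu1, hu2.trans hn.lt.le, hu3⟩⟩
    · rw [h, List.mem_append, List.mem_singleton] at hm
      rcases hm with hm | hm
      · have hs1 : t₁ ≤ s := (W.mem_upTo.mp hm).2
        obtain ⟨h1, h2⟩ := ih hs1
        refine ⟨h1, ?_⟩
        rcases h2 with h2 | ⟨u, hu1, hu2, hu3⟩
        · cases e with
          | departure i =>
            left
            rw [W.ledger_event h]
            exact List.mem_cons_of_mem _ h2
          | arrival =>
            have hT := W.tracks hs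
            have hst := hT.stack_eq
            rw [W.ledger_event h]
            generalize hL : W.ledger s = L at h2 hst
            rcases L with ⟨_ | ⟨b, bs⟩, pairs, firsts⟩
            · simp at h2
            · rcases List.mem_cons.mp h2 with rfl | h2
              · right
                refine ⟨t, hs1.trans_lt hn.lt, le_rfl, ?_⟩
                refine ⟨(W.center s).next, ?_, ?_⟩
                · rw [W.center_event h]; simp [Center.step]
                · rw [W.center_event h, serverOf]
                  simp only [Center.step, Function.update_self]
                  rw [hst, ← W.server_eq hs1 h1]; rfl
              · exact Or.inl h2
        · exact Or.inr ⟨u, hu1, hu2.trans hn.lt.le, hu3⟩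
      · obtain ⟨rfl, rfl⟩ := Prod.mk.inj hm
        have hmem : (t₁, j) ∈ (W.ledger t₁).opens := by
          rw [W.ledger_event h]; exact List.mem_cons_self
        exact ⟨(W.tracks ht).opens_lt _ hmem, Or.inl hmem⟩

theorem pairs_le {t : ℝ} (ht : 0 ≤ t) : ∀ b ∈ (W.ledger t).pairs, b.1.1 ≤ b.2 := by
  refine W.time_induction (Q := fun t => ∀ b ∈ (W.ledger t).pairs, b.1.1 ≤ b.2) le_rfl ?_ ?_ ht
  · rw [W.ledger_zero]; simp
  · intro s t hs hn ih
    rcases hn.step with h | ⟨e, h⟩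
    · rw [W.ledger_congr h]; exact ih
    · cases e with
      | departure j => rw [W.ledger_event h]; exact ih
      | arrival =>
        rw [W.ledger_event h]
        have hO := W.opens_spec hs
        generalize W.ledger s = L at ih hO
        rcases L with ⟨_ | ⟨b, bs⟩, pairs, firsts⟩
        · exact ih
        · intro d hd
          rcases List.mem_cons.mp hd with rfl | hd
          · exact (hO b List.mem_cons_self).1.trans hn.lt.le
          · exact ih d hd

theorem a_add_opens {t : ℝ} (ht : 0 ≤ t) :
    W.a t + (W.ledger t).opens.length = W.a₀ + (W.ledger t).firsts := (W.tracks ht).card_eq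

theorem a_zero : W.a 0 = W.a₀ := by
  rw [a, W.center_zero]; simp [Center.init]

theorem a_arrival {s t : ℝ} (hs : 0 ≤ s) (h : W.upTo t = W.upTo s ++ [(t, JobEvent.arrival)]) :
    W.a t = W.a s + 1 := by
  rw [a, W.center_event h, Center.step, Finset.card_insert_of_notMem, a]
  exact fun hm => ((W.tracks hs).present_lt _ hm).ne rfl

theorem a_departure {s t : ℝ} {j : ℕ}
    (h : W.upTo t = W.upTo s ++ [(t, JobEvent.departure j)]) : W.a t + 1 = W.a s := by
  have hj := W.mem_present_of_departure h
  rw [a, W.center_event h, Center.step, Finset.card_erase_of_mem hj, a]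
  exact Nat.sub_add_cancel (Finset.card_pos.mpr ⟨j, hj⟩)

/-- The server at depth `k` of the stack serves as soon as the number of jobs exceeds its present
value by more than `k`. This is what makes the next job of an empty server visible in the values
of `a`. -/
theorem serving_iff_of_stack {t : ℝ} (ht : 0 ≤ t) {r k : ℕ} (hk : (W.center t).stack.get k = r)
    {τ : ℝ} (hτ : t ≤ τ) :
    (∃ u, t < u ∧ u ≤ τ ∧ W.Serving r u ∧ W.a t + k < W.a u) ∨
      ((∀ u, t < u → u ≤ τ → ¬ W.Serving r u ∧ W.a u ≤ W.a t + k) ∧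
        ∃ k', (W.center τ).stack.get k' = r ∧ k' + W.a τ = k + W.a t) := by
  refine W.time_induction (Q := fun τ =>
    (∃ u, t < u ∧ u ≤ τ ∧ W.Serving r u ∧ W.a t + k < W.a u) ∨
      ((∀ u, t < u → u ≤ τ → ¬ W.Serving r u ∧ W.a u ≤ W.a t + k) ∧
        ∃ k', (W.center τ).stack.get k' = r ∧ k' + W.a τ = k + W.a t)) ht ?_ ?_ hτ
  · exact Or.inr ⟨fun u h1 h2 => absurd h1 (not_lt.mpr h2), k, hk, rfl⟩
  · intro s τ hts hn ih
    rcases ih with ⟨u, h1, h2, h3, h4⟩ | ⟨h1, k', h2, h3⟩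
    · exact Or.inl ⟨u, h1, h2.trans hn.lt.le, h3, h4⟩
    have hs : 0 ≤ s := ht.trans hts
    have hτ0 : 0 ≤ τ := hs.trans hn.lt.le
    have hs_not : ¬ W.Serving r s := by
      rintro ⟨j, hj, he⟩
      exact (W.tracks hs).stack_ne k' hj (h2.trans he.symm)
    have before : ∀ u, t < u → u < τ → ¬ W.Serving r u ∧ W.a u ≤ W.a t + k := by
      intro u h4 h5
      rcases le_total u s with h6 | h6
      · exact h1 u h4 h6
      · rw [W.serving_congr (hn.quiet u h6 h5), W.a_congr (hn.quiet u h6 h5)]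
        exact ⟨hs_not, by omega⟩
    have later : ∀ k'', (W.center τ).stack.get k'' = r → k'' + W.a τ = k + W.a t →
        ((∀ u, t < u → u ≤ τ → ¬ W.Serving r u ∧ W.a u ≤ W.a t + k) ∧
        ∃ k', (W.center τ).stack.get k' = r ∧ k' + W.a τ = k + W.a t) := by
      intro k'' h4 h5
      refine ⟨fun u h6 h7 => ?_, k'', h4, h5⟩
      rcases h7.lt_or_eq with h7 | rfl
      · exact before u h6 h7
      · refine ⟨?_, by omega⟩
        rintro ⟨j, hj, he⟩
        exact (W.tracks hτ0).stack_ne k'' hj (h4.trans he.symm)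
    rcases hn.step with h | ⟨e, h⟩
    · refine Or.inr (later k' ?_ ?_)
      · rw [W.center_congr h, h2]
      · rw [W.a_congr h, h3]
    · cases e with
      | departure j =>
        refine Or.inr (later (k' + 1) ?_ ?_)
        · rw [W.center_event h]; exact h2
        · have := W.a_departure h; omega
      | arrival =>
        have ha := W.a_arrival hs h
        cases k' with
        | zero =>
          refine Or.inl ⟨τ, hts.trans_lt hn.lt, le_rfl, ?_, by omega⟩
          refine ⟨(W.center s).next, ?_, ?_⟩
          · rw [W.center_event h]; simp [Center.step]
          · rw [W.center_event h]
            simp only [Center.step, Function.update_self]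
            exact h2
        | succ k' =>
          refine Or.inr (later k' ?_ (by omega))
          rw [W.center_event h]; exact h2

end Workload

/-! ### The future-aware policy is online -/

namespace Workload

variable (W : Workload)

theorem firsts_le_length {t : ℝ} (ht : 0 ≤ t) : (W.ledger t).firsts ≤ (W.upTo t).length := by
  refine W.time_induction (Q := fun t => (W.ledger t).firsts ≤ (W.upTo t).length) le_rfl ?_ ?_ ht
  · rw [W.ledger_zero]; exact Nat.zero_le _
  · intro s t _ hn ih
    rcases hn.step with h | ⟨e, h⟩
    · rw [W.ledger_congr h, h]; exact ih
    · rw [W.ledger_event h, h, List.length_append, List.length_singleton]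
      generalize W.ledger s = L at ih
      rcases L with ⟨_ | ⟨b, bs⟩, pairs, firsts⟩ <;> cases e <;> simp only [Ledger.step] at ih ⊢ <;>
        omega

theorem length_upTo_le (t : ℝ) : (W.upTo t).length ≤ W.events.length :=
  List.length_filter_le _ _

theorem Serving.lt {W : Workload} {r : ℕ} {t : ℝ} (ht : 0 ≤ t) (h : W.Serving r t) :
    r < W.a₀ + W.events.length := by
  obtain ⟨j, hj, rfl⟩ := h
  have := (W.tracks ht).server_lt j hj
  have := W.firsts_le_length ht
  have := W.length_upTo_le t
  omega

/-- The empty period `d` ends by a job at time `b` at the latest. -/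
def ReturnsBy (d : ℝ × ℕ) (b : ℝ) : Prop :=
  ∃ τ, d.1 < τ ∧ τ ≤ b ∧ τ ≤ W.T ∧ W.Serving (W.serverOf d) τ

/-- With waiting times `z`, the server of the open empty period `d` is on at time `t`. -/
def Idles (M : Model) (z : ℕ → ℝ) (d : ℝ × ℕ) (t : ℝ) : Prop :=
  t < W.T ∧ (t < d.1 + z d.2 ∨ W.ReturnsBy d (d.1 + z d.2 + M.α * M.Δ))

theorem Idles.anti {W : Workload} {M : Model} {z : ℕ → ℝ} {d : ℝ × ℕ} {s t : ℝ} (hst : s ≤ t)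
    (h : W.Idles M z d t) : W.Idles M z d s :=
  ⟨hst.trans_lt h.1, h.2.imp hst.trans_lt id⟩

theorem serverOf_eq {t : ℝ} (ht : 0 ≤ t) {d : ℝ × ℕ} (hd : d ∈ (W.ledger t).opens) :
    (W.center t).server d.2 = W.serverOf d :=
  W.server_eq (W.opens_spec ht d hd).1 (W.opens_spec ht d hd).2.2.1

theorem mem_waitPolicy {M : Model} {z : ℕ → ℝ} {t : ℝ} (ht : 0 ≤ t) {r : ℕ} :
    r ∈ waitPolicy M z W t ↔ W.Serving r t ∨
      ∃ d ∈ (W.ledger t).opens, W.serverOf d = r ∧ W.Idles M z d t := by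
  simp only [waitPolicy, Finset.mem_filter, Finset.mem_range]
  constructor
  · rintro ⟨-, h | ⟨hT, t₁, j, he, h1, rfl, h2, h3⟩⟩
    · exact Or.inl h
    · right
      obtain ⟨h4, h5⟩ := W.mem_opens_or_serving ht he h1
      have hr : (W.center t).server j = W.serverOf (t₁, j) := W.server_eq h1 h4
      rcases h5 with h5 | ⟨u, h6, h7, h8⟩
      · refine ⟨(t₁, j), h5, hr.symm, hT, h3.imp id ?_⟩
        rintro ⟨τ, h6, h7, h8, h9⟩
        exact ⟨τ, h6, h7, h8, hr ▸ h9⟩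
      · exact absurd (hr ▸ h8) (h2 u h6.le h7)
  · rintro (h | ⟨d, hd, rfl, hT, h⟩)
    · exact ⟨h.lt ht, Or.inl h⟩
    · obtain ⟨h1, h2, -, h4⟩ := W.opens_spec ht d hd
      refine ⟨?_, Or.inr ⟨hT, d.1, d.2, h2, h1, W.serverOf_eq ht hd, h4, h⟩⟩
      rw [← W.serverOf_eq ht hd]
      have := (W.tracks ht).idle_lt d hd
      have := W.firsts_le_length ht
      have := W.length_upTo_le t
      omega

open Classical in
theorem card_waitPolicy {M : Model} {z : ℕ → ℝ} {t : ℝ} (ht : 0 ≤ t) :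
    (waitPolicy M z W t).card =
      W.a t + (W.ledger t).opens.countP (fun d => decide (W.Idles M z d t)) := by
  have hT := W.tracks ht
  have hset : waitPolicy M z W t = (W.center t).present.image (W.center t).server ∪
      (((W.ledger t).opens.filter (fun d => decide (W.Idles M z d t))).map
        (fun d => (W.center t).server d.2)).toFinset := by
    ext r
    rw [W.mem_waitPolicy ht]
    simp only [Finset.mem_union, Finset.mem_image, List.mem_toFinset, List.mem_map,
      List.mem_filter, decide_eq_true_eq, Serving]
    refine or_congr Iff.rfl ⟨?_, ?_⟩
    · rintro ⟨d, hd, h1, h2⟩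
      exact ⟨d, ⟨hd, h2⟩, (W.serverOf_eq ht hd).trans h1⟩
    · rintro ⟨d, ⟨hd, h2⟩, h1⟩
      exact ⟨d, hd, (W.serverOf_eq ht hd).symm.trans h1, h2⟩
  rw [hset, Finset.card_union_of_disjoint, Finset.card_image_of_injOn hT.injOn,
    List.toFinset_card_of_nodup, List.length_map, ← List.countP_eq_length_filter, a]
  · exact hT.nodup.sublist (List.Sublist.map _ List.filter_sublist)
  · rw [Finset.disjoint_left]
    intro r h1 h2
    obtain ⟨j, hj, rfl⟩ := Finset.mem_image.mp h1
    obtain ⟨d, hd, he⟩ := List.mem_map.mp (List.mem_toFinset.mp h2)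
    exact hT.disjoint j hj d (List.mem_of_mem_filter hd) he

/-- The waiting times run out at these times. -/
noncomputable def deadlines (z : ℕ → ℝ) : Finset ℝ :=
  (W.events.map (fun e => match e.2 with
    | .departure j => e.1 + z j
    | .arrival => e.1)).toFinset

theorem mem_deadlines (z : ℕ → ℝ) {t : ℝ} (ht : 0 ≤ t) {d : ℝ × ℕ}
    (hd : d ∈ (W.ledger t).opens) : d.1 + z d.2 ∈ W.deadlines z := by
  simp only [deadlines, List.mem_toFinset, List.mem_map]
  exact ⟨_, (W.opens_spec ht d hd).2.1, rfl⟩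

theorem card_waitPolicy_zero (M : Model) (z : ℕ → ℝ) : (waitPolicy M z W 0).card = W.a 0 := by
  rw [W.card_waitPolicy le_rfl, W.ledger_zero]; simp

theorem card_waitPolicy_horizon (M : Model) (z : ℕ → ℝ) :
    (waitPolicy M z W W.T).card = W.a W.T := by
  rw [W.card_waitPolicy W.T_pos.le, List.countP_eq_zero.mpr, add_zero]
  intro d _
  simp [Idles]

end Workload

namespace SameInfo

variable {W W' : Workload} {t w : ℝ}

theorem symm (h : SameInfo W W' t w) : SameInfo W' W t w :=
  ⟨h.start.symm, h.past.symm, fun u h1 h2 => (h.window u h1 h2).symm,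
    fun hT => (h.horizon hT.symm).symm⟩

theorem center_eq (h : SameInfo W W' t w) : W.center t = W'.center t := by
  rw [Workload.center, Workload.center, h.start, h.past]

theorem ledger_eq (h : SameInfo W W' t w) : W.ledger t = W'.ledger t := by
  rw [Workload.ledger, Workload.ledger, h.past]

/-- If the waiting time has run out, the window shows whether the server will receive a job by the
time in question: its depth in the stack is known. -/
theorem idles {M : Model} {z : ℕ → ℝ} (h : SameInfo W W' t (M.α * M.Δ)) (ht : 0 ≤ t)
    (htT' : t ≤ W'.T) {d : ℝ × ℕ} (hd : d ∈ (W.ledger t).opens) (hi : W.Idles M z d t) :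
    W'.Idles M z d t := by
  have hw : 0 ≤ M.α * M.Δ := mul_nonneg M.α_nonneg M.Δ_pos.le
  have hd' : d ∈ (W'.ledger t).opens := h.ledger_eq ▸ hd
  have hr : W.serverOf d = W'.serverOf d := by
    rw [← W.serverOf_eq ht hd, ← W'.serverOf_eq ht hd', h.center_eq]
  have hlt : t < W'.T := by
    refine htT'.lt_of_ne fun he => ?_
    have := h.horizon (Or.inr (by linarith))
    have := hi.1
    linarith
  refine ⟨hlt, ?_⟩
  rcases hi.2 with h1 | ⟨τ, h1, h2, h3, h4⟩
  · exact Or.inl h1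
  by_cases hz : t < d.1 + z d.2
  · exact Or.inl hz
  right
  obtain ⟨k, hk⟩ := (W.tracks ht).mem_stack hd
  rw [W.serverOf_eq ht hd] at hk
  obtain ⟨hdt, -, -, hno⟩ := W.opens_spec ht d hd
  have htτ : t < τ := by
    by_contra hc
    exact hno τ h1.le (not_lt.mp hc) h4
  have hup : ∃ u, t < u ∧ u ≤ τ ∧ W.a t + k < W.a u := by
    rcases W.serving_iff_of_stack ht hk htτ.le with ⟨u, h5, h6, -, h7⟩ | ⟨h5, -⟩
    · exact ⟨u, h5, h6, h7⟩
    · exact absurd h4 (h5 τ htτ le_rfl).1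
  obtain ⟨u, h5, h6, h7⟩ := hup
  rw [h.window t le_rfl (by linarith), h.window u h5.le (by linarith)] at h7
  -- after the end of the horizon nothing happens
  rw [← W'.a_congr (W'.upTo_min_horizon u)] at h7
  have hk' : (W'.center t).stack.get k = W'.serverOf d := by rw [← h.center_eq, ← hr, hk]
  have htu : t < min u W'.T := lt_min h5 hlt
  rcases W'.serving_iff_of_stack ht hk' htu.le with ⟨v, h8, h9, h10, -⟩ | ⟨h8, -⟩
  · exact ⟨v, hdt.trans_lt h8, by linarith [h9.trans (min_le_left _ _)],
      h9.trans (min_le_right _ _), h10⟩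
  · have := (h8 _ htu le_rfl).2
    omega

theorem waitPolicy_subset {M : Model} {z : ℕ → ℝ} (h : SameInfo W W' t (M.α * M.Δ)) (ht : 0 ≤ t)
    (htT' : t ≤ W'.T) : waitPolicy M z W t ⊆ waitPolicy M z W' t := by
  intro r hr
  rw [W.mem_waitPolicy ht] at hr
  rw [W'.mem_waitPolicy ht]
  rcases hr with hr | ⟨d, hd, h1, h2⟩
  · left
    rwa [Workload.Serving, ← h.center_eq]
  · have hd' : d ∈ (W'.ledger t).opens := h.ledger_eq ▸ hd
    refine Or.inr ⟨d, hd', ?_, h.idles ht htT' hd h2⟩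
    rw [← h1, ← W.serverOf_eq ht hd, ← W'.serverOf_eq ht hd', h.center_eq]

end SameInfo

theorem isStep_waitPolicy (M : Model) (z : ℕ → ℝ) (W : Workload) :
    IsStep W.T (waitPolicy M z W) := by
  classical
  refine ⟨W.times ∪ W.deadlines z ∪ {W.T}, fun s t hs hst htT hno => ?_⟩
  have hup : W.upTo t = W.upTo s := W.upTo_eq_of_no_event hst fun e he h =>
    hno e.1 (by simp [W.mem_times he]) h
  ext r
  rw [W.mem_waitPolicy hs, W.mem_waitPolicy (hs.trans hst), W.serving_congr hup,
    W.ledger_congr hup]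
  refine or_congr Iff.rfl (exists_congr fun d => and_congr_right fun hd => and_congr_right fun _ =>
    ⟨fun h => ⟨?_, ?_⟩, Workload.Idles.anti hst⟩)
  · refine htT.lt_of_ne fun he => hno W.T (by simp) ⟨h.1, he.ge⟩
  · refine h.2.imp (fun h' => ?_) id
    by_contra hc
    exact hno _ (by simp [W.mem_deadlines z hs hd]) ⟨h', not_lt.mp hc⟩

theorem isOnline_waitPolicy (M : Model) (z : ℕ → ℝ) : IsOnline M (waitPolicy M z) where
  serves W _ _ ht _ h := (W.mem_waitPolicy ht).mpr (Or.inl h)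
  start W := W.card_waitPolicy_zero M z
  finish W := W.card_waitPolicy_horizon M z
  step W := isStep_waitPolicy M z W
  nonanticipating _ _ _ ht hT hT' h :=
    (h.waitPolicy_subset ht hT').antisymm (h.symm.waitPolicy_subset ht hT)

/-- Whether a given server is on at a given time depends on the waiting times through finitely many
comparisons. -/
theorem measurableSet_mem_waitPolicy (M : Model) (W : Workload) (t : ℝ) (r : ℕ) :
    MeasurableSet {z : ℕ → ℝ | r ∈ waitPolicy M z W t} := by
  have hsplit : {z : ℕ → ℝ | r ∈ waitPolicy M z W t} =
      {z | r < W.a₀ + W.events.length ∧ W.Serving r t} ∪ ⋃ j : ℕ, ⋃ t₁ ∈ W.times,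
        {z | (r < W.a₀ + W.events.length ∧ t < W.T ∧ (t₁, JobEvent.departure j) ∈ W.events ∧
          t₁ ≤ t ∧ (W.center t).server j = r ∧ ∀ u, t₁ ≤ u → u ≤ t → ¬ W.Serving r u) ∧
          (t - t₁ < z j ∨
            z j ∈ {y | ∃ τ, (t₁ < τ ∧ τ ≤ W.T ∧ W.Serving r τ) ∧ τ ≤ t₁ + y + M.α * M.Δ})} := by
    ext z
    simp only [waitPolicy, Finset.mem_filter, Finset.mem_range, Set.mem_ofPred_eq, Set.mem_union,
      Set.mem_iUnion, exists_prop]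
    constructor
    · rintro ⟨h0, h | ⟨hT, t₁, j, he, h1, h2, h3, h4⟩⟩
      · exact Or.inl ⟨h0, h⟩
      · refine Or.inr ⟨j, t₁, W.mem_times he, ⟨h0, hT, he, h1, h2, h3⟩, h4.imp ?_ ?_⟩
        · intro h; linarith
        · rintro ⟨τ, h5, h6, h7, h8⟩
          exact ⟨τ, ⟨h5, h7, h8⟩, h6⟩
    · rintro (⟨h0, h⟩ | ⟨j, t₁, -, ⟨h0, hT, he, h1, h2, h3⟩, h4⟩)
      · exact ⟨h0, Or.inl h⟩
      · refine ⟨h0, Or.inr ⟨hT, t₁, j, he, h1, h2, h3, h4.imp ?_ ?_⟩⟩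
        · intro h; linarith
        · rintro ⟨τ, ⟨h5, h7, h8⟩, h6⟩
          exact ⟨τ, h5, h6, h7, h8⟩
  rw [hsplit]
  refine (MeasurableSet.const _).union (MeasurableSet.iUnion fun j =>
    Finset.measurableSet_biUnion _ fun t₁ _ => ?_)
  have hup : MeasurableSet
      {y | ∃ τ, (t₁ < τ ∧ τ ≤ W.T ∧ W.Serving r τ) ∧ τ ≤ t₁ + y + M.α * M.Δ} := by
    refine (IsUpperSet.ordConnected ?_).measurableSet
    rintro x y hxy ⟨τ, h1, h2⟩
    exact ⟨τ, h1, by linarith⟩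
  have hpre := measurableSet_preimage (measurable_pi_apply (X := fun _ : ℕ => ℝ) j) hup
  exact MeasurableSet.inter (MeasurableSet.const _) (MeasurableSet.union
    (measurableSet_lt measurable_const (measurable_pi_apply j)) hpre)

theorem isRandomizedOnline_waitPolicy (M : Model) : IsRandomizedOnline M (waitPolicy M) where
  online z := isOnline_waitPolicy M z
  measurable W t r := measurableSet_mem_waitPolicy M W t r

/-! ### A lower bound for the minimum cost -/

theorem Model.β_nonneg (M : Model) : 0 ≤ M.βon + M.βoff := M.β_pos.le

theorem Model.P_mul_Δ (M : Model) : M.P * M.Δ = M.βon + M.βoff :=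
  mul_div_cancel₀ _ M.P_pos.ne'

/-- The least cost of an empty period of length `ℓ`: idling, or turning off and on again. -/
noncomputable def gapCost (M : Model) (ℓ : ℝ) : ℝ := min (M.P * ℓ) (M.βon + M.βoff)

theorem gapCost_nonneg (M : Model) {ℓ : ℝ} (h : 0 ≤ ℓ) : 0 ≤ gapCost M ℓ :=
  le_min (mul_nonneg M.P_pos.le h) M.β_nonneg

theorem gapCost_add_le (M : Model) (ℓ : ℝ) {h : ℝ} (hh : 0 ≤ h) :
    gapCost M (ℓ + h) ≤ gapCost M ℓ + M.P * h := by
  have := mul_nonneg M.P_pos.le hh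
  rw [gapCost, gapCost, ← min_add_add_right, mul_add]
  exact min_le_min le_rfl (by linarith)

/-- What `m` servers beyond the demand must have cost by time `t` if `opens` are the open empty
periods: the servers at the top of the stack have been kept on, or turned on again, during their
empty periods, and the servers below them have been turned on. -/
noncomputable def surplusCost (M : Model) (t : ℝ) : List (ℝ × ℕ) → ℕ → ℝ
  | _, 0 => 0
  | [], m + 1 => (M.βon + M.βoff) * (m + 1)
  | d :: ds, m + 1 => gapCost M (t - d.1) + surplusCost M t ds m

section surplusCost

variable (M : Model) {t : ℝ}

theorem surplusCost_zero (l : List (ℝ × ℕ)) : surplusCost M t l 0 = 0 := by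
  cases l <;> rfl

theorem surplusCost_nil (m : ℕ) : surplusCost M t [] m = (M.βon + M.βoff) * m := by
  cases m <;> simp [surplusCost]

theorem surplusCost_succ {l : List (ℝ × ℕ)} (hl : ∀ d ∈ l, d.1 ≤ t) (m : ℕ) :
    surplusCost M t l m ≤ surplusCost M t l (m + 1) ∧
      surplusCost M t l (m + 1) ≤ surplusCost M t l m + (M.βon + M.βoff) := by
  induction l generalizing m with
  | nil =>
    have := M.β_nonneg
    simp only [surplusCost_nil]
    push_cast
    constructor <;> linarith
  | cons d ds ih =>
    have hds : ∀ e ∈ ds, e.1 ≤ t := fun e he => hl e (List.mem_cons_of_mem _ he)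
    cases m with
    | zero =>
      have h1 := gapCost_nonneg M (sub_nonneg.mpr (hl d List.mem_cons_self))
      have h2 : gapCost M (t - d.1) ≤ M.βon + M.βoff := min_le_right _ _
      simp only [surplusCost, surplusCost_zero, add_zero]
      constructor <;> linarith
    | succ m =>
      simp only [surplusCost]
      obtain ⟨h1, h2⟩ := ih hds m
      constructor <;> linarith

theorem surplusCost_mono {l : List (ℝ × ℕ)} (hl : ∀ d ∈ l, d.1 ≤ t) :
    Monotone (surplusCost M t l) :=
  monotone_nat_of_le_succ fun m => (surplusCost_succ M hl m).1

theorem surplusCost_nonneg {l : List (ℝ × ℕ)} (hl : ∀ d ∈ l, d.1 ≤ t) (m : ℕ) :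
    0 ≤ surplusCost M t l m := by
  rw [← surplusCost_zero M l]; exact surplusCost_mono M hl (Nat.zero_le m)

theorem surplusCost_add_le {l : List (ℝ × ℕ)} (hl : ∀ d ∈ l, d.1 ≤ t) (m k : ℕ) :
    surplusCost M t l (m + k) ≤ surplusCost M t l m + (M.βon + M.βoff) * k := by
  induction k with
  | zero => simp
  | succ k ih =>
    have := (surplusCost_succ M hl (m + k)).2
    rw [← add_assoc]
    push_cast
    linarith

/-- Turning on `x' - x` servers pays for the growth of the surplus. -/
theorem surplusCost_jump {l : List (ℝ × ℕ)} (hl : ∀ d ∈ l, d.1 ≤ t) {x x' a : ℕ} :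
    surplusCost M t l (x' - a) ≤
      surplusCost M t l (x - a) + (M.βon + M.βoff) * ((x' - x : ℕ) : ℝ) :=
  (surplusCost_mono M hl (by omega)).trans (surplusCost_add_le M hl (x - a) (x' - x))

theorem surplusCost_time {s : ℝ} (hst : s ≤ t) (l : List (ℝ × ℕ)) (m : ℕ) :
    surplusCost M t l m ≤ surplusCost M s l m + M.P * (m * (t - s)) := by
  induction l generalizing m with
  | nil =>
    rw [surplusCost_nil, surplusCost_nil]
    have := mul_nonneg M.P_pos.le (mul_nonneg (Nat.cast_nonneg m) (sub_nonneg.mpr hst))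
    linarith
  | cons d ds ih =>
    cases m with
    | zero => simp [surplusCost_zero]
    | succ m =>
      have h1 := gapCost_add_le M (s - d.1) (sub_nonneg.mpr hst)
      rw [show s - d.1 + (t - s) = t - d.1 by ring] at h1
      have h2 := ih m
      simp only [surplusCost]
      push_cast
      linarith

end surplusCost

namespace Workload

variable (W : Workload)

/-- The total service time `∫ a(t) dt`. -/
noncomputable def load : ℝ := (∫⁻ t in Set.Icc 0 W.T, (W.a t : ℝ≥0∞)).toReal

theorem load_nonneg : 0 ≤ W.load := ENNReal.toReal_nonneg

theorem adapted_a {n : ℕ} {p : ℕ → ℝ} (hn : ∀ i < n, W.Next (p i) (p (i + 1))) :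
    Adapted n p W.a := fun i hi _ h1 h2 => W.a_congr ((hn i hi).quiet _ h1 h2)

theorem load_eq {n : ℕ} {p : ℕ → ℝ} (hp : IsPartition W.T n p) (ha : Adapted n p W.a) :
    W.load = ∑ i ∈ Finset.range n, W.a (p i) * (p (i + 1) - p i) := by
  rw [load, lintegral_of_adapted hp ha, ENNReal.toReal_ofReal]
  exact Finset.sum_nonneg fun i _ => mul_nonneg (Nat.cast_nonneg _)
    (sub_nonneg.mpr (hp.strictMono (Nat.lt_succ_self i)).le)

/-- The cost of serving, of the ended empty periods at the least, and of turning on servers for the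
first time. -/
noncomputable def lowerCost (M : Model) : ℝ :=
  M.P * W.load + ((W.ledger W.T).pairs.map (fun b => gapCost M (b.2 - b.1.1))).sum +
    (M.βon + M.βoff) * (W.ledger W.T).firsts

/-- One step of the lower bound: if the cost up to `s` covers the ended empty periods and the
surplus, so does the cost up to `t`. -/
theorem lower_step (M : Model) {x : ℝ → ℕ} {s t : ℝ} (hn : W.Next s t) (hxs : W.a s ≤ x s)
    (hxt : W.a t ≤ x t) :
    ((W.ledger t).pairs.map (fun b => gapCost M (b.2 - b.1.1))).sum +
        (M.βon + M.βoff) * (W.ledger t).firsts +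
        surplusCost M t (W.ledger t).opens (x t - W.a t) + M.P * (W.a s * (t - s)) ≤
      ((W.ledger s).pairs.map (fun b => gapCost M (b.2 - b.1.1))).sum +
        (M.βon + M.βoff) * (W.ledger s).firsts +
        surplusCost M s (W.ledger s).opens (x s - W.a s) +
        (M.P * (x s * (t - s)) + (M.βon + M.βoff) * ((x t - x s : ℕ) : ℝ)) := by
  have hl : ∀ d ∈ (W.ledger s).opens, d.1 ≤ t := fun d hd =>
    (W.opens_spec hn.nonneg d hd).1.trans hn.lt.le
  have h1 := surplusCost_time M hn.lt.le (W.ledger s).opens (x s - W.a s)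
  have h2 := surplusCost_jump M hl (x := x s) (x' := x t) (a := W.a s)
  rw [Nat.cast_sub hxs] at h1
  have h3 : surplusCost M t (W.ledger s).opens (x t - W.a s) + M.P * (W.a s * (t - s)) ≤
      surplusCost M s (W.ledger s).opens (x s - W.a s) +
        (M.P * (x s * (t - s)) + (M.βon + M.βoff) * ((x t - x s : ℕ) : ℝ)) := by
    linarith
  rcases hn.step with h | ⟨e, h⟩
  · rw [W.ledger_congr h, W.a_congr h]
    linarith
  · cases e with
    | departure j =>
      have ha := W.a_departure h
      have h4 : surplusCost M t (W.ledger t).opens (x t - W.a t) ≤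
          surplusCost M t (W.ledger s).opens (x t - W.a s) := by
        rw [W.ledger_event h]
        simp only [Ledger.step]
        rcases Nat.eq_zero_or_eq_succ_pred (x t - W.a t) with h5 | h5
        · rw [h5, surplusCost_zero]
          exact surplusCost_nonneg M hl _
        · rw [h5]
          simp only [surplusCost, sub_self, gapCost, mul_zero, min_eq_left M.β_nonneg, zero_add]
          exact surplusCost_mono M hl (by simp only [Nat.pred_eq_sub_one]; omega)
      rw [W.ledger_event h] at h4 ⊢
      simp only [Ledger.step] at h4 ⊢
      linarith
    | arrival =>
      have ha := W.a_arrival hn.nonneg h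
      have hm : x t - W.a s = (x t - W.a t) + 1 := by omega
      rw [W.ledger_event h]
      rw [hm] at h3
      generalize W.ledger s = L at h3
      rcases L with ⟨_ | ⟨d, ds⟩, pairs, firsts⟩
      · simp only [Ledger.step, surplusCost_nil] at h3 ⊢
        push_cast at h3 ⊢
        linarith
      · simp only [Ledger.step, surplusCost, List.map_cons, List.sum_cons] at h3 ⊢
        linarith

theorem lowerCost_le (M : Model) {x : ℝ → ℕ} (hx : Feasible W x) :
    ENNReal.ofReal (W.lowerCost M - M.βoff * ((W.a W.T : ℝ) - W.a 0)) ≤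
      operationCost M W.T x := by
  obtain ⟨n, p, hp, hxp, hF⟩ := hx.step.exists_adapted W.times W.T_pos
  have hn : ∀ i < n, W.Next (p i) (p (i + 1)) := fun i hi => W.next_of_partition hp hF hi
  have hdem : ∀ i ≤ n, W.a (p i) ≤ x (p i) := fun i hi =>
    hx.demand _ (hp.nonneg i) (hp.le_last hi)
  have key : ∀ k ≤ n, M.P * (∑ i ∈ Finset.range k, W.a (p i) * (p (i + 1) - p i)) +
      (((W.ledger (p k)).pairs.map (fun b => gapCost M (b.2 - b.1.1))).sum +
        (M.βon + M.βoff) * (W.ledger (p k)).firsts +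
        surplusCost M (p k) (W.ledger (p k)).opens (x (p k) - W.a (p k))) ≤
      startCost M p x k := by
    intro k
    induction k with
    | zero =>
      intro _
      simp [hp.zero, W.ledger_zero, hx.start, surplusCost_zero, startCost]
    | succ k ih =>
      intro hk
      have h1 := ih (by omega)
      have h2 := W.lower_step M (hn k hk) (hdem k (by omega)) (hdem (k + 1) hk)
      rw [startCost_succ, Finset.sum_range_succ, mul_add]
      linarith
  rw [operationCost_eq M hp hxp, hx.start, hx.finish]
  refine ENNReal.ofReal_le_ofReal (sub_le_sub_right ?_ _)
  have h1 := key n le_rfl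
  rw [← W.load_eq hp (W.adapted_a hn), hp.last, hx.finish, Nat.sub_self, surplusCost_zero] at h1
  rw [lowerCost]
  linarith

theorem lowerCost_le_optCost (M : Model) :
    ENNReal.ofReal (W.lowerCost M - M.βoff * ((W.a W.T : ℝ) - W.a 0)) ≤ optCost M W :=
  le_iInf₂ fun _ hx => W.lowerCost_le M hx

end Workload

/-! ### An upper bound for the cost of the future-aware policy -/

open Classical in
/-- The cost of an ended empty period of length `ℓ` if the waiting time is `z`. A negative waiting
time leads to no idling, hence counts as zero in this respect. -/
noncomputable def waitCost (M : Model) (z ℓ : ℝ) : ℝ :=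
  if ℓ ≤ z + M.α * M.Δ then M.P * ℓ else M.P * max z 0 + (M.βon + M.βoff)

namespace Workload

variable (W : Workload)

open Classical in
/-- For how long the server of the empty period `d` has idled by time `t`, if the period is open at
time `t`. -/
noncomputable def idleTime (M : Model) (z : ℕ → ℝ) (t : ℝ) (d : ℝ × ℕ) : ℝ :=
  if W.ReturnsBy d (d.1 + z d.2 + M.α * M.Δ) then t - d.1 else min (t - d.1) (max (z d.2) 0)

open Classical in
theorem idleTime_step (M : Model) (z : ℕ → ℝ) {s t : ℝ} (hst : s ≤ t) {d : ℝ × ℕ}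
    (hz : ¬ (s < d.1 + z d.2 ∧ d.1 + z d.2 < t)) :
    (if W.Idles M z d s then t - s else 0) + W.idleTime M z s d ≤ W.idleTime M z t d := by
  by_cases hR : W.ReturnsBy d (d.1 + z d.2 + M.α * M.Δ)
  · simp only [idleTime, if_pos hR]
    split_ifs <;> linarith
  · simp only [idleTime, if_neg hR]
    split_ifs with hi
    · have h1 : s < d.1 + z d.2 := hi.2.resolve_right hR
      have h2 : t ≤ d.1 + z d.2 := not_lt.mp fun h => hz ⟨h1, h⟩
      have h3 := le_max_left (z d.2) 0
      rw [min_eq_left (by linarith : t - d.1 ≤ max (z d.2) 0),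
        min_eq_left (by linarith : s - d.1 ≤ max (z d.2) 0)]
      linarith
    · rw [zero_add]
      exact min_le_min (by linarith) le_rfl

open Classical in
theorem sum_idleTime_step (M : Model) (z : ℕ → ℝ) {s t : ℝ} (hst : s ≤ t) (l : List (ℝ × ℕ))
    (hz : ∀ d ∈ l, ¬ (s < d.1 + z d.2 ∧ d.1 + z d.2 < t)) :
    (l.countP (fun d => decide (W.Idles M z d s)) : ℝ) * (t - s) +
        (l.map (W.idleTime M z s)).sum ≤ (l.map (W.idleTime M z t)).sum := by
  induction l with
  | nil => simp
  | cons d ds ih =>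
    have h1 := ih fun e he => hz e (List.mem_cons_of_mem _ he)
    have h2 := W.idleTime_step M z hst (hz d List.mem_cons_self)
    rw [List.countP_cons]
    simp only [List.map_cons, List.sum_cons, decide_eq_true_eq]
    split_ifs at h2 ⊢ with h <;> push_cast <;> linarith

open Classical in
theorem countP_idles_anti (M : Model) (z : ℕ → ℝ) {s t : ℝ} (hst : s ≤ t) (l : List (ℝ × ℕ)) :
    l.countP (fun d => decide (W.Idles M z d t)) ≤
      l.countP (fun d => decide (W.Idles M z d s)) :=
  List.countP_mono_left fun d _ h => by
    simp only [decide_eq_true_eq] at h ⊢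
    exact h.anti hst

/-- When an arrival ends an empty period, its cost is the idling so far, and `βon + βoff` if the
server is off. -/
theorem waitCost_of_pop (M : Model) (z : ℕ → ℝ) {s t : ℝ} (hn : W.Next s t) (htT : t ≤ W.T)
    {d : ℝ × ℕ} (hs : d ∈ (W.ledger s).opens) (ht : d ∉ (W.ledger t).opens) :
    (W.Idles M z d s ∧ M.P * W.idleTime M z t d ≤ waitCost M (z d.2) (t - d.1)) ∨
      M.P * W.idleTime M z t d + (M.βon + M.βoff) ≤ waitCost M (z d.2) (t - d.1) := by
  obtain ⟨h1, h2, -, h4⟩ := W.opens_spec hn.nonneg d hs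
  have only : ∀ u, d.1 < u → W.Serving (W.serverOf d) u → t ≤ u := by
    intro u hu hS
    by_contra hc
    rcases le_total u s with h | h
    · exact h4 u hu.le h hS
    · rw [W.serving_congr (hn.quiet u h (not_le.mp hc))] at hS
      exact h4 s h1 le_rfl hS
  obtain ⟨u, h5, h6, h7⟩ := (W.mem_opens_or_serving (hn.nonneg.trans hn.lt.le) h2
    (h1.trans hn.lt.le)).2.resolve_left ht
  by_cases hR : W.ReturnsBy d (d.1 + z d.2 + M.α * M.Δ)
  · left
    refine ⟨⟨hn.lt.trans_le htT, Or.inr hR⟩, ?_⟩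
    obtain ⟨τ, h8, h9, -, h10⟩ := id hR
    have := only τ h8 h10
    rw [idleTime, if_pos hR, waitCost, if_pos (by linarith)]
  · right
    have h8 : ¬ t - d.1 ≤ z d.2 + M.α * M.Δ := fun hc =>
      hR ⟨u, h5, by linarith, h6.trans htT, h7⟩
    rw [idleTime, if_neg hR, waitCost, if_neg h8]
    gcongr
    · exact M.P_pos.le
    · exact min_le_right _ _

/-- One step of the upper bound: idling is accounted for by `idleTime`, and a server is turned on
only by an arrival, namely if the server popped from the stack is off. -/
theorem upper_step (M : Model) (z : ℕ → ℝ) {s t : ℝ} (hn : W.Next s t) (htT : t ≤ W.T)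
    (hz : ∀ d ∈ (W.ledger s).opens, ¬ (s < d.1 + z d.2 ∧ d.1 + z d.2 < t)) :
    ((W.ledger s).pairs.map (fun b => waitCost M (z b.1.2) (b.2 - b.1.1))).sum +
        (M.βon + M.βoff) * (W.ledger s).firsts +
        M.P * ((W.ledger s).opens.map (W.idleTime M z s)).sum +
        (M.P * ((waitPolicy M z W s).card * (t - s)) + (M.βon + M.βoff) *
          (((waitPolicy M z W t).card - (waitPolicy M z W s).card : ℕ) : ℝ)) ≤
      ((W.ledger t).pairs.map (fun b => waitCost M (z b.1.2) (b.2 - b.1.1))).sum +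
        (M.βon + M.βoff) * (W.ledger t).firsts +
        M.P * ((W.ledger t).opens.map (W.idleTime M z t)).sum + M.P * (W.a s * (t - s)) := by
  classical
  have hs := hn.nonneg
  have ht : 0 ≤ t := hs.trans hn.lt.le
  have hβ := M.β_nonneg
  have h1 := mul_le_mul_of_nonneg_left (W.sum_idleTime_step M z hn.lt.le _ hz) M.P_pos.le
  have hcs := W.card_waitPolicy (M := M) (z := z) hs
  have hct := W.card_waitPolicy (M := M) (z := z) ht
  have hcs' : ((waitPolicy M z W s).card : ℝ) =
      W.a s + (((W.ledger s).opens.countP (fun d => decide (W.Idles M z d s)) : ℕ) : ℝ) := by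
    rw [hcs]; push_cast; rfl
  have hanti := fun l => W.countP_idles_anti M z hn.lt.le l
  have h2 : M.P * ((W.ledger s).opens.map (W.idleTime M z s)).sum +
      M.P * ((waitPolicy M z W s).card * (t - s)) ≤
      M.P * ((W.ledger s).opens.map (W.idleTime M z t)).sum + M.P * (W.a s * (t - s)) := by
    rw [hcs']
    linarith
  -- no server is turned on unless there is an arrival
  have quiet : (waitPolicy M z W t).card ≤ (waitPolicy M z W s).card →
      (M.βon + M.βoff) *
        (((waitPolicy M z W t).card - (waitPolicy M z W s).card : ℕ) : ℝ) = 0 := by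
    intro h
    rw [Nat.sub_eq_zero_of_le h, Nat.cast_zero, mul_zero]
  have single : (waitPolicy M z W t).card ≤ (waitPolicy M z W s).card + 1 →
      (M.βon + M.βoff) *
        (((waitPolicy M z W t).card - (waitPolicy M z W s).card : ℕ) : ℝ) ≤
        M.βon + M.βoff := by
    intro h
    refine mul_le_of_le_one_right hβ ?_
    exact_mod_cast Nat.sub_le_iff_le_add'.mpr h
  rcases hn.step with h | ⟨e, h⟩
  · have := hanti (W.ledger s).opens
    rw [W.ledger_congr h, W.a_congr h] at hct
    have := quiet (by omega)
    rw [W.ledger_congr h]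
    linarith
  · cases e with
    | departure j =>
      have ha := W.a_departure h
      have := hanti (W.ledger s).opens
      rw [W.ledger_event h] at hct ⊢
      simp only [Ledger.step, List.countP_cons, List.map_cons, List.sum_cons] at hct ⊢
      have h3 : (if decide (W.Idles M z (t, j) t) = true then 1 else 0) ≤ 1 := by
        split_ifs <;> omega
      have h4 := quiet (by omega)
      have h5 : W.idleTime M z t (t, j) = 0 := by
        simp [idleTime]
      rw [h5, zero_add]
      linarith
    | arrival =>
      have ha := W.a_arrival hs h
      have hpop := fun d => W.waitCost_of_pop M z hn htT (d := d)
      have hnd : (W.ledger s).opens.Nodup := (W.tracks hs).nodup.of_map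
      rw [W.ledger_event h] at hct hpop ⊢
      generalize W.ledger s = L at hct hcs h2 hpop hnd
      rcases L with ⟨_ | ⟨d, ds⟩, pairs, firsts⟩
      · simp only [Ledger.step, List.countP_nil, List.map_nil, List.sum_nil] at hct hcs h2 ⊢
        have := single (by omega)
        push_cast
        linarith
      · simp only [Ledger.step, List.countP_cons, List.map_cons, List.sum_cons,
          decide_eq_true_eq] at hct hcs h2 ⊢
        have h3 := hanti ds
        rcases hpop d List.mem_cons_self (List.nodup_cons.mp hnd).1 with ⟨h4, h5⟩ | h5
        · rw [if_pos h4] at hcs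
          have := quiet (by omega)
          linarith
        · have := single (by omega)
          linarith

theorem idleTime_horizon_le (M : Model) (z : ℕ → ℝ) {d : ℝ × ℕ}
    (hd : d ∈ (W.ledger W.T).opens) : W.idleTime M z W.T d ≤ max (z d.2) 0 := by
  rw [idleTime, if_neg]
  · exact min_le_right _ _
  · rintro ⟨τ, h1, -, h2, h3⟩
    exact (W.opens_spec W.T_pos.le d hd).2.2.2 τ h1.le h2 h3

/-- The cost of serving, of the empty periods, and of turning on servers for the first time. -/
noncomputable def upperCost (M : Model) (z : ℕ → ℝ) : ℝ :=
  M.P * W.load +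
    ((W.ledger W.T).pairs.map (fun b => waitCost M (z b.1.2) (b.2 - b.1.1))).sum +
    (M.βon + M.βoff) * (W.ledger W.T).firsts +
    ((W.ledger W.T).opens.map (fun d => M.P * max (z d.2) 0)).sum

theorem cost_waitPolicy_le (M : Model) (z : ℕ → ℝ) :
    (waitPolicy M z).cost M W ≤
      ENNReal.ofReal (W.upperCost M z - M.βoff * ((W.a W.T : ℝ) - W.a 0)) := by
  classical
  obtain ⟨E, hE⟩ := isStep_waitPolicy M z W
  have hstep : IsStep W.T (fun t => (waitPolicy M z W t).card) :=
    ⟨E, fun s t h1 h2 h3 h4 => congrArg Finset.card (hE s t h1 h2 h3 h4)⟩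
  obtain ⟨n, p, hp, hxp, hF⟩ := hstep.exists_adapted (W.times ∪ W.deadlines z) W.T_pos
  have hn : ∀ i < n, W.Next (p i) (p (i + 1)) := fun i hi =>
    W.next_of_partition hp (fun q hq => hF q (Finset.mem_union_left _ hq)) hi
  have key : ∀ k ≤ n, startCost M p (fun t => (waitPolicy M z W t).card) k ≤
      M.P * (∑ i ∈ Finset.range k, W.a (p i) * (p (i + 1) - p i)) +
      (((W.ledger (p k)).pairs.map (fun b => waitCost M (z b.1.2) (b.2 - b.1.1))).sum +
        (M.βon + M.βoff) * (W.ledger (p k)).firsts +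
        M.P * ((W.ledger (p k)).opens.map (W.idleTime M z (p k))).sum) := by
    intro k
    induction k with
    | zero =>
      intro _
      simp [hp.zero, W.ledger_zero, startCost]
    | succ k ih =>
      intro hk
      have h1 := ih (by omega)
      have h2 := W.upper_step M z (hn k hk) (hp.le_last hk) (fun d hd h => by
        have h0 := hp.nonneg k
        have h3 := hp.le_last hk
        exact hp.not_between (hF _ (Finset.mem_union_right _ (W.mem_deadlines z h0 hd))
          (by linarith [h.1]) (by linarith [h.2])) k h)
      rw [startCost_succ, Finset.sum_range_succ, mul_add]
      linarith
  rw [Policy.cost, operationCost_eq M hp hxp]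
  simp only [W.card_waitPolicy_zero, W.card_waitPolicy_horizon]
  refine ENNReal.ofReal_le_ofReal (sub_le_sub_right ?_ _)
  have h1 := key n le_rfl
  rw [← W.load_eq hp (W.adapted_a hn), hp.last] at h1
  have h2 : M.P * ((W.ledger W.T).opens.map (W.idleTime M z W.T)).sum ≤
      ((W.ledger W.T).opens.map (fun d => M.P * max (z d.2) 0)).sum := by
    rw [← List.sum_map_mul_left]
    exact List.sum_le_sum fun d hd =>
      mul_le_mul_of_nonneg_left (W.idleTime_horizon_le M z hd) M.P_pos.le
  rw [upperCost]
  linarith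

end Workload

/-! ### From bounds for a single empty period to competitiveness -/

theorem measurable_waitCost (M : Model) (ℓ : ℝ) : Measurable fun z => waitCost M z ℓ := by
  unfold waitCost
  refine Measurable.ite (measurableSet_le measurable_const ?_) ?_ ?_ <;> fun_prop

theorem lintegral_ofReal_sum_map_le {Ω ι : Type*} [MeasurableSpace Ω] (ν : Measure Ω)
    (f : ι → Ω → ℝ) (g : ι → ℝ) (l : List ι) (hf : ∀ b ∈ l, Measurable (f b))
    (hg : ∀ b ∈ l, 0 ≤ g b)
    (hfg : ∀ b ∈ l, ∫⁻ ω, ENNReal.ofReal (f b ω) ∂ν ≤ ENNReal.ofReal (g b)) :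
    ∫⁻ ω, ENNReal.ofReal ((l.map fun b => f b ω).sum) ∂ν ≤ ENNReal.ofReal (l.map g).sum := by
  induction l with
  | nil => simp
  | cons b l ih =>
    have hl : ∀ b ∈ l, b ∈ b :: l := fun _ h => List.mem_cons_of_mem _ h
    simp only [List.map_cons, List.sum_cons]
    rw [ENNReal.ofReal_add (hg b List.mem_cons_self) (List.sum_nonneg fun x hx => by
      obtain ⟨i, hi, rfl⟩ := List.mem_map.mp hx
      exact hg i (List.mem_cons_of_mem _ hi))]
    calc ∫⁻ ω, ENNReal.ofReal (f b ω + (l.map fun b => f b ω).sum) ∂ν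
        ≤ ∫⁻ ω, ENNReal.ofReal (f b ω) + ENNReal.ofReal ((l.map fun b => f b ω).sum) ∂ν :=
          lintegral_mono fun ω => ENNReal.ofReal_add_le
      _ = ∫⁻ ω, ENNReal.ofReal (f b ω) ∂ν +
            ∫⁻ ω, ENNReal.ofReal ((l.map fun b => f b ω).sum) ∂ν :=
          lintegral_add_left (hf b List.mem_cons_self).ennreal_ofReal _
      _ ≤ _ := add_le_add (hfg b List.mem_cons_self)
          (ih (fun i hi => hf i (List.mem_cons_of_mem _ hi))
            (fun i hi => hg i (List.mem_cons_of_mem _ hi))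
            (fun i hi => hfg i (List.mem_cons_of_mem _ hi)))

/-- It suffices to bound the expected cost of a single empty period by `c` times the least cost if
the period ends, and to bound the expected idling by `(c - 1) (βon + βoff)` if it does not. The
number of the latter periods exceeds the number of the servers that are turned on for the first
time by `a(0) - a(T)`. -/
theorem isCompetitiveUpToBoundary_of_gap (M : Model) (ν : Measure (ℕ → ℝ))
    [IsProbabilityMeasure ν] {c : ℝ} (hc : 1 ≤ c)
    (hgap : ∀ j ℓ, 0 ≤ ℓ →
      ∫⁻ z, ENNReal.ofReal (waitCost M (z j) ℓ) ∂ν ≤ ENNReal.ofReal (c * gapCost M ℓ))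
    (hlast : ∀ j, ∫⁻ z, ENNReal.ofReal (M.P * max (z j) 0) ∂ν ≤
      ENNReal.ofReal ((c - 1) * (M.βon + M.βoff))) :
    IsCompetitiveUpToBoundary M (expectedCost M ν (waitPolicy M)) c := by
  intro W
  have hβ := M.β_nonneg
  have hle := W.pairs_le W.T_pos.le
  have hcount : (W.a W.T : ℝ) + (W.ledger W.T).opens.length =
      W.a 0 + (W.ledger W.T).firsts := by
    rw [W.a_zero]; exact_mod_cast W.a_add_opens W.T_pos.le
  set pairs := (W.ledger W.T).pairs
  set opens := (W.ledger W.T).opens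
  set N : ℝ := ((W.ledger W.T).firsts : ℝ)
  set b : ℝ := M.βoff * ((W.a W.T : ℝ) - W.a 0) with hb
  set K : ℝ := M.P * W.load + (M.βon + M.βoff) * N - b with hK
  set G : ℝ := (pairs.map (fun b => gapCost M (b.2 - b.1.1))).sum with hG
  have hK0 : 0 ≤ K := by
    have h1 : (0 : ℝ) ≤ N := Nat.cast_nonneg _
    have h2 : (0 : ℝ) ≤ opens.length := Nat.cast_nonneg _
    have h3 := mul_nonneg M.P_pos.le W.load_nonneg
    have h4 : K = M.P * W.load + M.βon * N + M.βoff * opens.length := by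
      rw [hK, hb, show (W.a W.T : ℝ) - W.a 0 = N - opens.length by linarith]; ring
    rw [h4]
    have := mul_nonneg M.βon_nonneg h1
    have := mul_nonneg M.βoff_nonneg h2
    linarith
  have hG0 : 0 ≤ G := List.sum_nonneg fun x hx => by
    obtain ⟨i, hi, rfl⟩ := List.mem_map.mp hx
    exact gapCost_nonneg M (sub_nonneg.mpr (hle i hi))
  have hupper : expectedCost M ν (waitPolicy M) W ≤
      ENNReal.ofReal (K + c * G + (c - 1) * (M.βon + M.βoff) * opens.length) := by
    have hm1 : ∀ b ∈ pairs, Measurable fun z : ℕ → ℝ => waitCost M (z b.1.2) (b.2 - b.1.1) :=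
      fun b _ => (measurable_waitCost M _).comp (measurable_pi_apply _)
    have h1 := lintegral_ofReal_sum_map_le ν
      (fun (b : (ℝ × ℕ) × ℝ) (z : ℕ → ℝ) => waitCost M (z b.1.2) (b.2 - b.1.1))
      (fun b => c * gapCost M (b.2 - b.1.1)) pairs hm1
      (fun b hb => mul_nonneg (by linarith) (gapCost_nonneg M (sub_nonneg.mpr (hle b hb))))
      (fun b hb => hgap _ _ (sub_nonneg.mpr (hle b hb)))
    have h2 := lintegral_ofReal_sum_map_le ν
      (fun (d : ℝ × ℕ) (z : ℕ → ℝ) => M.P * max (z d.2) 0)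
      (fun _ => (c - 1) * (M.βon + M.βoff)) opens (fun d _ => by fun_prop)
      (fun d _ => mul_nonneg (by linarith) hβ) (fun d _ => hlast _)
    rw [List.sum_map_mul_left] at h1
    rw [List.map_const', List.sum_replicate, nsmul_eq_mul, mul_comm] at h2
    have hsum : Measurable fun z : ℕ → ℝ => ENNReal.ofReal
        ((pairs.map fun b => waitCost M (z b.1.2) (b.2 - b.1.1)).sum) := by
      refine Measurable.ennreal_ofReal ?_
      have := List.measurable_fun_sum
        (pairs.map fun b (z : ℕ → ℝ) => waitCost M (z b.1.2) (b.2 - b.1.1)) (by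
          intro f hf
          obtain ⟨b, hb, rfl⟩ := List.mem_map.mp hf
          exact hm1 b hb)
      simpa [List.map_map, Function.comp_def] using this
    calc expectedCost M ν (waitPolicy M) W
        ≤ ∫⁻ z, (ENNReal.ofReal K + ENNReal.ofReal
            ((pairs.map fun b => waitCost M (z b.1.2) (b.2 - b.1.1)).sum)) +
            ENNReal.ofReal ((opens.map fun d => M.P * max (z d.2) 0).sum) ∂ν := by
          refine lintegral_mono fun z => (W.cost_waitPolicy_le M z).trans ?_
          refine le_trans (le_of_eq ?_) (ENNReal.ofReal_add_le.trans
            (add_le_add_left ENNReal.ofReal_add_le _))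
          congr 1
          rw [Workload.upperCost, hK]
          ring
      _ = ENNReal.ofReal K + ∫⁻ z, ENNReal.ofReal
            ((pairs.map fun b => waitCost M (z b.1.2) (b.2 - b.1.1)).sum) ∂ν +
            ∫⁻ z, ENNReal.ofReal ((opens.map fun d => M.P * max (z d.2) 0).sum) ∂ν := by
          rw [lintegral_add_left (hsum.const_add _), lintegral_add_left measurable_const,
            lintegral_const, measure_univ, mul_one]
      _ ≤ ENNReal.ofReal K + ENNReal.ofReal (c * G) +
            ENNReal.ofReal ((c - 1) * (M.βon + M.βoff) * opens.length) :=
          add_le_add (add_le_add le_rfl h1) h2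
      _ = _ := by
          rw [← ENNReal.ofReal_add hK0 (mul_nonneg (by linarith) hG0), ← ENNReal.ofReal_add]
          · exact add_nonneg hK0 (mul_nonneg (by linarith) hG0)
          · exact mul_nonneg (mul_nonneg (by linarith) hβ) (Nat.cast_nonneg _)
  have hlower : W.lowerCost M - b = K + G := by
    rw [Workload.lowerCost, hK]; ring
  refine hupper.trans ?_
  have h1 : ENNReal.ofReal c * ENNReal.ofReal (K + G) ≤ ENNReal.ofReal c * optCost M W :=
    mul_le_mul_right (hlower ▸ W.lowerCost_le_optCost M) _
  refine le_trans ?_ (add_le_add_left h1 _)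
  rw [← ENNReal.ofReal_mul (by linarith), ← ENNReal.ofReal_natCast,
    ← ENNReal.ofReal_mul (mul_nonneg (by linarith) M.βon_nonneg), ← ENNReal.ofReal_add]
  · refine ENNReal.ofReal_le_ofReal ?_
    have h2 : (W.a 0 : ℝ) - W.a W.T ≤ ((W.a 0 - W.a W.T : ℕ) : ℝ) := by
      rw [sub_le_iff_le_add]; exact_mod_cast le_tsub_add
    have h3 : (c - 1) * M.βon * ((W.a 0 : ℝ) - W.a W.T) ≤
        (c - 1) * M.βon * ((W.a 0 - W.a W.T : ℕ) : ℝ) :=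
      mul_le_mul_of_nonneg_left h2 (mul_nonneg (by linarith) M.βon_nonneg)
    have h4 : (0 : ℝ) ≤ (c - 1) * (M.P * W.load) :=
      mul_nonneg (by linarith) (mul_nonneg M.P_pos.le W.load_nonneg)
    have h5 : (opens.length : ℝ) = N + W.a 0 - W.a W.T := by linarith
    rw [h5]
    have h6 : (c - 1) * K = (c - 1) * (M.P * W.load) + (c - 1) * (M.βon + M.βoff) * N +
        (c - 1) * M.βoff * ((W.a 0 : ℝ) - W.a W.T) := by
      rw [hK, hb]; ring
    linarith
  · exact mul_nonneg (by linarith) (add_nonneg hK0 hG0)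
  · exact mul_nonneg (mul_nonneg (by linarith) M.βon_nonneg) (Nat.cast_nonneg _)

theorem IsCompetitiveUpToBoundary.isCompetitive {M : Model} {C : Workload → ℝ≥0∞} {c : ℝ}
    (h : IsCompetitiveUpToBoundary M C c) : IsCompetitive M C c := by
  intro W _ ha
  have := h W
  rwa [Nat.sub_eq_zero_of_le ha, Nat.cast_zero, mul_zero, add_zero] at this

/-! ### The fixed waiting time -/

theorem waitCost_eq_of_le {M : Model} {z ℓ : ℝ} (h : ℓ ≤ z + M.α * M.Δ) :
    waitCost M z ℓ = M.P * ℓ := if_pos h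

/-- The cost never exceeds that of waiting and then turning off and on. If the server idles
throughout, this holds since the period ends within `α Δ ≤ Δ` after the waiting time. -/
theorem waitCost_le {M : Model} {z : ℝ} (hz : 0 ≤ z) (ℓ : ℝ) :
    waitCost M z ℓ ≤ M.P * (z + M.Δ) := by
  have h1 : M.α * M.Δ ≤ M.Δ := mul_le_of_le_one_left M.Δ_pos.le M.α_le_one
  unfold waitCost
  split_ifs with h
  · exact mul_le_mul_of_nonneg_left (by linarith) M.P_pos.le
  · rw [max_eq_left hz, mul_add, M.P_mul_Δ]

theorem gapCost_eq_of_le {M : Model} {ℓ : ℝ} (h : ℓ ≤ M.Δ) : gapCost M ℓ = M.P * ℓ :=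
  min_eq_left (by rw [← M.P_mul_Δ]; exact mul_le_mul_of_nonneg_left h M.P_pos.le)

theorem gapCost_eq_of_ge {M : Model} {ℓ : ℝ} (h : M.Δ ≤ ℓ) : gapCost M ℓ = M.P * M.Δ := by
  rw [gapCost, ← M.P_mul_Δ]
  exact min_eq_right (mul_le_mul_of_nonneg_left h M.P_pos.le)

theorem isCompetitiveUpToBoundary_algA1 (M : Model) :
    IsCompetitiveUpToBoundary M ((algA1 M).cost M) (2 - M.α) := by
  have hα := M.α_le_one
  have hD : 0 ≤ (1 - M.α) * M.Δ := mul_nonneg (by linarith) M.Δ_pos.le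
  have h := isCompetitiveUpToBoundary_of_gap M
    (Measure.dirac fun _ : ℕ => (1 - M.α) * M.Δ) (c := 2 - M.α) (by linarith) ?_ ?_
  · intro W
    have h' := h W
    rwa [expectedCost, lintegral_dirac] at h'
  · intro j ℓ hℓ
    rw [lintegral_dirac]
    refine ENNReal.ofReal_le_ofReal ?_
    rcases le_total ℓ M.Δ with hle | hle
    · rw [waitCost_eq_of_le (by linarith), gapCost_eq_of_le hle]
      exact le_mul_of_one_le_left (mul_nonneg M.P_pos.le hℓ) (by linarith)
    · rw [gapCost_eq_of_ge hle]
      refine (waitCost_le hD ℓ).trans (le_of_eq ?_)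
      ring
  · intro j
    rw [lintegral_dirac, max_eq_left hD, ← M.P_mul_Δ]
    refine ENNReal.ofReal_le_ofReal (le_of_eq ?_)
    ring

/-! ### Exponentially distributed waiting times -/

/-- The density `e ^ (z / D) / ((e - 1) D)` of a waiting time on `[0, D]`. -/
noncomputable def waitDensity (D z : ℝ) : ℝ := Real.exp (z / D) / ((Real.exp 1 - 1) * D)

theorem waitDensity_nonneg {D : ℝ} (hD : 0 < D) (z : ℝ) : 0 ≤ waitDensity D z :=
  div_nonneg (Real.exp_pos _).le (mul_nonneg exp_one_sub_one_pos.le hD.le)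

theorem continuous_waitDensity (D : ℝ) : Continuous (waitDensity D) := by
  unfold waitDensity; fun_prop

theorem lintegral_waitDensity_mul {D u v : ℝ} (hD : 0 < D) (huv : u ≤ v) {b : ℝ}
    (hb : 0 ≤ u + b) :
    ∫⁻ z in Set.Ioc u v, ENNReal.ofReal (waitDensity D z) * ENNReal.ofReal (z + b) =
      ENNReal.ofReal ((Real.exp (v / D) * (v + b - D) - Real.exp (u / D) * (u + b - D)) /
        (Real.exp 1 - 1)) := by
  have he := exp_one_sub_one_pos
  have hcont : Continuous fun z => waitDensity D z * (z + b) :=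
    (continuous_waitDensity D).mul (by fun_prop)
  have hint : ∫ z in u..v, waitDensity D z * (z + b) =
      (Real.exp (v / D) * (v + b - D) - Real.exp (u / D) * (u + b - D)) / (Real.exp 1 - 1) := by
    rw [intervalIntegral.integral_eq_sub_of_hasDerivAt
      (f := fun z => Real.exp (z / D) * (z + b - D) / (Real.exp 1 - 1))
      (fun z _ => ?_) (hcont.intervalIntegrable _ _)]
    · ring
    · have h1 : HasDerivAt (fun z : ℝ => Real.exp (z / D)) (Real.exp (z / D) * (1 / D)) z :=
        ((hasDerivAt_id z).div_const D).exp
      have h2 : HasDerivAt (fun z : ℝ => z + b - D) 1 z :=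
        ((hasDerivAt_id z).add_const b).sub_const D
      have h3 := (h1.mul h2).div_const (Real.exp 1 - 1)
      refine h3.congr_deriv ?_
      rw [waitDensity]
      field_simp
      ring
  rw [← hint, intervalIntegral.integral_of_le huv,
    ofReal_integral_eq_lintegral_ofReal hcont.integrableOn_Ioc]
  · refine setLIntegral_congr_fun measurableSet_Ioc fun z _ => ?_
    rw [ENNReal.ofReal_mul (waitDensity_nonneg hD z)]
  · refine (ae_restrict_iff' measurableSet_Ioc).mpr (Eventually.of_forall fun z hz => ?_)
    exact mul_nonneg (waitDensity_nonneg hD z) (by linarith [hz.1])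

theorem lintegral_waitDensity {D u v : ℝ} (hD : 0 < D) (huv : u ≤ v) :
    ∫⁻ z in Set.Ioc u v, ENNReal.ofReal (waitDensity D z) =
      ENNReal.ofReal ((Real.exp (v / D) - Real.exp (u / D)) / (Real.exp 1 - 1)) := by
  have he := exp_one_sub_one_pos
  have hcont := continuous_waitDensity D
  have hint : ∫ z in u..v, waitDensity D z =
      (Real.exp (v / D) - Real.exp (u / D)) / (Real.exp 1 - 1) := by
    rw [intervalIntegral.integral_eq_sub_of_hasDerivAt
      (f := fun z => Real.exp (z / D) / (Real.exp 1 - 1))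
      (fun z _ => ?_) (hcont.intervalIntegrable _ _)]
    · ring
    · have h1 : HasDerivAt (fun z : ℝ => Real.exp (z / D)) (Real.exp (z / D) * (1 / D)) z :=
        ((hasDerivAt_id z).div_const D).exp
      refine (h1.div_const (Real.exp 1 - 1)).congr_deriv ?_
      rw [waitDensity]
      field_simp
  rw [← hint, intervalIntegral.integral_of_le huv,
    ofReal_integral_eq_lintegral_ofReal hcont.integrableOn_Ioc]
  exact Eventually.of_forall fun z => waitDensity_nonneg hD z

/-- The expectation of `f` for a waiting time with density `waitDensity D` on `[0, D]`. -/
noncomputable def waitMean (D : ℝ) (f : ℝ → ℝ≥0∞) : ℝ≥0∞ :=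
  ∫⁻ z in Set.Ioc 0 D, ENNReal.ofReal (waitDensity D z) * f z

theorem waitMean_mono {D : ℝ} {f g : ℝ → ℝ≥0∞} (h : ∀ z, 0 < z → z ≤ D → f z ≤ g z) :
    waitMean D f ≤ waitMean D g :=
  setLIntegral_mono' measurableSet_Ioc fun z hz => mul_le_mul_right (h z hz.1 hz.2) _

theorem measurable_ofReal_waitDensity (D : ℝ) :
    Measurable fun z => ENNReal.ofReal (waitDensity D z) :=
  (continuous_waitDensity D).measurable.ennreal_ofReal

theorem waitMean_const {D : ℝ} (hD : 0 < D) (q : ℝ≥0∞) : waitMean D (fun _ => q) = q := by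
  rw [waitMean, lintegral_mul_const _ (measurable_ofReal_waitDensity D),
    lintegral_waitDensity hD hD.le, div_self hD.ne', zero_div, Real.exp_zero,
    div_self exp_one_sub_one_pos.ne', ENNReal.ofReal_one, one_mul]

theorem waitMean_const_mul {D : ℝ} (q : ℝ) (hq : 0 ≤ q) (f : ℝ → ℝ) (hf : Measurable f) :
    waitMean D (fun z => ENNReal.ofReal (q * f z)) =
      ENNReal.ofReal q * waitMean D (fun z => ENNReal.ofReal (f z)) := by
  rw [waitMean, waitMean, ← lintegral_const_mul]
  · refine lintegral_congr fun z => ?_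
    rw [ENNReal.ofReal_mul hq, mul_left_comm]
  · exact (measurable_ofReal_waitDensity D).mul hf.ennreal_ofReal

/-- The mean of the waiting time is `D / (e - 1)`. -/
theorem waitMean_max {D P : ℝ} (hD : 0 < D) (hP : 0 ≤ P) :
    waitMean D (fun z => ENNReal.ofReal (P * max z 0)) =
      ENNReal.ofReal (P * (D / (Real.exp 1 - 1))) := by
  rw [waitMean_const_mul P hP (fun z => max z 0) (by fun_prop), ENNReal.ofReal_mul hP]
  congr 1
  have h := lintegral_waitDensity_mul hD hD.le (b := 0) (by simp)
  rw [waitMean, setLIntegral_congr_fun measurableSet_Ioc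
    (g := fun z => ENNReal.ofReal (waitDensity D z) * ENNReal.ofReal (z + 0)), h]
  · congr 1
    simp
  · intro z hz
    simp only [add_zero, max_eq_left hz.1.le]

section

variable {M : Model} {D : ℝ}

/-- The expected cost of an ended empty period that is longer than the look-ahead window, but not
longer than `Δ`. -/
theorem waitMean_waitCost_mid (hD : 0 < D) (hM : D = (1 - M.α) * M.Δ) {y : ℝ} (hy : 0 ≤ y)
    (hyD : y ≤ D) :
    waitMean D (fun z => ENNReal.ofReal (waitCost M z (y + M.α * M.Δ))) ≤
      ENNReal.ofReal (M.P * (Real.exp 1 / (Real.exp 1 - 1) * y + M.α * M.Δ)) := by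
  have he := exp_one_sub_one_pos
  have hw : 0 ≤ M.α * M.Δ := mul_nonneg M.α_nonneg M.Δ_pos.le
  have hΔ : M.Δ = D + M.α * M.Δ := by rw [hM]; ring
  have hmeas := measurable_ofReal_waitDensity D
  have hexp : Real.exp (y / D) ≤ Real.exp 1 :=
    Real.exp_le_exp.mpr ((div_le_one hD).mpr hyD)
  have hexp1 : 1 ≤ Real.exp (y / D) := Real.one_le_exp (by positivity)
  rw [waitMean, ← Set.Ioc_union_Ioc_eq_Ioc hy hyD,
    lintegral_union measurableSet_Ioc (Set.Ioc_disjoint_Ioc_of_le le_rfl)]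
  have h1 : ∫⁻ z in Set.Ioc 0 y, ENNReal.ofReal (waitDensity D z) *
      ENNReal.ofReal (waitCost M z (y + M.α * M.Δ)) ≤
      ENNReal.ofReal M.P * ENNReal.ofReal
        ((Real.exp (y / D) * (y + M.α * M.Δ) - M.α * M.Δ) / (Real.exp 1 - 1)) := by
    have h := lintegral_waitDensity_mul hD hy (b := M.Δ) (by linarith [M.Δ_pos])
    rw [show y + M.Δ - D = y + M.α * M.Δ by linarith,
      show (0 : ℝ) + M.Δ - D = M.α * M.Δ by linarith, zero_div, Real.exp_zero, one_mul] at h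
    rw [← h, ← lintegral_const_mul _ (f := fun z =>
      ENNReal.ofReal (waitDensity D z) * ENNReal.ofReal (z + M.Δ)) (hmeas.mul (by fun_prop))]
    refine setLIntegral_mono' measurableSet_Ioc fun z hz => ?_
    rw [mul_left_comm, ← ENNReal.ofReal_mul M.P_pos.le]
    exact mul_le_mul_right (ENNReal.ofReal_le_ofReal (waitCost_le hz.1.le _)) _
  have h2 : ∫⁻ z in Set.Ioc y D, ENNReal.ofReal (waitDensity D z) *
      ENNReal.ofReal (waitCost M z (y + M.α * M.Δ)) =
      ENNReal.ofReal ((Real.exp 1 - Real.exp (y / D)) / (Real.exp 1 - 1)) *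
        ENNReal.ofReal (M.P * (y + M.α * M.Δ)) := by
    have h := lintegral_waitDensity hD hyD
    rw [div_self hD.ne'] at h
    rw [← h, ← lintegral_mul_const _ hmeas]
    refine setLIntegral_congr_fun measurableSet_Ioc fun z hz => ?_
    rw [waitCost_eq_of_le (by linarith [hz.1])]
  rw [h2]
  refine (add_le_add_left h1 _).trans (le_of_eq ?_)
  rw [← ENNReal.ofReal_mul M.P_pos.le, ← ENNReal.ofReal_mul, ← ENNReal.ofReal_add]
  · congr 1
    field_simp
    ring
  · refine mul_nonneg M.P_pos.le (div_nonneg ?_ he.le)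
    nlinarith
  · exact mul_nonneg (div_nonneg (by linarith) he.le)
      (mul_nonneg M.P_pos.le (by linarith))
  · exact div_nonneg (by linarith) he.le

/-- A bound for all lengths; it is attained by the periods longer than `Δ`, where the server is always
turned off and on. -/
theorem waitMean_waitCost_long (hD : 0 < D) (hM : D = (1 - M.α) * M.Δ) (ℓ : ℝ) :
    waitMean D (fun z => ENNReal.ofReal (waitCost M z ℓ)) ≤
      ENNReal.ofReal (M.P * (Real.exp 1 / (Real.exp 1 - 1) * D + M.α * M.Δ)) := by
  have he := exp_one_sub_one_pos
  have hΔ : M.Δ = D + M.α * M.Δ := by rw [hM]; ring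
  have h := lintegral_waitDensity_mul hD hD.le (b := M.Δ) (by linarith [M.Δ_pos])
  refine (waitMean_mono (g := fun z => ENNReal.ofReal (M.P * (z + M.Δ)))
    fun z hz _ => ENNReal.ofReal_le_ofReal (waitCost_le hz.le ℓ)).trans (le_of_eq ?_)
  rw [waitMean_const_mul M.P M.P_pos.le (fun z => z + M.Δ) (by fun_prop), waitMean, h,
    ENNReal.ofReal_mul M.P_pos.le]
  congr 2
  rw [div_self hD.ne', zero_div, Real.exp_zero, show D + M.Δ - D = D + M.α * M.Δ by linarith,
    show (0 : ℝ) + M.Δ - D = M.α * M.Δ by linarith]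
  field_simp
  ring

theorem waitMean_waitCost_short (hD : 0 < D) {ℓ : ℝ} (hℓ : ℓ ≤ M.α * M.Δ) :
    waitMean D (fun z => ENNReal.ofReal (waitCost M z ℓ)) ≤ ENNReal.ofReal (M.P * ℓ) := by
  rw [← waitMean_const hD (ENNReal.ofReal (M.P * ℓ))]
  refine waitMean_mono fun z hz _ => ?_
  rw [waitCost_eq_of_le (by linarith)]

end

theorem lintegral_lawA2 {M : Model} (h : M.α < 1) {f : ℝ → ℝ≥0∞} (hf : Measurable f) :
    ∫⁻ z, f z ∂lawA2 M = waitMean ((1 - M.α) * M.Δ) f := by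
  have hm : Measurable fun z : ℝ => ENNReal.ofReal (Real.exp (z / ((1 - M.α) * M.Δ)) /
      ((Real.exp 1 - 1) * ((1 - M.α) * M.Δ))) := by fun_prop
  rw [lawA2, if_pos h, lintegral_withDensity_eq_lintegral_mul _ (hm.indicator measurableSet_Icc) hf,
    waitMean, setLIntegral_congr Ioc_ae_eq_Icc, ← lintegral_indicator measurableSet_Icc]
  refine lintegral_congr fun z => ?_
  by_cases hz : z ∈ Set.Icc 0 ((1 - M.α) * M.Δ)
  · simp only [Pi.mul_apply, Set.indicator_of_mem hz, waitDensity]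
  · simp only [Pi.mul_apply, Set.indicator_of_notMem hz, zero_mul]

theorem lintegral_lawA3 {M : Model} (h : M.α < 1) {f : ℝ → ℝ≥0∞} (hf : Measurable f) :
    ∫⁻ z, f z ∂lawA3 M = ENNReal.ofReal (M.α / (Real.exp 1 - 1 + M.α)) * f 0 +
      ENNReal.ofReal (1 - M.α / (Real.exp 1 - 1 + M.α)) * waitMean ((1 - M.α) * M.Δ) f := by
  have he := exp_one_sub_one_pos
  have h0 := M.α_nonneg
  have h2 : 0 ≤ 1 - M.α / (Real.exp 1 - 1 + M.α) := by
    rw [sub_nonneg, div_le_one (by linarith)]; linarith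
  have hm : Measurable fun z : ℝ => ENNReal.ofReal ((1 - M.α / (Real.exp 1 - 1 + M.α)) /
      ((Real.exp 1 - 1) * ((1 - M.α) * M.Δ)) * Real.exp (z / ((1 - M.α) * M.Δ))) := by fun_prop
  rw [lawA3, if_pos h, lintegral_add_measure, lintegral_smul_measure, lintegral_dirac,
    lintegral_withDensity_eq_lintegral_mul _ (hm.indicator measurableSet_Ioc) hf, waitMean,
    ← lintegral_const_mul _ (f := fun z => ENNReal.ofReal (waitDensity ((1 - M.α) * M.Δ) z) * f z)
      ((measurable_ofReal_waitDensity _).mul hf),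
    ← lintegral_indicator measurableSet_Ioc, smul_eq_mul]
  congr 1
  refine lintegral_congr fun z => ?_
  by_cases hz : z ∈ Set.Ioc 0 ((1 - M.α) * M.Δ)
  · simp only [Pi.mul_apply, Set.indicator_of_mem hz, waitDensity]
    rw [← mul_assoc (ENNReal.ofReal _) (ENNReal.ofReal _) (f z), ← ENNReal.ofReal_mul h2]
    congr 2
    ring
  · simp only [Pi.mul_apply, Set.indicator_of_notMem hz, zero_mul]

theorem lintegral_waitTimes (μ : Measure ℝ) [IsProbabilityMeasure μ] (j : ℕ) {f : ℝ → ℝ≥0∞}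
    (hf : Measurable f) : ∫⁻ z, f (z j) ∂waitTimes μ = ∫⁻ z, f z ∂μ :=
  (measurePreserving_eval_infinitePi (fun _ : ℕ => μ) j).lintegral_comp hf

instance (μ : Measure ℝ) [IsProbabilityMeasure μ] : IsProbabilityMeasure (waitTimes μ) := by
  unfold waitTimes; infer_instance

theorem measurable_ofReal_waitCost (M : Model) (ℓ : ℝ) :
    Measurable fun z => ENNReal.ofReal (waitCost M z ℓ) :=
  (measurable_waitCost M ℓ).ennreal_ofReal

theorem isCompetitiveUpToBoundary_of_law (M : Model) (μ : Measure ℝ) [IsProbabilityMeasure μ]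
    {c : ℝ} (hc : 1 ≤ c)
    (hgap : ∀ ℓ, 0 ≤ ℓ →
      ∫⁻ z, ENNReal.ofReal (waitCost M z ℓ) ∂μ ≤ ENNReal.ofReal (c * gapCost M ℓ))
    (hlast : ∫⁻ z, ENNReal.ofReal (M.P * max z 0) ∂μ ≤
      ENNReal.ofReal ((c - 1) * (M.βon + M.βoff))) :
    IsCompetitiveUpToBoundary M (expectedCost M (waitTimes μ) (waitPolicy M)) c := by
  refine isCompetitiveUpToBoundary_of_gap M _ hc (fun j ℓ hℓ => ?_) (fun j => ?_)
  · rw [lintegral_waitTimes μ j (f := fun z => ENNReal.ofReal (waitCost M z ℓ))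
      (measurable_ofReal_waitCost M ℓ)]
    exact hgap ℓ hℓ
  · rw [lintegral_waitTimes μ j (f := fun z => ENNReal.ofReal (M.P * max z 0)) (by fun_prop)]
    exact hlast

/-- With full look-ahead over `Δ` and no waiting, every empty period has the least cost. -/
theorem waitCost_zero_of_one {M : Model} (h : M.α = 1) (ℓ : ℝ) :
    waitCost M 0 ℓ = gapCost M ℓ := by
  rcases le_or_gt ℓ M.Δ with hle | hlt
  · rw [waitCost_eq_of_le (by rw [h]; linarith), gapCost_eq_of_le hle]
  · rw [waitCost, if_neg (by rw [h]; linarith), gapCost_eq_of_ge hlt.le, M.P_mul_Δ]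
    simp

theorem isCompetitiveUpToBoundary_dirac_zero {M : Model} (h : M.α = 1) (μ : Measure ℝ)
    [IsProbabilityMeasure μ] (hμ : μ = Measure.dirac 0) {c : ℝ} (hc : c = 1) :
    IsCompetitiveUpToBoundary M (expectedCost M (waitTimes μ) (waitPolicy M)) c := by
  refine isCompetitiveUpToBoundary_of_law M μ hc.ge (fun ℓ hℓ => ?_) ?_
  · rw [hμ, lintegral_dirac, waitCost_zero_of_one h, hc, one_mul]
  · rw [hμ, lintegral_dirac]; simp

theorem isCompetitiveUpToBoundary_lawA2 (M : Model) :
    IsCompetitiveUpToBoundary M (expectedCost M (waitTimes (lawA2 M)) (waitPolicy M))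
      ((Real.exp 1 - M.α) / (Real.exp 1 - 1)) := by
  have he := exp_one_sub_one_pos
  have hP := M.P_pos
  have hα0 := M.α_nonneg
  rcases M.α_le_one.lt_or_eq with h | h
  swap
  · refine isCompetitiveUpToBoundary_dirac_zero h _ ?_ ?_
    · rw [lawA2, if_neg (by linarith)]
    · rw [h, div_self he.ne']
  obtain ⟨D, hDM⟩ : ∃ D, D = (1 - M.α) * M.Δ := ⟨_, rfl⟩
  have hD : 0 < D := hDM ▸ mul_pos (by linarith) M.Δ_pos
  have hw : 0 ≤ M.α * M.Δ := mul_nonneg hα0 M.Δ_pos.le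
  have hΔ : M.Δ = D + M.α * M.Δ := by rw [hDM]; ring
  have hc : (Real.exp 1 - M.α) / (Real.exp 1 - 1) = 1 + (1 - M.α) / (Real.exp 1 - 1) := by
    field_simp; ring
  have hc1 : 1 ≤ (Real.exp 1 - M.α) / (Real.exp 1 - 1) := by
    rw [one_le_div he]; linarith
  have mid : ∀ y, y ≤ D → Real.exp 1 / (Real.exp 1 - 1) * y + M.α * M.Δ ≤
      (Real.exp 1 - M.α) / (Real.exp 1 - 1) * (y + M.α * M.Δ) := by
    intro y hyD
    rw [div_mul_eq_mul_div, div_mul_eq_mul_div, div_add' _ _ _ he.ne', div_le_div_iff_of_pos_right he]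
    have h1 : M.α * y ≤ M.α * D := mul_le_mul_of_nonneg_left hyD hα0
    have h2 : (1 - M.α) * (M.α * M.Δ) = M.α * D := by rw [hDM]; ring
    linarith
  refine isCompetitiveUpToBoundary_of_law M _ hc1 (fun ℓ hℓ => ?_) ?_
  · rw [lintegral_lawA2 h (measurable_ofReal_waitCost M ℓ), ← hDM]
    rcases le_total ℓ (M.α * M.Δ) with h1 | h1
    · refine (waitMean_waitCost_short hD h1).trans (ENNReal.ofReal_le_ofReal ?_)
      rw [gapCost_eq_of_le (by linarith)]
      exact le_mul_of_one_le_left (mul_nonneg hP.le hℓ) hc1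
    · rcases le_total ℓ M.Δ with h2 | h2
      · have h3 := waitMean_waitCost_mid hD hDM (y := ℓ - M.α * M.Δ) (by linarith) (by linarith)
        rw [sub_add_cancel] at h3
        refine h3.trans (ENNReal.ofReal_le_ofReal ?_)
        have h4 := mul_le_mul_of_nonneg_left (mid (ℓ - M.α * M.Δ) (by linarith)) hP.le
        rw [sub_add_cancel] at h4
        rw [gapCost_eq_of_le h2]
        linarith
      · refine (waitMean_waitCost_long hD hDM ℓ).trans (ENNReal.ofReal_le_ofReal ?_)
        have h4 := mul_le_mul_of_nonneg_left (mid D le_rfl) hP.le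
        rw [← hΔ] at h4
        rw [gapCost_eq_of_ge h2]
        linarith
  · rw [lintegral_lawA2 h (by fun_prop), ← hDM, waitMean_max hD hP.le]
    refine ENNReal.ofReal_le_ofReal (le_of_eq ?_)
    rw [hc, ← M.P_mul_Δ, hDM]
    ring

theorem isCompetitiveUpToBoundary_lawA3 (M : Model) :
    IsCompetitiveUpToBoundary M (expectedCost M (waitTimes (lawA3 M)) (waitPolicy M))
      (Real.exp 1 / (Real.exp 1 - 1 + M.α)) := by
  have he := exp_one_sub_one_pos
  have hP := M.P_pos
  have hα0 := M.α_nonneg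
  have hα1 := M.α_le_one
  have hq : 0 < Real.exp 1 - 1 + M.α := by linarith
  rcases M.α_le_one.lt_or_eq with h | h
  swap
  · refine isCompetitiveUpToBoundary_dirac_zero h _ ?_ ?_
    · rw [lawA3, if_neg (by linarith)]
    · rw [h, sub_add_cancel, div_self (Real.exp_pos 1).ne']
  obtain ⟨D, hDM⟩ : ∃ D, D = (1 - M.α) * M.Δ := ⟨_, rfl⟩
  have hD : 0 < D := hDM ▸ mul_pos (by linarith) M.Δ_pos
  have hw : 0 ≤ M.α * M.Δ := mul_nonneg hα0 M.Δ_pos.le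
  have hΔ : M.Δ = D + M.α * M.Δ := by rw [hDM]; ring
  have hc1 : 1 ≤ Real.exp 1 / (Real.exp 1 - 1 + M.α) := by
    rw [one_le_div hq]; linarith
  have hp0 : 0 ≤ M.α / (Real.exp 1 - 1 + M.α) := div_nonneg hα0 hq.le
  have hp1 : 0 ≤ 1 - M.α / (Real.exp 1 - 1 + M.α) := by
    rw [sub_nonneg, div_le_one hq]; linarith
  have combine : ∀ {x y A B C : ℝ}, 0 ≤ x → 0 ≤ y → 0 ≤ A → 0 ≤ B → x * A + y * B ≤ C →
      ENNReal.ofReal x * ENNReal.ofReal A + ENNReal.ofReal y * ENNReal.ofReal B ≤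
        ENNReal.ofReal C := by
    intro x y A B C hx hy hA hB hC
    rw [← ENNReal.ofReal_mul hx, ← ENNReal.ofReal_mul hy,
      ← ENNReal.ofReal_add (mul_nonneg hx hA) (mul_nonneg hy hB)]
    exact ENNReal.ofReal_le_ofReal hC
  -- the atom at `0` is chosen so that the ratio is the same for all lengths up to `Δ`
  have mid : ∀ y, M.α / (Real.exp 1 - 1 + M.α) * (M.P * (0 + M.Δ)) +
      (1 - M.α / (Real.exp 1 - 1 + M.α)) *
        (M.P * (Real.exp 1 / (Real.exp 1 - 1) * y + M.α * M.Δ)) =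
      Real.exp 1 / (Real.exp 1 - 1 + M.α) * (M.P * (y + M.α * M.Δ)) := by
    intro y
    field_simp
    ring
  refine isCompetitiveUpToBoundary_of_law M _ hc1 (fun ℓ hℓ => ?_) ?_
  · rw [lintegral_lawA3 h (measurable_ofReal_waitCost M ℓ), ← hDM]
    have hz := ENNReal.ofReal_le_ofReal (waitCost_le (M := M) le_rfl ℓ)
    have hz0 : 0 ≤ M.P * (0 + M.Δ) := mul_nonneg hP.le (by linarith [M.Δ_pos])
    rcases le_total ℓ (M.α * M.Δ) with h1 | h1
    · refine (add_le_add_right (mul_le_mul_right (waitMean_waitCost_short hD h1) _) _).trans ?_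
      rw [waitCost_eq_of_le (by linarith), gapCost_eq_of_le (by linarith)]
      have hPℓ := mul_nonneg hP.le hℓ
      refine combine hp0 hp1 hPℓ hPℓ ?_
      rw [← add_mul, add_sub_cancel, one_mul]
      exact le_mul_of_one_le_left hPℓ hc1
    · have hB : ∀ y, 0 ≤ y → 0 ≤ M.P * (Real.exp 1 / (Real.exp 1 - 1) * y + M.α * M.Δ) :=
        fun y hy => mul_nonneg hP.le (add_nonneg
          (mul_nonneg (div_nonneg (Real.exp_pos 1).le he.le) hy) hw)
      rcases le_total ℓ M.Δ with h2 | h2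
      · have h3 := waitMean_waitCost_mid hD hDM (y := ℓ - M.α * M.Δ) (by linarith) (by linarith)
        rw [sub_add_cancel] at h3
        refine (add_le_add (mul_le_mul_right hz _) (mul_le_mul_right h3 _)).trans
          (combine hp0 hp1 hz0 (hB _ (by linarith)) (le_of_eq ?_))
        rw [mid, sub_add_cancel, gapCost_eq_of_le h2]
      · refine (add_le_add (mul_le_mul_right hz _)
          (mul_le_mul_right (waitMean_waitCost_long hD hDM ℓ) _)).trans
          (combine hp0 hp1 hz0 (hB _ hD.le) (le_of_eq ?_))
        rw [mid, ← hΔ, gapCost_eq_of_ge h2]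
  · rw [lintegral_lawA3 h (by fun_prop), ← hDM, waitMean_max hD hP.le]
    refine combine hp0 hp1 (by simp) (mul_nonneg hP.le (div_nonneg hD.le he.le)) (le_of_eq ?_)
    rw [← M.P_mul_Δ, hDM]
    field_simp
    simp
    ring

/-! ### Workloads with a single gap -/

/-- One job is present at time `0` and leaves at time `δ`; another job arrives at the end `T` of the
horizon. -/
noncomputable def singleGap {δ T : ℝ} (hδ : 0 < δ) (hT : δ < T) : Workload where
  T := T
  T_pos := hδ.trans hT
  a₀ := 1
  events := [(δ, .departure 0), (T, .arrival)]
  sorted := by simpa using hT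
  mem_horizon e he := by
    simp only [List.mem_cons, List.not_mem_nil, or_false] at he
    rcases he with rfl | rfl
    · exact ⟨hδ, hT.le⟩
    · exact ⟨hδ.trans hT, le_rfl⟩
  departs l₁ t j l₂ h := by
    rcases l₁ with _ | ⟨e, _ | ⟨f, l₁⟩⟩
    · simp only [List.nil_append, List.cons.injEq, Prod.mk.injEq, JobEvent.departure.injEq] at h
      obtain ⟨⟨-, rfl⟩, -⟩ := h
      simp [Center.run, Center.init]
    · simp at h
    · simp at h

namespace singleGap

variable {δ T : ℝ} (hδ : 0 < δ) (hT : δ < T)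

theorem upTo_of_lt {t : ℝ} (ht : t < δ) : (singleGap hδ hT).upTo t = [] := by
  simp [Workload.upTo, singleGap, ht, ht.trans hT]

theorem upTo_of_mem {t : ℝ} (h1 : δ ≤ t) (h2 : t < T) :
    (singleGap hδ hT).upTo t = [(δ, .departure 0)] := by
  simp [Workload.upTo, singleGap, h1, h2]

theorem upTo_of_ge {t : ℝ} (h : T ≤ t) :
    (singleGap hδ hT).upTo t = [(δ, .departure 0), (T, .arrival)] := by
  simp [Workload.upTo, singleGap, h, hT.le.trans h]

theorem a_of_lt {t : ℝ} (ht : t < δ) : (singleGap hδ hT).a t = 1 := by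
  rw [Workload.a, Workload.center, upTo_of_lt hδ hT ht]
  simp [Center.run, Center.init, singleGap]

theorem a_of_mem {t : ℝ} (h1 : δ ≤ t) (h2 : t < T) : (singleGap hδ hT).a t = 0 := by
  rw [Workload.a, Workload.center, upTo_of_mem hδ hT h1 h2]
  simp [Center.run, Center.init, Center.step, singleGap]

theorem a_of_ge {t : ℝ} (h : T ≤ t) : (singleGap hδ hT).a t = 1 := by
  rw [Workload.a, Workload.center, upTo_of_ge hδ hT h]
  simp [Center.run, Center.init, Center.step, singleGap]

theorem a_le_one (t : ℝ) : (singleGap hδ hT).a t ≤ 1 := by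
  rcases lt_or_ge t δ with h | h
  · exact (a_of_lt hδ hT h).le
  rcases lt_or_ge t T with h' | h'
  · rw [a_of_mem hδ hT h h']; exact zero_le_one
  · exact (a_of_ge hδ hT h').le

/-- As long as the arrivals are beyond the look-ahead window, the horizons cannot be told apart. -/
theorem sameInfo {T' : ℝ} (hT' : δ < T') {t w : ℝ} (ht : δ ≤ t) (hw : 0 ≤ w) (h : t + w < T)
    (h' : t + w < T') : SameInfo (singleGap hδ hT) (singleGap hδ hT') t w where
  start := rfl
  past := by
    rw [upTo_of_mem hδ hT ht (by linarith), upTo_of_mem hδ hT' ht (by linarith)]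
  window u h1 h2 := by
    rw [a_of_mem hδ hT (by linarith) (by linarith), a_of_mem hδ hT' (by linarith) (by linarith)]
  horizon hc := by
    rcases hc with hc | hc
    · exact absurd h (not_lt.mpr hc)
    · exact absurd h' (not_lt.mpr hc)

theorem optCost_le_stay (M : Model) :
    optCost M (singleGap hδ hT) ≤ ENNReal.ofReal (M.P * T) := by
  have hT0 := hδ.trans hT
  have hp : IsPartition T 1 (fun i : ℕ => T * i) :=
    ⟨fun i j hij => mul_lt_mul_of_pos_left (Nat.cast_lt.mpr hij) hT0, by simp, by simp⟩
  have hx : Adapted 1 (fun i : ℕ => T * i) (fun _ : ℝ => 1) := fun _ _ _ _ _ => rfl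
  have hf : Feasible (singleGap hδ hT) (fun _ => 1) :=
    ⟨⟨∅, fun _ _ _ _ _ _ => rfl⟩, fun t _ _ => a_le_one hδ hT t, (a_of_lt hδ hT hδ).symm,
      (a_of_ge hδ hT le_rfl).symm⟩
  refine (iInf₂_le _ hf).trans ?_
  change operationCost M T _ ≤ _
  rw [operationCost_eq M hp hx]
  simp [startCost]

theorem optCost_le_off (M : Model) :
    optCost M (singleGap hδ hT) ≤ ENNReal.ofReal (M.P * (δ + M.Δ)) := by
  have hT0 := hδ.trans hT
  let p : ℕ → ℝ := fun i => if i = 0 then 0 else if i = 1 then δ else T + ((i : ℝ) - 2)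
  have hp : IsPartition T 2 p := by
    refine ⟨strictMono_nat_of_lt_succ fun i => ?_, by simp [p], by simp [p]⟩
    rcases i with _ | _ | i
    · simpa [p] using hδ
    · simpa [p] using hT
    · simp [p]
  have hx : Adapted 2 p (singleGap hδ hT).a := by
    intro i hi t h1 h2
    rcases i with _ | _ | i
    · simp only [p] at h1 h2 ⊢
      norm_num at h1 h2 ⊢
      rw [a_of_lt hδ hT h2, a_of_lt hδ hT hδ]
    · simp only [p] at h1 h2 ⊢
      norm_num at h1 h2 ⊢
      rw [a_of_mem hδ hT h1 h2, a_of_mem hδ hT le_rfl hT]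
    · omega
  have hf : Feasible (singleGap hδ hT) (singleGap hδ hT).a := by
    refine ⟨⟨{δ, T}, fun s t _ hst _ hno => ?_⟩, fun _ _ _ => le_rfl, rfl, rfl⟩
    refine ((singleGap hδ hT).a_congr ((singleGap hδ hT).upTo_eq_of_no_event hst ?_)).symm
    intro e he
    refine hno e.1 ?_
    simp only [singleGap, List.mem_cons, List.not_mem_nil, or_false] at he
    rcases he with rfl | rfl <;> simp
  refine (iInf₂_le _ hf).trans ?_
  change operationCost M T _ ≤ _
  rw [operationCost_eq M hp hx, a_of_ge hδ hT le_rfl, a_of_lt hδ hT hδ]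
  refine ENNReal.ofReal_le_ofReal (le_of_eq ?_)
  have e0 : p 0 = 0 := by simp [p]
  have e1 : p 1 = δ := by simp [p]
  have e2 : p 2 = T := by simp [p]
  simp only [startCost, Finset.sum_range_succ, Finset.sum_range_zero, zero_add, e0, e1,
    Nat.reduceAdd, e2, a_of_lt hδ hT hδ, a_of_mem hδ hT le_rfl hT, a_of_ge hδ hT le_rfl]
  rw [mul_add M.P, M.P_mul_Δ]
  push_cast
  ring

end singleGap

theorem IsCompetitive.singleGap_le {M : Model} {C : Workload → ℝ≥0∞} {c : ℝ}
    (h : IsCompetitive M C c) {δ T : ℝ} (hδ : 0 < δ) (hT : δ < T) :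
    C (singleGap hδ hT) ≤ ENNReal.ofReal c * optCost M (singleGap hδ hT) := by
  have h0 := singleGap.a_of_lt hδ hT hδ
  refine h _ ⟨0, le_rfl, (singleGap hδ hT).T_pos.le, by rw [h0]; exact one_ne_zero⟩ ?_
  rw [h0]
  exact (singleGap.a_of_ge hδ hT le_rfl).ge

/-! ### Lower bounds for the cost in terms of a few observed states -/

section observed

variable (M : Model) {T : ℝ} {n : ℕ} {p : ℕ → ℝ} {x : ℝ → ℕ}

theorem startCost_step (hp : IsPartition T n p) (k : ℕ) :
    M.P * (x (p k) * (p (k + 1) - p k)) ≤ startCost M p x (k + 1) - startCost M p x k ∧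
      (M.βon + M.βoff) * ((x (p (k + 1)) : ℝ) - x (p k)) ≤
        startCost M p x (k + 1) - startCost M p x k := by
  have h1 : 0 ≤ M.P * (x (p k) * (p (k + 1) - p k)) := mul_nonneg M.P_pos.le
    (mul_nonneg (Nat.cast_nonneg _) (sub_nonneg.mpr (hp.strictMono (Nat.lt_succ_self k)).le))
  have h2 : 0 ≤ (M.βon + M.βoff) * ((x (p (k + 1)) - x (p k) : ℕ) : ℝ) :=
    mul_nonneg M.β_nonneg (Nat.cast_nonneg _)
  have h3 : (x (p (k + 1)) : ℝ) - x (p k) ≤ ((x (p (k + 1)) - x (p k) : ℕ) : ℝ) := by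
    rw [sub_le_iff_le_add]
    exact_mod_cast le_tsub_add
  have h4 := mul_le_mul_of_nonneg_left h3 M.β_nonneg
  rw [startCost_succ]
  constructor <;> linarith

theorem startCost_mono (hp : IsPartition T n p) : Monotone (startCost M p x) := by
  refine monotone_nat_of_le_succ fun k => ?_
  have h := (startCost_step M (x := x) hp k).1
  have h1 : 0 ≤ M.P * (x (p k) * (p (k + 1) - p k)) := mul_nonneg M.P_pos.le
    (mul_nonneg (Nat.cast_nonneg _) (sub_nonneg.mpr (hp.strictMono (Nat.lt_succ_self k)).le))
  linarith

theorem startCost_sub_ge_jump (hp : IsPartition T n p) {i j : ℕ} (hij : i ≤ j) :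
    (M.βon + M.βoff) * ((x (p j) : ℝ) - x (p i)) ≤ startCost M p x j - startCost M p x i := by
  induction j, hij using Nat.le_induction with
  | base => simp
  | succ j _ ih =>
    have := (startCost_step M (x := x) hp j).2
    linarith

theorem startCost_sub_ge_on (hp : IsPartition T n p) {i j : ℕ} (hij : i ≤ j)
    (hx : ∀ l, i ≤ l → l < j → 1 ≤ x (p l)) :
    M.P * (p j - p i) ≤ startCost M p x j - startCost M p x i := by
  induction j, hij using Nat.le_induction with
  | base => simp
  | succ j hj ih =>
    have h1 := ih fun l h1 h2 => hx l h1 (by omega)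
    have h2 := (startCost_step M (x := x) hp j).1
    have h3 : (1 : ℝ) ≤ x (p j) := by exact_mod_cast hx j hj (Nat.lt_succ_self j)
    have h4 : M.P * (1 * (p (j + 1) - p j)) ≤ M.P * (x (p j) * (p (j + 1) - p j)) :=
      mul_le_mul_of_nonneg_left (mul_le_mul_of_nonneg_right h3
        (sub_nonneg.mpr (hp.strictMono (Nat.lt_succ_self j)).le)) M.P_pos.le
    linarith

/-- If some server is on at two times, then it has been on in between, or a server has been turned
on again. -/
theorem gapCost_le_startCost_sub (hp : IsPartition T n p) {i j : ℕ} (hij : i ≤ j)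
    (hj : 1 ≤ x (p j)) :
    gapCost M (p j - p i) ≤ startCost M p x j - startCost M p x i := by
  by_cases h : ∀ l, i ≤ l → l < j → 1 ≤ x (p l)
  · exact (min_le_left _ _).trans (startCost_sub_ge_on M hp hij h)
  · push Not at h
    obtain ⟨l, h1, h2, h3⟩ := h
    have h4 := startCost_sub_ge_jump M (x := x) hp h2.le
    have h5 := startCost_mono M (x := x) hp h1
    have h6 : (1 : ℝ) ≤ x (p j) := by exact_mod_cast hj
    have h7 : (x (p l) : ℝ) = 0 := by
      have : x (p l) = 0 := by omega
      rw [this, Nat.cast_zero]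
    have h8 : (M.βon + M.βoff) * 1 ≤ (M.βon + M.βoff) * ((x (p j) : ℝ) - x (p l)) :=
      mul_le_mul_of_nonneg_left (by linarith) M.β_nonneg
    refine (min_le_right _ _).trans ?_
    linarith

end observed

/-- The cost of a profile that starts and ends with one server, when some server is on at the times
`δ + i η` for `i < N`, and none is on for `i = N` unless `N = k + 1`. -/
theorem observed_le_operationCost (M : Model) {T δ η : ℝ} (hT : 0 < T) {x : ℝ → ℕ}
    (hx : IsStep T x) (h0 : x 0 = 1) (hxT : x T = 1) (hδ : 0 ≤ δ) (hη : 0 ≤ η) (hηΔ : η ≤ M.Δ)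
    {k N : ℕ} (hN : N ≤ k + 1) (hkT : δ + k * η ≤ T) (hTk : T - (δ + k * η) ≤ M.Δ)
    (hon : ∀ i < N, 1 ≤ x (δ + i * η)) (hoff : N ≤ k → x (δ + N * η) = 0) :
    ENNReal.ofReal (M.P * (if k < N then T - δ else (N - 1) * η + M.Δ)) ≤
      operationCost M T x := by
  classical
  obtain ⟨n, p, hp, hxp, hF⟩ := hx.exists_adapted
    ((Finset.range (k + 1)).image fun i : ℕ => δ + i * η) hT
  have hidx : ∀ i ≤ k, ∃ l ≤ n, p l = δ + i * η := by
    intro i hi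
    have h1 : (i : ℝ) * η ≤ k * η := mul_le_mul_of_nonneg_right (by exact_mod_cast hi) hη
    refine hF _ (Finset.mem_image_of_mem _ (Finset.mem_range.mpr (by omega))) ?_ (by linarith)
    have : 0 ≤ (i : ℝ) * η := mul_nonneg (Nat.cast_nonneg _) hη
    linarith
  have hS0 : ∀ l, 0 ≤ startCost M p x l := fun l => by
    have h := startCost_mono M (x := x) hp (Nat.zero_le l)
    simpa [startCost] using h
  have grid : ∀ i ≤ k, i < N → ∀ l, p l = δ + i * η → M.P * (i * η) ≤ startCost M p x l := by
    intro i
    induction i with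
    | zero => intro _ _ l _; simpa using hS0 l
    | succ i ih =>
      intro hi hiN l hl
      obtain ⟨m, -, hm⟩ := hidx i (by omega)
      have h1 := ih (by omega) (by omega) m hm
      have hlm : p l - p m = η := by rw [hl, hm]; push_cast; ring
      have hml : m ≤ l := by
        by_contra hc
        have := hp.strictMono (not_le.mp hc)
        linarith
      have h2 := gapCost_le_startCost_sub M (x := x) hp hml (by rw [hl]; exact hon _ hiN)
      rw [hlm, gapCost_eq_of_le hηΔ] at h2
      push_cast
      linarith
  rw [operationCost_eq M hp hxp, h0, hxT]
  refine ENNReal.ofReal_le_ofReal ?_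
  rw [sub_self, mul_zero, sub_zero]
  split_ifs with hkN
  · obtain ⟨l, hl, hpl⟩ := hidx k le_rfl
    have h1 := grid k le_rfl hkN l hpl
    have h2 := gapCost_le_startCost_sub M (x := x) hp hl (by rw [hp.last, hxT])
    rw [hp.last, hpl, gapCost_eq_of_le hTk] at h2
    linarith
  · obtain ⟨l, hl, hpl⟩ := hidx N (by omega)
    have h1 := startCost_sub_ge_jump M (x := x) hp hl
    rw [hp.last, hxT, hpl, hoff (by omega), Nat.cast_one, Nat.cast_zero, sub_zero, mul_one] at h1
    rw [mul_add, M.P_mul_Δ]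
    rcases N with _ | N
    · have h2 := hS0 l
      have h3 := mul_nonneg M.P_pos.le hη
      push_cast
      linarith
    · obtain ⟨m, -, hm⟩ := hidx N (by omega)
      have h2 := grid N (by omega) (Nat.lt_succ_self N) m hm
      have hml : m ≤ l := by
        by_contra hc
        have h3 := hp.strictMono (not_le.mp hc)
        rw [hm, hpl] at h3
        push_cast at h3
        linarith
      have h3 := startCost_mono M (x := x) hp hml
      push_cast
      rw [add_sub_cancel_right]
      linarith

/-! ### The adversary -/

/-- The gap has a length of `(k + 1) η` beyond the look-ahead window; `η` is the mesh at which the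
adversary observes the algorithm. -/
noncomputable def adversary (M : Model) {η : ℝ} (hη : 0 < η) (k : ℕ) : Workload :=
  singleGap (δ := η) (T := η + ((k + 1) * η + M.α * M.Δ)) hη (by
    have := mul_nonneg M.α_nonneg M.Δ_pos.le
    have : 0 < ((k : ℝ) + 1) * η := by positivity
    linarith)

section adversary

variable (M : Model) {η : ℝ} (hη : 0 < η)

theorem optCost_adversary_le (k : ℕ) :
    optCost M (adversary M hη k) ≤
      ENNReal.ofReal (M.P * (η + min ((k + 1) * η + M.α * M.Δ) M.Δ)) := by
  rcases min_choice ((k + 1) * η + M.α * M.Δ) M.Δ with h | h <;> rw [h]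
  · exact singleGap.optCost_le_stay _ _ M
  · exact singleGap.optCost_le_off _ _ M

/-- What the algorithm has to pay for the `k`-th gap if it is first seen without a server on at the
`N`-th observation. -/
noncomputable def adversaryCost (M : Model) (η : ℝ) (k N : ℕ) : ℝ :=
  if k < N then (k + 1) * η + M.α * M.Δ else (N - 1) * η + M.Δ

theorem adversaryCost_nonneg (hηΔ : η ≤ M.Δ) (hη : 0 < η) (k N : ℕ) :
    0 ≤ adversaryCost M η k N := by
  have := mul_nonneg M.α_nonneg M.Δ_pos.le
  unfold adversaryCost
  split_ifs
  · positivity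
  · have : 0 ≤ (N : ℝ) * η := by positivity
    linarith

/-- Up to the `k`-th observation, the gaps with indices `≥ k` look alike. -/
theorem IsOnline.adversary_eq {A : Policy} (hA : IsOnline M A) {i k m : ℕ} (hik : i ≤ k)
    (hkm : k ≤ m) :
    A (adversary M hη k) (η + i * η) = A (adversary M hη m) (η + i * η) := by
  have hw := mul_nonneg M.α_nonneg M.Δ_pos.le
  have h1 : (i : ℝ) * η ≤ k * η := mul_le_mul_of_nonneg_right (by exact_mod_cast hik) hη.le
  have h2 : (k : ℝ) * η ≤ m * η := mul_le_mul_of_nonneg_right (by exact_mod_cast hkm) hη.le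
  have h0 : 0 ≤ (i : ℝ) * η := by positivity
  refine hA.nonanticipating _ _ _ (by linarith) ?_ ?_ ?_
  · change _ ≤ η + ((k + 1) * η + M.α * M.Δ); linarith
  · change _ ≤ η + ((m + 1) * η + M.α * M.Δ); linarith
  · exact singleGap.sameInfo _ _ _ (by linarith) hw (by linarith) (by linarith)

theorem IsOnline.adversaryCost_le {A : Policy} (hA : IsOnline M A) {k m N : ℕ} (hkm : k ≤ m)
    (hηD : η ≤ (1 - M.α) * M.Δ) (hon : ∀ i < N, i ≤ m → A (adversary M hη m) (η + i * η) ≠ ∅)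
    (hoff : N ≤ m → A (adversary M hη m) (η + N * η) = ∅) :
    ENNReal.ofReal (M.P * adversaryCost M η k N) ≤ A.cost M (adversary M hη k) := by
  have hw := mul_nonneg M.α_nonneg M.Δ_pos.le
  have hkη : 0 ≤ (k : ℝ) * η := by positivity
  have h := observed_le_operationCost M (T := (adversary M hη k).T) (δ := η) (η := η)
    (x := fun t => (A (adversary M hη k) t).card) (k := k) (N := min N (k + 1))
    (adversary M hη k).T_pos ?_ ?_ ?_ hη.le hη.le (by linarith) (min_le_right _ _) ?_ ?_ ?_ ?_
  · refine le_trans (le_of_eq ?_) h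
    unfold adversaryCost
    congr 2
    by_cases hkN : k < N
    · rw [if_pos hkN, if_pos (lt_min hkN (Nat.lt_succ_self k))]
      change _ = η + ((k + 1) * η + M.α * M.Δ) - η
      ring
    · rw [if_neg hkN, min_eq_left (by omega), if_neg hkN]
  · obtain ⟨E, hE⟩ := hA.step (adversary M hη k)
    exact ⟨E, fun s t h1 h2 h3 h4 => congrArg Finset.card (hE s t h1 h2 h3 h4)⟩
  · exact (hA.start _).trans (singleGap.a_of_lt _ _ hη)
  · exact (hA.finish _).trans (singleGap.a_of_ge _ _ le_rfl)
  · change _ ≤ η + ((k + 1) * η + M.α * M.Δ); linarith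
  · change η + ((k + 1) * η + M.α * M.Δ) - _ ≤ _; linarith
  · intro i hi
    have hi' := lt_min_iff.mp hi
    rw [hA.adversary_eq M hη (by omega) hkm, Nat.one_le_iff_ne_zero, Ne, Finset.card_eq_zero]
    exact hon i hi'.1 (by omega)
  · intro hN
    have hNk : N ≤ k := by omega
    rw [min_eq_left (by omega), hA.adversary_eq M hη hNk hkm, hoff (hNk.trans hkm),
      Finset.card_empty]

end adversary

theorem le_max_one_mul_of_ofReal_le {P a b c : ℝ} (hP : 0 < P) (hb : 0 ≤ b) {q : ℝ≥0∞}
    (h1 : ENNReal.ofReal (P * a) ≤ ENNReal.ofReal c * q) (h2 : q ≤ ENNReal.ofReal (P * b)) :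
    a ≤ max c 1 * b := by
  have hc : 0 ≤ max c 1 := zero_le_one.trans (le_max_right _ _)
  have h3 : ENNReal.ofReal (P * a) ≤ ENNReal.ofReal (max c 1 * (P * b)) := by
    rw [ENNReal.ofReal_mul hc]
    exact h1.trans (mul_le_mul' (ENNReal.ofReal_le_ofReal (le_max_left _ _)) h2)
  rw [ENNReal.ofReal_le_ofReal_iff (mul_nonneg hc (mul_nonneg hP.le hb))] at h3
  have h4 : P * a ≤ P * (max c 1 * b) := by linarith
  exact le_of_mul_le_mul_left h4 hP

/-- On a horizon shorter than `Δ` there is nothing better than to stay on, so that no algorithm has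
a ratio below `1`. -/
theorem IsOnline.cost_short_ge {M : Model} {A : Policy} (hA : IsOnline M A) {δ T : ℝ} (hδ : 0 < δ)
    (hT : δ < T) (hTΔ : T ≤ M.Δ) :
    ENNReal.ofReal (M.P * T) ≤ A.cost M (singleGap hδ hT) := by
  obtain ⟨E, hE⟩ := hA.step (singleGap hδ hT)
  have hstep : IsStep T (fun t => (A (singleGap hδ hT) t).card) :=
    ⟨E, fun s t h1 h2 h3 h4 => congrArg Finset.card (hE s t h1 h2 h3 h4)⟩
  have h0 : (A (singleGap hδ hT) 0).card = 1 :=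
    (hA.start _).trans (singleGap.a_of_lt _ _ hδ)
  have hT1 : (A (singleGap hδ hT) T).card = 1 :=
    (hA.finish _).trans (singleGap.a_of_ge _ _ le_rfl)
  have h := observed_le_operationCost M (δ := 0) (η := 0) (k := 0) (N := 1) (hδ.trans hT) hstep
    h0 hT1 le_rfl le_rfl M.Δ_pos.le le_rfl (by simpa using (hδ.trans hT).le) (by simpa using hTΔ)
    (by intro i _; simp [h0]) (by simp)
  rw [if_pos zero_lt_one, sub_zero] at h
  exact h

theorem one_le_of_isCompetitive {M : Model} {C : Workload → ℝ≥0∞} {c : ℝ}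
    (h : IsCompetitive M C c)
    (hC : ∀ (δ T : ℝ) (hδ : 0 < δ) (hT : δ < T), T ≤ M.Δ →
      ENNReal.ofReal (M.P * T) ≤ C (singleGap hδ hT)) : 1 ≤ c := by
  have hΔ := M.Δ_pos
  have hδ : 0 < M.Δ / 2 := by linarith
  have hT : M.Δ / 2 < M.Δ := by linarith
  have h1 := ((hC _ _ hδ hT le_rfl).trans (h.singleGap_le hδ hT)).trans
    (mul_le_mul_right (singleGap.optCost_le_stay hδ hT M) _)
  have hpos : 0 < M.P * M.Δ := mul_pos M.P_pos hΔ
  rw [mul_comm (ENNReal.ofReal c), ← ENNReal.ofReal_mul hpos.le] at h1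
  by_contra hc
  have h2 : M.P * M.Δ * c < M.P * M.Δ := by
    have := mul_lt_mul_of_pos_left (not_le.mp hc) hpos
    linarith
  exact absurd h1 (not_le.mpr ((ENNReal.ofReal_lt_ofReal_iff hpos).mpr h2))

/-- If the algorithm turns off within `(1 - α) Δ`, the adversary ends the gap just beyond the window;
otherwise a gap of length `(2 - α) Δ` is taken, for which the minimum cost is that of turning off
and on at once. -/
theorem two_sub_le_of_isCompetitive {M : Model} {A : Policy} (hA : IsOnline M A) {c : ℝ}
    (hc : IsCompetitive M (A.cost M) c) : 2 - M.α ≤ c := by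
  classical
  have hΔ := M.Δ_pos
  have hone : 1 ≤ c := one_le_of_isCompetitive hc fun δ T hδ hT h => hA.cost_short_ge hδ hT h
  rcases M.α_le_one.lt_or_eq with hα | hα
  swap
  · rw [hα]; linarith
  have hw := mul_nonneg M.α_nonneg hΔ.le
  obtain ⟨D, hDM⟩ : ∃ D, D = (1 - M.α) * M.Δ := ⟨_, rfl⟩
  have hD : 0 < D := hDM ▸ mul_pos (by linarith) hΔ
  have hΔD : M.Δ = D + M.α * M.Δ := by rw [hDM]; ring
  have key : ∀ n : ℕ, 0 < n → M.Δ * (2 - M.α - c) ≤ (1 + 2 * c) * D / n := by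
    intro n hn
    have hn0 : (0 : ℝ) < n := by exact_mod_cast hn
    have hn1 : (1 : ℝ) ≤ n := by exact_mod_cast hn
    obtain ⟨η, hηdef⟩ : ∃ η, η = D / n := ⟨_, rfl⟩
    have hη : 0 < η := hηdef ▸ div_pos hD hn0
    have hnη : n * η = D := by rw [hηdef]; field_simp
    have hηD : η ≤ D := hηdef ▸ div_le_self hD.le hn1
    rw [mul_div_assoc, ← hηdef]
    have hex : ∃ N : ℕ, A (adversary M hη (2 * n)) (η + N * η) = ∅ ∨ 2 * n < N :=
      ⟨2 * n + 1, Or.inr (Nat.lt_succ_self _)⟩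
    obtain ⟨N, hNdef⟩ : ∃ N, N = Nat.find hex := ⟨_, rfl⟩
    have hon : ∀ i < N, i ≤ 2 * n → A (adversary M hη (2 * n)) (η + i * η) ≠ ∅ :=
      fun i hi _ h => Nat.find_min hex (hNdef ▸ hi) (Or.inl h)
    have hoff : N ≤ 2 * n → A (adversary M hη (2 * n)) (η + N * η) = ∅ := fun h => by
      have := Nat.find_spec hex
      rw [← hNdef] at this
      exact this.resolve_right (by omega)
    have main : ∀ k ≤ 2 * n, adversaryCost M η k N ≤
        c * (η + min ((k + 1) * η + M.α * M.Δ) M.Δ) := by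
      intro k hk
      have h := le_max_one_mul_of_ofReal_le M.P_pos (by positivity)
        ((hA.adversaryCost_le M hη hk (hDM ▸ hηD) hon hoff).trans (hc.singleGap_le _ _))
        (optCost_adversary_le M hη k)
      rwa [max_eq_left hone] at h
    rcases le_or_gt N n with hNn | hNn
    · have h := main N (by omega)
      rw [adversaryCost, if_neg (lt_irrefl N)] at h
      have h1 : c * (η + min ((N + 1) * η + M.α * M.Δ) M.Δ) ≤
          c * (η + ((N + 1) * η + M.α * M.Δ)) :=
        mul_le_mul_of_nonneg_left (by linarith [min_le_left ((N + 1) * η + M.α * M.Δ) M.Δ])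
          (by linarith)
      have h2 : (N : ℝ) * η ≤ D := by
        rw [← hnη]; exact mul_le_mul_of_nonneg_right (by exact_mod_cast hNn) hη.le
      have h3 : (c - 1) * (N * η) ≤ (c - 1) * D := mul_le_mul_of_nonneg_left h2 (by linarith)
      have h4 : (c - 1) * D + c * (M.α * M.Δ) - M.Δ = M.Δ * (c - 2 + M.α) := by rw [hDM]; ring
      linarith
    · have h := main (2 * n) le_rfl
      have h1 : D + M.Δ ≤ adversaryCost M η (2 * n) N := by
        unfold adversaryCost
        split_ifs with h2
        · push_cast; linarith
        · have h3 : (n : ℝ) + 1 ≤ N := by exact_mod_cast hNn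
          have h4 := mul_le_mul_of_nonneg_right h3 hη.le
          linarith
      have h2 := mul_le_mul_of_nonneg_left
        (min_le_right ((((2 * n : ℕ) : ℝ) + 1) * η + M.α * M.Δ) M.Δ) (zero_le_one.trans hone)
      have h3 : M.Δ * (2 - M.α) = D + M.Δ := by rw [hDM]; ring
      have h4 : 0 ≤ c * η := mul_nonneg (by linarith) hη.le
      linarith
  have hlim : Tendsto (fun n : ℕ => (1 + 2 * c) * D / n) atTop (𝓝 0) :=
    tendsto_const_div_atTop_nhds_zero_nat _
  have h := ge_of_tendsto hlim (eventually_atTop.mpr ⟨1, fun n hn => key n hn⟩)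
  by_contra hcon
  have := mul_pos hΔ (sub_pos.mpr (not_le.mp hcon))
  linarith

/-! ### Randomizing the adversary -/

/-- The weights `r ^ k - r ^ (k + 1)` of the gaps `k < n`, and `r ^ n` of a long gap, make the
algorithm nearly indifferent as to when it turns off. -/
theorem le_weighted_adversaryCost (M : Model) {n N : ℕ} (hn : 0 < n) {η r : ℝ} (hη : 0 ≤ η)
    (hnη : n * η = (1 - M.α) * M.Δ) (hr : r = 1 - 1 / n) :
    M.Δ - η ≤ ∑ k ∈ Finset.range n, (r ^ k - r ^ (k + 1)) * adversaryCost M η k N +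
      r ^ n * adversaryCost M η (2 * n) N := by
  have hn1 : (1 : ℝ) ≤ n := by exact_mod_cast hn
  have hn0 : (n : ℝ) ≠ 0 := by linarith
  have hr0 : 0 ≤ r := by
    rw [hr, sub_nonneg]; exact div_le_one_of_le₀ hn1 (by linarith)
  have hrη : (1 - r) * (n * η) = η := by rw [hr]; field_simp; ring
  have hr1 : 0 ≤ 1 - r := by rw [hr]; simp
  have key : ∀ m ≤ n, M.Δ - η ≤
      ∑ k ∈ Finset.range m, (r ^ k - r ^ (k + 1)) * adversaryCost M η k N +
        r ^ m * (((min N m : ℕ) - 1) * η + M.Δ) := by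
    intro m
    induction m with
    | zero => intro _; simp
    | succ m ih =>
      intro hm
      have h1 := ih (by omega)
      have hrm := pow_nonneg hr0 m
      rw [Finset.sum_range_succ]
      rcases le_or_gt N m with hNm | hNm
      · rw [min_eq_left hNm] at h1
        rw [min_eq_left (by omega), adversaryCost, if_neg (by omega)]
        linarith
      · rw [min_eq_right hNm.le] at h1
        rw [min_eq_right (by omega), adversaryCost, if_pos hNm]
        have h2 : 0 ≤ r ^ m * ((1 - r) * η) := mul_nonneg hrm (mul_nonneg hr1 hη)
        have h3 : r ^ m * ((1 - r) * (n * η)) = r ^ m * η := by rw [hrη]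
        have h4 : M.α * M.Δ = M.Δ - n * η := by rw [hnη]; ring
        rw [h4, pow_succ]
        push_cast
        linarith
  refine (key n le_rfl).trans (add_le_add_right (mul_le_mul_of_nonneg_left ?_
    (pow_nonneg hr0 n)) _)
  unfold adversaryCost
  rcases le_or_gt N n with hNn | hNn
  · rw [min_eq_left hNn, if_neg (by omega)]
  · rw [min_eq_right hNn.le]
    have h4 : M.α * M.Δ = M.Δ - n * η := by rw [hnη]; ring
    split_ifs with h
    · rw [h4]
      push_cast
      linarith
    · have h5 : (n : ℝ) * η ≤ N * η :=
        mul_le_mul_of_nonneg_right (by exact_mod_cast hNn.le) hη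
      linarith

theorem weighted_gap_sum (M : Model) {n : ℕ} (hn : 0 < n) {η r : ℝ}
    (hnη : n * η = (1 - M.α) * M.Δ) (hr : r = 1 - 1 / n) :
    ∑ k ∈ Finset.range n, (r ^ k - r ^ (k + 1)) * (η + ((k + 1) * η + M.α * M.Δ)) +
      r ^ n * (η + M.Δ) = η + M.Δ - r ^ n * ((1 - M.α) * M.Δ) := by
  have hn0 : (n : ℝ) ≠ 0 := by exact_mod_cast hn.ne'
  have hrη : (1 - r) * (n * η) = η := by rw [hr]; field_simp; ring
  have h4 : M.α * M.Δ = M.Δ - n * η := by rw [hnη]; ring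
  have key : ∀ m : ℕ, ∑ k ∈ Finset.range m,
      (r ^ k - r ^ (k + 1)) * (η + ((k + 1) * η + M.α * M.Δ)) =
      (η + M.Δ) * (1 - r ^ m) - η * m * r ^ m := by
    intro m
    induction m with
    | zero => simp
    | succ m ih =>
      have h3 : r ^ m * ((1 - r) * (n * η)) = r ^ m * η := by rw [hrη]
      rw [Finset.sum_range_succ, ih, h4, pow_succ]
      push_cast
      linarith
  rw [key n, ← hnη]
  ring

theorem IsRandomizedOnline.measurableSet_eq_empty {Ω : Type*} [MeasurableSpace Ω] {M : Model}
    {A : Ω → Policy} (hA : IsRandomizedOnline M A) (W : Workload) (t : ℝ) :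
    MeasurableSet {ω | A ω W t = ∅} := by
  have h : {ω | A ω W t = ∅} = ⋂ s : ℕ, {ω | s ∈ A ω W t}ᶜ := by
    ext ω
    simp [Finset.eq_empty_iff_forall_notMem]
  rw [h]
  exact MeasurableSet.iInter fun s => (hA.measurable W t s).compl

/-- The mean cost over the randomized gaps is at least `Δ` (in units of `P`) for every deterministic
algorithm, up to the mesh, hence also for a randomized one. -/
theorem weighted_adversary_le {Ω : Type*} [MeasurableSpace Ω] {M : Model} {μ : Measure Ω}
    [IsProbabilityMeasure μ] {A : Ω → Policy} (hA : IsRandomizedOnline M A) {c : ℝ}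
    (hc : IsCompetitive M (expectedCost M μ A) c) {n : ℕ} (hn : 0 < n) {η r : ℝ} (hη : 0 < η)
    (hnη : n * η = (1 - M.α) * M.Δ) (hr : r = 1 - 1 / n) :
    M.Δ - η ≤ max c 1 * (η + M.Δ - r ^ n * ((1 - M.α) * M.Δ)) := by
  classical
  have hn1 : (1 : ℝ) ≤ n := by exact_mod_cast hn
  have hw := mul_nonneg M.α_nonneg M.Δ_pos.le
  have hP := M.P_pos
  have hηD : η ≤ (1 - M.α) * M.Δ := by rw [← hnη]; exact le_mul_of_one_le_left hη.le hn1
  have hηΔ : η ≤ M.Δ := by linarith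
  have hr0 : 0 ≤ r := by
    rw [hr, sub_nonneg]; exact div_le_one_of_le₀ hn1 (by linarith)
  have hr1 : r ≤ 1 := by rw [hr]; simp
  have hwt : ∀ k, 0 ≤ r ^ k - r ^ (k + 1) := fun k =>
    sub_nonneg.mpr (pow_le_pow_of_le_one hr0 hr1 (Nat.le_succ k))
  -- the first observation without a server on
  have hex : ∀ ω, ∃ N : ℕ, A ω (adversary M hη (2 * n)) (η + N * η) = ∅ ∨ 2 * n < N :=
    fun _ => ⟨2 * n + 1, Or.inr (Nat.lt_succ_self _)⟩
  let N : Ω → ℕ := fun ω => Nat.find (hex ω)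
  have hN : Measurable N := measurable_find hex fun k =>
    (hA.measurableSet_eq_empty _ _).union (MeasurableSet.const _)
  have hH : ∀ k, Measurable fun ω => ENNReal.ofReal (M.P * adversaryCost M η k (N ω)) :=
    fun k => (measurable_from_nat (f := fun m =>
      ENNReal.ofReal (M.P * adversaryCost M η k m))).comp hN
  have hle : ∀ k ≤ 2 * n, ∫⁻ ω, ENNReal.ofReal (M.P * adversaryCost M η k (N ω)) ∂μ ≤
      ENNReal.ofReal c * optCost M (adversary M hη k) := by
    intro k hk
    refine le_trans (lintegral_mono fun ω => ?_) (hc.singleGap_le _ _)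
    refine (hA.online ω).adversaryCost_le M hη hk hηD (fun i hi _ h => ?_) (fun h => ?_)
    · exact Nat.find_min (hex ω) hi (Or.inl h)
    · exact (Nat.find_spec (hex ω)).resolve_right (not_lt.mpr h)
  have hbound : ∀ k ≤ 2 * n, ∀ v B : ℝ, 0 ≤ v →
      min ((k + 1) * η + M.α * M.Δ) M.Δ ≤ B →
      ∫⁻ ω, ENNReal.ofReal (v * (M.P * adversaryCost M η k (N ω))) ∂μ ≤
        ENNReal.ofReal (max c 1) * ENNReal.ofReal (v * (M.P * (η + B))) := by
    intro k hk v B hv hB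
    have h1 : optCost M (adversary M hη k) ≤ ENNReal.ofReal (M.P * (η + B)) :=
      (optCost_adversary_le M hη k).trans (ENNReal.ofReal_le_ofReal
        (mul_le_mul_of_nonneg_left (by linarith) hP.le))
    simp only [ENNReal.ofReal_mul hv]
    rw [lintegral_const_mul _ (hH k), mul_left_comm]
    exact mul_le_mul_right ((hle k hk).trans
      (mul_le_mul' (ENNReal.ofReal_le_ofReal (le_max_left _ _)) h1)) _
  have hcost0 : ∀ k m, 0 ≤ M.P * adversaryCost M η k m := fun k m =>
    mul_nonneg hP.le (adversaryCost_nonneg M hηΔ hη k m)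
  have hmeas : ∀ k (v : ℝ), 0 ≤ v →
      Measurable fun ω => ENNReal.ofReal (v * (M.P * adversaryCost M η k (N ω))) := by
    intro k v hv
    simp only [ENNReal.ofReal_mul hv]
    exact (hH k).const_mul _
  have hgap0 : ∀ k : ℕ, 0 ≤ M.P * (η + (((k : ℝ) + 1) * η + M.α * M.Δ)) := fun k => by
    have : 0 ≤ ((k : ℝ) + 1) * η := by positivity
    exact mul_nonneg hP.le (by linarith)
  have hchain : ENNReal.ofReal (M.P * (M.Δ - η)) ≤ ENNReal.ofReal (max c 1) *
      ENNReal.ofReal (M.P * (η + M.Δ - r ^ n * ((1 - M.α) * M.Δ))) := by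
    calc ENNReal.ofReal (M.P * (M.Δ - η))
        = ∫⁻ _, ENNReal.ofReal (M.P * (M.Δ - η)) ∂μ := by
          rw [lintegral_const, measure_univ, mul_one]
      _ ≤ ∫⁻ ω, (∑ k ∈ Finset.range n,
            ENNReal.ofReal ((r ^ k - r ^ (k + 1)) * (M.P * adversaryCost M η k (N ω)))) +
            ENNReal.ofReal (r ^ n * (M.P * adversaryCost M η (2 * n) (N ω))) ∂μ := by
          refine lintegral_mono fun ω => ?_
          rw [← ENNReal.ofReal_sum_of_nonneg (fun k _ => mul_nonneg (hwt k) (hcost0 k _)),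
            ← ENNReal.ofReal_add (Finset.sum_nonneg fun k _ => mul_nonneg (hwt k) (hcost0 k _))
              (mul_nonneg (pow_nonneg hr0 n) (hcost0 _ _))]
          refine ENNReal.ofReal_le_ofReal ?_
          refine (mul_le_mul_of_nonneg_left
            (le_weighted_adversaryCost M (N := N ω) hn hη.le hnη hr) hP.le).trans (le_of_eq ?_)
          rw [mul_add, Finset.mul_sum]
          congr 1
          · exact Finset.sum_congr rfl fun k _ => by ring
          · ring
      _ = (∑ k ∈ Finset.range n, ∫⁻ ω,
            ENNReal.ofReal ((r ^ k - r ^ (k + 1)) * (M.P * adversaryCost M η k (N ω))) ∂μ) +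
            ∫⁻ ω, ENNReal.ofReal (r ^ n * (M.P * adversaryCost M η (2 * n) (N ω))) ∂μ := by
          rw [lintegral_add_right _ (hmeas _ _ (pow_nonneg hr0 n)),
            lintegral_finsetSum _ fun k _ => hmeas k _ (hwt k)]
      _ ≤ (∑ k ∈ Finset.range n, ENNReal.ofReal (max c 1) * ENNReal.ofReal
            ((r ^ k - r ^ (k + 1)) * (M.P * (η + ((k + 1) * η + M.α * M.Δ))))) +
            ENNReal.ofReal (max c 1) * ENNReal.ofReal (r ^ n * (M.P * (η + M.Δ))) := by
          refine add_le_add (Finset.sum_le_sum fun k hk => ?_) ?_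
          · have := Finset.mem_range.mp hk
            exact hbound k (by omega) _ _ (hwt k) (min_le_left _ _)
          · exact hbound (2 * n) le_rfl _ _ (pow_nonneg hr0 n) (min_le_right _ _)
      _ = _ := by
          rw [← Finset.mul_sum, ← mul_add, ← ENNReal.ofReal_sum_of_nonneg
              (fun k _ => mul_nonneg (hwt k) (hgap0 k)),
            ← ENNReal.ofReal_add (Finset.sum_nonneg fun k _ => mul_nonneg (hwt k) (hgap0 k))
              (mul_nonneg (pow_nonneg hr0 n) (mul_nonneg hP.le (by linarith [M.Δ_pos]))),
            ← weighted_gap_sum M hn hnη hr,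
            mul_add M.P (Finset.sum _ _), Finset.mul_sum]
          congr 3
          · exact Finset.sum_congr rfl fun k _ => by ring
          · ring
  refine (le_max_one_mul_of_ofReal_le hP ?_ hchain le_rfl).trans
    (by rw [max_eq_left (le_max_right _ _)])
  have h1 : r ^ n * ((1 - M.α) * M.Δ) ≤ 1 * ((1 - M.α) * M.Δ) :=
    mul_le_mul_of_nonneg_right (pow_le_one₀ hr0 hr1) (by linarith)
  linarith

theorem le_of_isCompetitive_expectedCost {Ω : Type*} [MeasurableSpace Ω] {M : Model}
    {μ : Measure Ω} [IsProbabilityMeasure μ] {A : Ω → Policy} (hA : IsRandomizedOnline M A) {c : ℝ}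
    (hc : IsCompetitive M (expectedCost M μ A) c) :
    Real.exp 1 / (Real.exp 1 - 1 + M.α) ≤ c := by
  have hΔ := M.Δ_pos
  have he := exp_one_sub_one_pos
  have hα0 := M.α_nonneg
  have hq : 0 < Real.exp 1 - 1 + M.α := by linarith
  have hone : 1 ≤ c := by
    refine one_le_of_isCompetitive hc fun δ T hδ hT h => ?_
    calc ENNReal.ofReal (M.P * T) = ∫⁻ _, ENNReal.ofReal (M.P * T) ∂μ := by
          rw [lintegral_const, measure_univ, mul_one]
      _ ≤ _ := lintegral_mono fun ω => (hA.online ω).cost_short_ge hδ hT h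
  rcases M.α_le_one.lt_or_eq with hα | hα
  swap
  · rw [hα, sub_add_cancel, div_self (Real.exp_pos 1).ne']; exact hone
  obtain ⟨D, hDM⟩ : ∃ D, D = (1 - M.α) * M.Δ := ⟨_, rfl⟩
  have hD : 0 < D := hDM ▸ mul_pos (by linarith) hΔ
  have key : ∀ n : ℕ, 0 < n →
      M.Δ - D / n ≤ c * (D / n + M.Δ - (1 + (-1) / (n : ℝ)) ^ n * D) := by
    intro n hn
    have hn0 : (0 : ℝ) < n := by exact_mod_cast hn
    have h := weighted_adversary_le hA hc hn (η := D / n) (r := 1 - 1 / n) (div_pos hD hn0)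
      (by rw [← hDM]; field_simp) rfl
    rw [max_eq_left hone, ← hDM] at h
    rwa [neg_div, ← sub_eq_add_neg]
  have hlim0 : Tendsto (fun n : ℕ => D / (n : ℝ)) atTop (𝓝 0) :=
    tendsto_const_div_atTop_nhds_zero_nat _
  have hexp := Real.tendsto_one_add_div_pow_exp (-1)
  have hleft : Tendsto (fun n : ℕ => M.Δ - D / (n : ℝ)) atTop (𝓝 (M.Δ - 0)) :=
    tendsto_const_nhds.sub hlim0
  have hright : Tendsto (fun n : ℕ => c * (D / n + M.Δ - (1 + (-1) / (n : ℝ)) ^ n * D)) atTop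
      (𝓝 (c * (0 + M.Δ - Real.exp (-1) * D))) :=
    ((hlim0.add_const _).sub (hexp.mul_const _)).const_mul _
  have h := le_of_tendsto_of_tendsto hleft hright
    (eventually_atTop.mpr ⟨1, fun n hn => key n hn⟩)
  rw [sub_zero, zero_add, Real.exp_neg, hDM] at h
  have hE := Real.exp_pos 1
  have h1 : c * (M.Δ - (Real.exp 1)⁻¹ * ((1 - M.α) * M.Δ)) =
      c * (Real.exp 1 - 1 + M.α) * M.Δ / Real.exp 1 := by
    field_simp
    ring
  rw [h1, le_div_iff₀ hE] at h
  rw [div_le_iff₀ hq]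
  have h2 : Real.exp 1 * M.Δ ≤ c * (Real.exp 1 - 1 + M.α) * M.Δ := by linarith
  exact le_of_mul_le_mul_right h2 hΔ

/-! ### Competitiveness and optimality of the algorithms -/

theorem theorem3 (M : Model) :
    -- A1
    (IsOnline M (algA1 M) ∧
      IsCompetitive M ((algA1 M).cost M) (2 - M.α) ∧
      IsCompetitiveUpToBoundary M ((algA1 M).cost M) (2 - M.α)) ∧
    -- A2 and A3 differ only in the law of the waiting times
    IsRandomizedOnline M (waitPolicy M) ∧
    -- A2
    (IsCompetitive M (expectedCost M (waitTimes (lawA2 M)) (waitPolicy M))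
        ((Real.exp 1 - M.α) / (Real.exp 1 - 1)) ∧
      IsCompetitiveUpToBoundary M (expectedCost M (waitTimes (lawA2 M)) (waitPolicy M))
        ((Real.exp 1 - M.α) / (Real.exp 1 - 1))) ∧
    -- A3
    (IsCompetitive M (expectedCost M (waitTimes (lawA3 M)) (waitPolicy M))
        (Real.exp 1 / (Real.exp 1 - 1 + M.α)) ∧
      IsCompetitiveUpToBoundary M (expectedCost M (waitTimes (lawA3 M)) (waitPolicy M))
        (Real.exp 1 / (Real.exp 1 - 1 + M.α))) ∧
    -- no deterministic online algorithm does better than A1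
    (∀ A : Policy, IsOnline M A → ∀ c : ℝ, IsCompetitive M (A.cost M) c → 2 - M.α ≤ c) ∧
    -- no randomized online algorithm does better than A3
    (∀ (Ω : Type u) [MeasurableSpace Ω] (μ : Measure Ω) [IsProbabilityMeasure μ]
      (A : Ω → Policy), IsRandomizedOnline M A →
      ∀ c : ℝ, IsCompetitive M (expectedCost M μ A) c →
        Real.exp 1 / (Real.exp 1 - 1 + M.α) ≤ c) := by
  refine ⟨⟨isOnline_waitPolicy M _, ?_, isCompetitiveUpToBoundary_algA1 M⟩,
    isRandomizedOnline_waitPolicy M, ⟨?_, isCompetitiveUpToBoundary_lawA2 M⟩,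
    ⟨?_, isCompetitiveUpToBoundary_lawA3 M⟩, ?_, ?_⟩
  · exact (isCompetitiveUpToBoundary_algA1 M).isCompetitive
  · exact (isCompetitiveUpToBoundary_lawA2 M).isCompetitive
  · exact (isCompetitiveUpToBoundary_lawA3 M).isCompetitive
  · exact fun A hA c hc => two_sub_le_of_isCompetitive hA hc
  · intro Ω _ μ _ A hA c hc
    exact le_of_isCompetitive_expectedCost hA hc
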